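/- Let $p>1$, $\Phi(m)=m(m-1)(m-2)(m-3)$, $a=\frac4{p-1}$. Consider the ODE $$-f''''-\tfrac14\,y f'-\tfrac1{p-1}f+|f|^{p-1}f=0. \qquad (1)$$ A (fixed-sign) blow-up solution with blow-up point $y_0\in\mathbb R$ is a classical solution $f$ of (1) on some interval $(y_0,b)$ with $|f(y)|\to\infty$ and $f''''=|f|^{p-1}f\,(1+o(1))$ as $y\to y_0^+$. For $y_1>y_0$ let $B(y_0,y_1)\subset\mathbb R^4$ be the set of Cauchy data $(f,f',f'',f''')(y_1)$ of blow-up solutions with blow-up point $y_0$ that are defined on an interval $(y_0,b)$ with $b>y_1$, and let $B(y_0,y_1)=\emptyset$ if $y_1\le y_0$. 1. With $A_0=\Phi(-a)^{1/(p-1)}>0$, the profile $f_0(y)=A_0(y-y_0)^{-a}$ satisfies $A_0^{p-1}=\Phi(-a)$ and solves $f''''=|f|^{p-1}f$ for $y>y_0$. The linearization of $f''''-|f|^{p-1}f$ about $f_0$ is $Y\mapsto Y''''-p\,\Phi(-a)(y-y_0)^{-4}Y$. For $m\in\mathbb C$ the function $Y=(y-y_0)^m$ solves Euler's equation $(y-y_0)^4Y''''=p\,\Phi(-a)Y$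 on $y>y_0$ if and only if $\Phi(m)=p\,\Phi(-a)$. 2. The complex roots of $\Phi(m)=p\,\Phi(-a)$ are exactly $m_+$, $m_-$, $\frac32+i\omega$, $\frac32-i\omega$, where $m_\pm$ are real, $m_+>3$, $m_-<-a$, and $\omega>0$. The real solutions $Y$ of Euler's equation on $(y_0,\infty)$ with $Y=o(f_0)$ as $y\to y_0^+$ are exactly the functions $$C_1(y-y_0)^{m_+}+(y-y_0)^{3/2}\big[C_2\cos(\omega\ln(y-y_0))+C_3\sin(\omega\ln(y-y_0))\big],\qquad C_1,C_2,C_3\in\mathbb R.$$ 3. For fixed $y_0$ and $y_1>y_0$ let $W(y_0,y_1)$ be the set of Cauchy data at $y_1$ of the solutions of (1) on intervals $(y_0,b)$, $b>y_1$, with $f^{(i)}(y)/f_0^{(i)}(y)\to1$ as $y\to y_0^+$ for $i=0,1,2,3$ (the stable manifold of $f_0$). Then $W(y_0,y_1)$ is nonempty for all $y_1>y_0$ close enough to $y_0$. For all $y_1>y_0$, $W(y_0,y_1)$ and $B(y_0,y_1)$ are embedded $C^1$ submanifolds of $\mathbb R^4$ of dimension $3$ (possibly empty if $y_1$ is not close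 to $y_0$), and $B(y_0,y_1)=W(y_0,y_1)\cup(-W(y_0,y_1))$. 4. The set of all blow-up solutions is four-dimensional, and $y_0$ is one of the parameters: for every $y_1\in\mathbb R$ the set $\bigcup_{y_0}B(y_0,y_1)$ is a $4$-dimensional $C^1$ submanifold (i.e. an open subset) of $\mathbb R^4$, and each of its points has a neighbourhood with $C^1$ coordinates whose first coordinate, at each point of the neighbourhood, is the blow-up point $y_0$ of the corresponding solution. -/

import Mathlib

open Set Filter Topology Asymptotics

noncomputable section

/-- The quartic `Φ(m) = m (m - 1) (m - 2) (m - 3)`. -/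
def eulerPhi {R : Type*} [CommRing R] (m : R) : R := m * (m - 1) * (m - 2) * (m - 3)

/-- The amplitude `A₀ = Φ(-4/(p-1))^{1/(p-1)}`. -/
def blowUpAmp (p : ℝ) : ℝ := (eulerPhi (-(4 / (p - 1)))) ^ (1 / (p - 1))

/-- The explicit profile `f₀(y) = A₀ (y - y₀)^{-4/(p-1)}`, used for `y > y₀`. -/
def blowUpProfile (p y₀ : ℝ) (y : ℝ) : ℝ := blowUpAmp p * (y - y₀) ^ (-(4 / (p - 1)))

/-- `f` is a classical solution on the open interval `(a, b)` of
`-f'''' - y f' / 4 - f / (p - 1) + |f|^{p-1} f = 0`. -/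
def SolvesSimilarityODE (p a b : ℝ) (f : ℝ → ℝ) : Prop :=
  ContDiffOn ℝ 4 f (Ioo a b) ∧
    ∀ y ∈ Ioo a b,
      -iteratedDeriv 4 f y - (1 / 4) * y * deriv f y - (1 / (p - 1)) * f y
        + |f y| ^ (p - 1) * f y = 0

/-- `f` is a solution on `(y₀, b)` which blows up with a fixed sign as `y → y₀⁺`
(`f` is continuous, so `|f| → ∞` means `f → +∞` or `f → -∞`), with
`f'''' = |f|^{p-1} f (1 + o(1))` as `y → y₀⁺`. -/
def IsBlowUpSolution (p y₀ b : ℝ) (f : ℝ → ℝ) : Prop :=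
  SolvesSimilarityODE p y₀ b f ∧
    Tendsto (fun y => |f y|) (𝓝[>] y₀) atTop ∧
    iteratedDeriv 4 f ~[𝓝[>] y₀] fun y => |f y| ^ (p - 1) * f y

/-- The Cauchy data `(f, f', f'', f''')` at `y₁`. -/
def cauchyData (f : ℝ → ℝ) (y₁ : ℝ) : Fin 4 → ℝ := fun i => iteratedDeriv i f y₁

/-- The Cauchy data at `y₁` of all solutions that exist on `(y₀, y₁]` (hence a little beyond `y₁`)
and blow up at `y₀ < y₁`. Cauchy data at `y₁` are the coordinates of the solution there, so this
is the set of blow-up solutions with blow-up point `y₀`, among the solutions defined at `y₁`. -/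
def blowUpData (p y₀ y₁ : ℝ) : Set (Fin 4 → ℝ) :=
  {z | ∃ (b : ℝ) (f : ℝ → ℝ), y₁ ∈ Ioo y₀ b ∧ IsBlowUpSolution p y₀ b f ∧ z = cauchyData f y₁}

/-- The stable manifold of the profile `f₀` for fixed `y₀`, seen in the phase space at `y₁`: the
Cauchy data at `y₁` of the solutions on `(y₀, y₁]` that approach `f₀` in phase space as `y → y₀⁺`,
`f⁽ⁱ⁾(y) / f₀⁽ⁱ⁾(y) → 1` for `i = 0, 1, 2, 3`. -/
def profileStableSet (p y₀ y₁ : ℝ) : Set (Fin 4 → ℝ) :=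
  {z | ∃ (b : ℝ) (f : ℝ → ℝ), y₁ ∈ Ioo y₀ b ∧ SolvesSimilarityODE p y₀ b f ∧
    (∀ i : Fin 4, iteratedDeriv i f ~[𝓝[>] y₀] iteratedDeriv i (blowUpProfile p y₀)) ∧
    z = cauchyData f y₁}

/-- A local `C¹` diffeomorphism between open subsets of `ℝⁿ`. -/
def IsC1Chart {n : ℕ} (e : OpenPartialHomeomorph (Fin n → ℝ) (Fin n → ℝ)) : Prop :=
  ContDiffOn ℝ 1 e e.source ∧ ContDiffOn ℝ 1 e.symm e.target

/-- `S` is an embedded `k`-dimensional `C¹` submanifold of `ℝⁿ` (slice charts). -/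
def IsC1Submanifold {n : ℕ} (k : ℕ) (S : Set (Fin n → ℝ)) : Prop :=
  k ≤ n ∧ ∀ x ∈ S, ∃ e : OpenPartialHomeomorph (Fin n → ℝ) (Fin n → ℝ),
    x ∈ e.source ∧ IsC1Chart e ∧
      ∀ z ∈ e.source, z ∈ S ↔ ∀ i : Fin n, k ≤ (i : ℕ) → e z i = 0

/-- `Y` solves Euler's equation `(y - y₀)⁴ Y'''' = p Φ(-4/(p-1)) Y` for `y > y₀`. -/
def SolvesEuler (p y₀ : ℝ) (Y : ℝ → ℝ) : Prop :=
  ContDiffOn ℝ 4 Y (Ioi y₀) ∧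
    ∀ y ∈ Ioi y₀, (y - y₀) ^ 4 * iteratedDeriv 4 Y y = p * eulerPhi (-(4 / (p - 1))) * Y y

end

/-! The powers are elementary: `Φ` is a polynomial in `(m - 3/2)²`, and `p a = a + 4` gives `p Φ(-a)
= Φ(a + 4)`, so the quartic splits explicitly. First integrals, one per root, then yield all
solutions of Euler's equation.

The nonlinear part rests on one change of variables. For a positive solution write `f = A₀ H ^
(-a)`, let `V₁, V₂, V₃` be the derivatives of `f` divided by those of the profile at distance `H`
from its singularity, and let time run by `dy = -H dt`. The equation becomes an autonomous
polynomial system in `(V₁, V₂, V₃, H, y)` (`IsDesingularized`), and approaching the profile becomes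
convergence to a point `(1, 1, 1, 0, y₀)` of a line of equilibria. Transversally to the line the
eigenvalues are `-(2a+4)` and `-(a+3/2) ± iω`, coming from the three Euler modes that are `o(f₀)`,
and `-1`, coming from `H`. The remaining root `-a-1` corresponds to moving `y₀`, that is, to moving
along the line. So the line attracts, and `exists_asymptoticPhase`, an inverse function argument on
exponentially weighted bounded functions, makes the limit point `T` a `C¹` function of the initial
state, equal to the identity on the line.

Hence near `y₀` the blow-up point is a `C¹` function `G(w, y)` of the data `w` at position `y`. Its
derivative in `y` alone is nonzero, because `T` is the identity on the line, while `G` is constant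
along the solution. Therefore its derivative in `w` along the vector field is nonzero, and `G(·, y)`
is a submersion (`exists_contDiffAt_blowUpPoint`). The `C¹` flow (`exists_flow`) carries this to any
`y₁` where the solution is defined. Since the blow-up point is unique, the stable set for fixed `y₀`
is locally a level set of a submersion, and the union over `y₀` is open with the blow-up point as a
coordinate.

It remains to see that every blow-up solution follows the profile up to sign, with no a priori
bounds (`IsBlowUpSolution.isEquivalent`). For a positive one the derivatives alternate in sign, so
`-log H` is an admissible time. The normalized form of `f' f''' - f''² / 2` satisfies a scalar
linear equation and converges. This leaves an asymptotically planar system, for which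
`tendsto_normalized` has a coercive Lyapunov function. -/

open scoped BoundedContinuousFunction

noncomputable section

/-! ### Integral operators and local inversion on bounded continuous functions. -/

/-- The operator `N ↦ α(θ(t)) ∫₀^{θ(t)} k N` on bounded continuous functions. -/
lemma exists_weightedPrimitive {𝕜 : Type*} [RCLike 𝕜] {θ : ℝ → ℝ} (hθ : Continuous θ)
    {α k : ℝ → 𝕜} (hα : Continuous α) (hk : Continuous k) {C : ℝ} (hC0 : 0 ≤ C)
    (hC : ∀ t, ‖α (θ t)‖ * |∫ σ in (0)..(θ t), ‖k σ‖| ≤ C) :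
    ∃ S : (ℝ →ᵇ 𝕜) →L[ℝ] (ℝ →ᵇ 𝕜), ‖S‖ ≤ C ∧
      ∀ N t, S N t = α (θ t) * ∫ σ in (0)..(θ t), k σ * N σ := by
  have hint : ∀ (N : ℝ →ᵇ 𝕜) (x y : ℝ),
      IntervalIntegrable (fun σ => k σ * N σ) MeasureTheory.volume x y := fun N x y =>
    (hk.mul N.continuous).intervalIntegrable x y
  have hbound : ∀ (N : ℝ →ᵇ 𝕜) (t : ℝ),
      ‖α (θ t) * ∫ σ in (0)..(θ t), k σ * N σ‖ ≤ C * ‖N‖ := by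
    intro N t
    rw [norm_mul]
    have h1 : ‖∫ σ in (0)..(θ t), k σ * N σ‖ ≤ |∫ σ in (0)..(θ t), ‖k σ‖| * ‖N‖ := by
      calc ‖∫ σ in (0)..(θ t), k σ * N σ‖
          ≤ |∫ σ in (0)..(θ t), ‖k σ‖ * ‖N‖| := by
            apply intervalIntegral.norm_integral_le_abs_of_norm_le
            · filter_upwards with σ
              rw [norm_mul]
              exact mul_le_mul_of_nonneg_left (N.norm_coe_le_norm σ) (norm_nonneg _)
            · exact (hk.norm.mul continuous_const).intervalIntegrable _ _
        _ = |∫ σ in (0)..(θ t), ‖k σ‖| * ‖N‖ := by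
            rw [intervalIntegral.integral_mul_const, abs_mul, abs_of_nonneg (norm_nonneg N)]
    calc _ ≤ ‖α (θ t)‖ * (|∫ σ in (0)..(θ t), ‖k σ‖| * ‖N‖) :=
          mul_le_mul_of_nonneg_left h1 (norm_nonneg _)
      _ = (‖α (θ t)‖ * |∫ σ in (0)..(θ t), ‖k σ‖|) * ‖N‖ := by ring
      _ ≤ C * ‖N‖ := mul_le_mul_of_nonneg_right (hC t) (norm_nonneg _)
  have hcont : ∀ N : ℝ →ᵇ 𝕜, Continuous fun t => α (θ t) * ∫ σ in (0)..(θ t), k σ * N σ := by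
    intro N
    have h2 : Continuous fun τ : ℝ => ∫ σ in (0)..τ, k σ * N σ :=
      intervalIntegral.continuous_primitive (hint N) 0
    exact (hα.comp hθ).mul (h2.comp hθ)
  let f : (ℝ →ᵇ 𝕜) → (ℝ →ᵇ 𝕜) := fun N =>
    BoundedContinuousFunction.ofNormedAddCommGroup _ (hcont N) (C * ‖N‖) (hbound N)
  let l : (ℝ →ᵇ 𝕜) →ₗ[ℝ] (ℝ →ᵇ 𝕜) :=
    { toFun := f
      map_add' := by
        intro N M
        ext t
        simp only [f, BoundedContinuousFunction.coe_ofNormedAddCommGroup,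
          BoundedContinuousFunction.coe_add, Pi.add_apply, mul_add]
        rw [intervalIntegral.integral_add (hint N _ _) (hint M _ _), mul_add]
      map_smul' := by
        intro r N
        ext t
        simp only [f, BoundedContinuousFunction.coe_ofNormedAddCommGroup,
          BoundedContinuousFunction.coe_smul, RingHom.id_apply, mul_smul_comm]
        rw [intervalIntegral.integral_smul, mul_smul_comm] }
  refine ⟨l.mkContinuous C fun N => ?_, LinearMap.mkContinuous_norm_le _ hC0 _, fun N t => rfl⟩
  exact (BoundedContinuousFunction.norm_le (by positivity)).2 (hbound N)

/-- The solution operators `S` (forcing) and `E` (initial value) of `w' = c w + N`, `w(0) = z`, on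
bounded functions, where `e` is the exponential `t ↦ exp(c t)` and `Re c = -l < 0`. -/
lemma exists_duhamel {𝕜 : Type*} [RCLike 𝕜] {θ : ℝ → ℝ} (hθ : Continuous θ) {κ l : ℝ}
    (hl : 0 < l) (hκ : 0 ≤ κ) (hθκ : ∀ t, -κ ≤ θ t) {c : 𝕜} {e : ℝ → 𝕜} (he0 : e 0 = 1)
    (hinv : ∀ t, e t * e (-t) = 1) (hd : ∀ t, HasDerivAt e (c * e t) t)
    (hn : ∀ t, ‖e t‖ = Real.exp (-(l * t))) :
    ∃ (S : (ℝ →ᵇ 𝕜) →L[ℝ] (ℝ →ᵇ 𝕜)) (E : 𝕜 →L[ℝ] (ℝ →ᵇ 𝕜)), ‖S‖ ≤ Real.exp (l * κ) / l ∧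
      (∀ z t, E z t = z * e (θ t)) ∧
      (∀ (N w : ℝ →ᵇ 𝕜) z, w = E z + S N →
        (∀ t, θ t = 0 → w t = z) ∧
        ∀ t, (∀ᶠ s in 𝓝 t, θ s = s) → HasDerivAt w (c * w t + N t) t) ∧
      ∀ (N w : ℝ →ᵇ 𝕜) (v : ℝ → 𝕜), (∀ t, w t = v (θ t)) →
        (∀ t, ∀ τ ∈ uIcc 0 (θ t), HasDerivAt v (c * v τ + N τ) τ) → w = E (v 0) + S N := by
  have hec : Continuous e := continuous_iff_continuousAt.2 fun t => (hd t).continuousAt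
  have hkc : Continuous fun σ => e (-σ) := hec.comp continuous_neg
  have hle : ∀ t, Real.exp (-(l * θ t)) ≤ Real.exp (l * κ) := fun t =>
    Real.exp_le_exp.2 (by nlinarith [hθκ t])
  -- Weight times integral is `|1 - exp(-l θ)| / l`, at most `exp(l κ) / l` because `θ ≥ -κ`.
  obtain ⟨S, hS, hSN⟩ := exists_weightedPrimitive (α := e) (k := fun σ => e (-σ)) hθ hec hkc
    (C := Real.exp (l * κ) / l) (by positivity) (by
      intro t
      have h1 : ∀ τ : ℝ, ∫ σ in (0)..τ, ‖e (-σ)‖ = (Real.exp (l * τ) - 1) / l := by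
        intro τ
        have : ∀ σ : ℝ, ‖e (-σ)‖ = Real.exp (l * σ) := by intro σ; rw [hn]; congr 1; ring
        simp_rw [this]
        rw [intervalIntegral.integral_comp_mul_left (fun x => Real.exp x) hl.ne', integral_exp,
          mul_zero, Real.exp_zero, smul_eq_mul, inv_mul_eq_div]
      rw [h1, hn, abs_div, abs_of_pos hl, ← mul_div_assoc]
      apply div_le_div_of_nonneg_right _ hl.le
      rw [← abs_of_pos (Real.exp_pos (-(l * θ t))), ← abs_mul, mul_sub, ← Real.exp_add]
      have h3 : (1:ℝ) ≤ Real.exp (l * κ) := Real.one_le_exp (by positivity)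
      rw [show -(l * θ t) + l * θ t = 0 by ring, Real.exp_zero, abs_le]
      constructor <;> linarith [Real.exp_pos (-(l * θ t)), hle t])
  let E₁ : ℝ →ᵇ 𝕜 := BoundedContinuousFunction.ofNormedAddCommGroup (fun t => e (θ t))
    (hec.comp hθ) (Real.exp (l * κ)) (fun t => by rw [hn]; exact hle t)
  let E : 𝕜 →L[ℝ] (ℝ →ᵇ 𝕜) :=
    ((ContinuousLinearMap.id 𝕜 𝕜).smulRight E₁).restrictScalars ℝ
  have hE : ∀ z t, E z t = z * e (θ t) := fun z t => rfl
  refine ⟨S, E, hS, hE, fun N w z hw => ⟨fun t h => ?_, fun t ht => ?_⟩,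
    fun N w v hwv hv => ?_⟩
  · rw [hw, BoundedContinuousFunction.add_apply, hE, hSN, h, he0]
    simp
  · have hSe : w =ᶠ[𝓝 t] fun s => z * e s + e s * ∫ σ in (0)..s, e (-σ) * N σ := by
      filter_upwards [ht] with s hs
      rw [hw, BoundedContinuousFunction.add_apply, hE, hSN, hs]
    have hI : HasDerivAt (fun s => ∫ σ in (0)..s, e (-σ) * N σ) (e (-t) * N t) t :=
      have hc : Continuous fun σ => e (-σ) * N σ := hkc.mul N.continuous
      intervalIntegral.integral_hasDerivAt_right (hc.intervalIntegrable _ _)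
        (hc.stronglyMeasurableAtFilter _ _) hc.continuousAt
    have := (((hd t).const_mul z).add ((hd t).mul hI)).congr_of_eventuallyEq hSe
    have h1 : c * w t + N t =
        z * (c * e t) + ((c * e t * ∫ σ in (0)..t, e (-σ) * N σ) + e t * (e (-t) * N t)) := by
      rw [hSe.self_of_nhds]
      linear_combination (- N t) * hinv t
    rwa [h1]
  · ext t
    -- Variation of constants: differentiating `e(-τ) v(τ)` leaves only the forcing, and integration
    -- from `0` to `θ t` gives the formula.
    have h1 : ∀ τ ∈ uIcc 0 (θ t), HasDerivAt (fun τ => e (-τ) * v τ) (e (-τ) * N τ) τ := by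
      intro τ hτ
      have h2 : HasDerivAt (fun τ => e (-τ)) (-(c * e (-τ))) τ := by
        have h3 : HasDerivAt (fun τ => e (-τ)) ((-1 : ℝ) • (c * e (-τ))) τ :=
          (hd (-τ)).scomp τ (hasDerivAt_neg τ)
        exact h3.congr_deriv (by simp)
      refine (h2.mul (hv t τ hτ)).congr_deriv ?_
      ring
    have h2 := intervalIntegral.integral_eq_sub_of_hasDerivAt h1
      ((hkc.mul N.continuous).intervalIntegrable _ _)
    rw [BoundedContinuousFunction.add_apply, hE, hSN, h2, hwv, neg_zero, he0]
    linear_combination -v (θ t) * hinv (θ t)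

/-- `id - R` is locally invertible where the derivative of `R` is a contraction. -/
lemma exists_localInverse_id_sub {Y : Type*} [NormedAddCommGroup Y] [NormedSpace ℝ Y]
    [CompleteSpace Y] {R : Y → Y} {b : Y} (hR : ContDiffAt ℝ 1 R b) {R' : Y →L[ℝ] Y}
    (hd : HasFDerivAt R R' b) (hn : ‖R'‖ < 1) :
    ∃ σ : Y → Y, ContDiffAt ℝ 1 σ (b - R b) ∧ σ (b - R b) = b ∧
      (∀ᶠ z in 𝓝 (b - R b), σ z - R (σ z) = z) ∧ ∀ᶠ x in 𝓝 b, σ (x - R x) = x := by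
  -- A Neumann series makes `1 - R'` invertible, as the inverse function theorem requires.
  let U : (Y →L[ℝ] Y)ˣ := Units.oneSub R' hn
  let e : Y ≃L[ℝ] Y := ContinuousLinearEquiv.unitsEquiv ℝ Y U
  have he : (e : Y →L[ℝ] Y) = ContinuousLinearMap.id ℝ Y - R' := rfl
  have hc : ContDiffAt ℝ 1 (fun x => x - R x) b := contDiffAt_id.sub hR
  have hd' : HasFDerivAt (fun x => x - R x) (e : Y →L[ℝ] Y) b := by
    rw [he]; exact (hasFDerivAt_id b).sub hd
  let Φ := hc.toOpenPartialHomeomorph (fun x => x - R x) hd' one_ne_zero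
  have hb : b ∈ Φ.source := hc.mem_toOpenPartialHomeomorph_source hd' one_ne_zero
  have hΦ : ∀ x, Φ x = x - R x := fun x => rfl
  refine ⟨Φ.symm, hc.to_localInverse hd' one_ne_zero, Φ.left_inv hb, ?_, ?_⟩
  · have : Φ.target ∈ 𝓝 (b - R b) := Φ.open_target.mem_nhds (Φ.map_source hb)
    filter_upwards [this] with z hz
    exact Φ.right_inv hz
  · filter_upwards [Φ.open_source.mem_nhds hb] with x hx
    exact Φ.left_inv hx

/-! ### Superposition operators. -/

/-- The superposition operator `u ↦ g ∘ u` on bounded continuous real functions. -/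
def superpose (g : ℝ → ℝ) (hg : Continuous g) (u : ℝ →ᵇ ℝ) : ℝ →ᵇ ℝ :=
  BoundedContinuousFunction.ofNormedAddCommGroup (fun t => g (u t)) (hg.comp u.continuous)
    (sSup ((fun x => ‖g x‖) '' Icc (-‖u‖) ‖u‖)) (by
      intro t
      apply le_csSup
      · exact (isCompact_Icc.image hg.norm).bddAbove
      · refine ⟨u t, ?_, rfl⟩
        have := u.norm_coe_le_norm t
        rwa [Real.norm_eq_abs, abs_le] at this)

@[simp] lemma superpose_apply (g : ℝ → ℝ) (hg : Continuous g) (u : ℝ →ᵇ ℝ) (t : ℝ) :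
    superpose g hg u t = g (u t) := rfl

/-- Uniform continuity on `[-(R+1), R+1]`; taking `δ ≤ 1` keeps `y` in that interval. The uniform
`δ` is what turns pointwise estimates into sup norm estimates. -/
lemma exists_delta_superpose {g : ℝ → ℝ} (hg : Continuous g) (R : ℝ) {ε : ℝ} (hε : 0 < ε) :
    ∃ δ > 0, ∀ x y : ℝ, |x| ≤ R → |y - x| < δ → |g y - g x| < ε := by
  have hK : IsCompact (Icc (-(R + 1)) (R + 1)) := isCompact_Icc
  have hu := hK.uniformContinuousOn_of_continuous hg.continuousOn
  rw [Metric.uniformContinuousOn_iff] at hu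
  obtain ⟨δ, hδ, h⟩ := hu ε hε
  refine ⟨min δ 1, by positivity, fun x y hx hxy => ?_⟩
  have h1 := lt_of_lt_of_le hxy (min_le_right _ _)
  have h2 := lt_of_lt_of_le hxy (min_le_left _ _)
  rw [abs_le] at hx
  rw [abs_lt] at h1
  exact h y ⟨by linarith, by linarith⟩ x ⟨by linarith, by linarith⟩ h2

lemma continuous_superpose {g : ℝ → ℝ} (hg : Continuous g) : Continuous (superpose g hg) := by
  rw [Metric.continuous_iff]
  intro u ε hε
  obtain ⟨δ, hδ, h⟩ := exists_delta_superpose hg ‖u‖ (half_pos hε)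
  refine ⟨δ, hδ, fun v hv => ?_⟩
  refine lt_of_le_of_lt ((BoundedContinuousFunction.dist_le (half_pos hε).le).2 fun t => ?_)
    (half_lt_self hε)
  rw [superpose_apply, superpose_apply]
  exact (h (u t) (v t) (u.norm_coe_le_norm t)
    (lt_of_le_of_lt ((v - u).norm_coe_le_norm t) (by rwa [← dist_eq_norm]))).le

/-- The range of `u` is bounded, so `g'` oscillates little near `u t`, uniformly in `t`. The mean
value inequality for `x ↦ g x - g' (u t) x` then makes the remainder `o(‖v‖)` in the sup norm. -/
lemma hasFDerivAt_superpose {g g' : ℝ → ℝ} (hg : Continuous g) (hg' : Continuous g')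
    (hd : ∀ x, HasDerivAt g (g' x) x) (u : ℝ →ᵇ ℝ) :
    HasFDerivAt (superpose g hg) (ContinuousLinearMap.mul ℝ (ℝ →ᵇ ℝ) (superpose g' hg' u)) u := by
  rw [hasFDerivAt_iff_isLittleO_nhds_zero, Asymptotics.isLittleO_iff]
  intro ε hε
  obtain ⟨δ, hδ, h⟩ := exists_delta_superpose hg' ‖u‖ hε
  filter_upwards [Metric.ball_mem_nhds (0 : ℝ →ᵇ ℝ) hδ] with v hv
  rw [mem_ball_zero_iff] at hv
  refine (BoundedContinuousFunction.norm_le (by positivity)).2 fun t => ?_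
  have hvt : ‖v t‖ ≤ ‖v‖ := v.norm_coe_le_norm t
  simp only [BoundedContinuousFunction.coe_sub, BoundedContinuousFunction.coe_add, Pi.sub_apply,
    superpose_apply, Pi.add_apply, ContinuousLinearMap.mul_apply',
    BoundedContinuousFunction.coe_mul, Pi.mul_apply]
  have key := Convex.norm_image_sub_le_of_norm_hasDerivWithin_le
    (f := fun x => g x - g' (u t) * x) (f' := fun x => g' x - g' (u t) * 1)
    (s := Metric.ball (u t) δ) (C := ε) (x := u t) (y := u t + v t)
    (fun x _ => ((hd x).sub ((hasDerivAt_id x).const_mul (g' (u t)))).hasDerivWithinAt)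
    (fun x hx => by
      rw [mul_one]
      exact (h (u t) x (u.norm_coe_le_norm t) hx).le)
    (convex_ball _ _) (Metric.mem_ball_self hδ) (by simpa using lt_of_le_of_lt hvt hv)
  have e1 : g (u t + v t) - g (u t) - g' (u t) * v t =
      (g (u t + v t) - g' (u t) * (u t + v t)) - (g (u t) - g' (u t) * u t) := by ring
  rw [e1]
  refine key.trans ?_
  rw [add_sub_cancel_left]
  exact mul_le_mul_of_nonneg_left hvt hε.le

lemma contDiff_superpose {g g' : ℝ → ℝ} (hg : Continuous g) (hg' : Continuous g')
    (hd : ∀ x, HasDerivAt g (g' x) x) : ContDiff ℝ 1 (superpose g hg) := by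
  rw [contDiff_one_iff_fderiv]
  refine ⟨fun u => (hasFDerivAt_superpose hg hg' hd u).differentiableAt, ?_⟩
  have : fderiv ℝ (superpose g hg) =
      fun u => ContinuousLinearMap.mul ℝ (ℝ →ᵇ ℝ) (superpose g' hg' u) := by
    ext1 u
    exact (hasFDerivAt_superpose hg hg' hd u).fderiv
  rw [this]
  exact (ContinuousLinearMap.mul ℝ (ℝ →ᵇ ℝ)).continuous.comp (continuous_superpose hg')

/-! ### The desingularized system and its asymptotic phase. -/

/-- The time of the desingularized system, frozen before `-1`. -/
def clampTime (t : ℝ) : ℝ := max t (-1)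

lemma continuous_clampTime : Continuous clampTime := continuous_id.max continuous_const

lemma neg_one_le_clampTime (t : ℝ) : -1 ≤ clampTime t := le_max_right _ _

lemma clampTime_eventually {t : ℝ} (ht : -1 < t) : ∀ᶠ s in 𝓝 t, clampTime s = s := by
  filter_upwards [lt_mem_nhds ht] with s hs
  exact max_eq_left hs.le

lemma clampTime_zero : clampTime 0 = 0 := max_eq_left (by norm_num)

/-- The decaying weight `exp(-t/2)`. -/
def decayWeight : ℝ →ᵇ ℝ :=
  BoundedContinuousFunction.ofNormedAddCommGroup (fun t => Real.exp (-(1 / 2 * clampTime t)))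
    (by have := continuous_clampTime; fun_prop) (Real.exp (1 / 2)) (fun t => by
      rw [Real.norm_eq_abs, Real.abs_exp]
      exact Real.exp_le_exp.2 (by linarith [neg_one_le_clampTime t]))

lemma decayWeight_apply (t : ℝ) : decayWeight t = Real.exp (-(1 / 2 * clampTime t)) := rfl

lemma hasDerivAt_decayWeight {t : ℝ} (ht : -1 < t) :
    HasDerivAt decayWeight (-(1 / 2) * decayWeight t) t := by
  have h1 : decayWeight =ᶠ[𝓝 t] fun s => Real.exp (-(1 / 2 * s)) := by
    filter_upwards [clampTime_eventually ht] with s hs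
    rw [decayWeight_apply, hs]
  have h2 : HasDerivAt (fun s : ℝ => Real.exp (-(1 / 2 * s)))
      (Real.exp (-(1 / 2 * t)) * (-(1 / 2 * 1))) t :=
    (((hasDerivAt_id t).const_mul (1 / 2 : ℝ)).neg).exp
  rw [h1.self_of_nhds]
  refine (h2.congr_of_eventuallyEq h1).congr_deriv ?_
  ring

lemma tendsto_decayWeight : Tendsto decayWeight atTop (𝓝 0) := by
  have h : (fun s : ℝ => Real.exp (-(1 / 2 * s))) =ᶠ[atTop] decayWeight := by
    filter_upwards [eventually_ge_atTop (-1 : ℝ)] with s hs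
    rw [decayWeight_apply, clampTime, max_eq_left hs]
  refine Tendsto.congr' h ?_
  exact Real.tendsto_exp_neg_atTop_nhds_zero.comp
    (tendsto_id.const_mul_atTop (by norm_num : (0:ℝ) < 1 / 2))

lemma tendsto_decayWeight_mul (u : ℝ →ᵇ ℝ) :
    Tendsto (fun t => decayWeight t * u t) atTop (𝓝 0) := by
  apply tendsto_decayWeight.zero_mul_isBoundedUnder_le
  exact isBoundedUnder_of ⟨‖u‖, fun t => u.norm_coe_le_norm t⟩

/-- The weighted primitive together with its limit at infinity. -/
lemma exists_weightedIntegral :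
    ∃ (J : (ℝ →ᵇ ℝ) →L[ℝ] (ℝ →ᵇ ℝ)) (J₁ : (ℝ →ᵇ ℝ) →L[ℝ] ℝ),
      (∀ u, Tendsto (J u) atTop (𝓝 (J₁ u))) ∧ (∀ u, J u 0 = 0) ∧
      ∀ u t, -1 < t → HasDerivAt (J u) (decayWeight t * u t) t := by
  have hexp : Continuous fun σ : ℝ => Real.exp (-(1 / 2) * σ) := by fun_prop
  have hprim : ∀ τ : ℝ, ∫ σ in (0)..τ, ‖Real.exp (-(1 / 2) * σ)‖ =
      2 * (1 - Real.exp (-(1 / 2) * τ)) := by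
    intro τ
    simp_rw [Real.norm_eq_abs, Real.abs_exp]
    rw [intervalIntegral.integral_comp_mul_left (fun x => Real.exp x) (by norm_num), integral_exp,
      mul_zero, Real.exp_zero, smul_eq_mul]
    ring
  obtain ⟨J, -, hJ⟩ := exists_weightedPrimitive (𝕜 := ℝ) continuous_clampTime
    (α := fun _ => 1) (k := fun σ => Real.exp (-(1 / 2) * σ)) continuous_const hexp
    (C := 2 * Real.exp (1 / 2)) (by positivity) (by
      intro t
      have h1 : Real.exp (-(1 / 2) * clampTime t) ≤ Real.exp (1 / 2) :=
        Real.exp_le_exp.2 (by linarith [neg_one_le_clampTime t])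
      have h2 : (1:ℝ) ≤ Real.exp (1 / 2) := Real.one_le_exp (by norm_num)
      rw [norm_one, one_mul, hprim, abs_le]
      constructor <;> linarith [Real.exp_pos (-(1 / 2) * clampTime t)])
  have hI : MeasureTheory.IntegrableOn (fun σ : ℝ => Real.exp (-(1 / 2) * σ)) (Ioi 0) :=
    integrableOn_exp_mul_Ioi (by norm_num) 0
  have hIu : ∀ u : ℝ →ᵇ ℝ,
      MeasureTheory.IntegrableOn (fun σ : ℝ => Real.exp (-(1 / 2) * σ) * u σ) (Ioi 0) := by
    intro u
    refine MeasureTheory.Integrable.mul_bdd (c := ‖u‖) hI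
      u.continuous.aestronglyMeasurable ?_
    exact Eventually.of_forall fun t => u.norm_coe_le_norm t
  let l : (ℝ →ᵇ ℝ) →ₗ[ℝ] ℝ :=
    { toFun := fun u => ∫ σ in Ioi (0:ℝ), Real.exp (-(1 / 2) * σ) * u σ
      map_add' := by
        intro u v
        rw [← MeasureTheory.integral_add (hIu u) (hIu v)]
        congr 1
        ext σ
        simp [mul_add]
      map_smul' := by
        intro r u
        rw [RingHom.id_apply, smul_eq_mul, ← MeasureTheory.integral_const_mul]
        congr 1
        ext σ
        simp
        ring }
  let C := ∫ σ in Ioi (0:ℝ), Real.exp (-(1 / 2) * σ)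
  have hl : ∀ u, ‖l u‖ ≤ C * ‖u‖ := by
    intro u
    refine (MeasureTheory.norm_integral_le_of_norm_le (hI.mul_const ‖u‖) ?_).trans_eq ?_
    · refine Eventually.of_forall fun σ => ?_
      rw [norm_mul, Real.norm_eq_abs, Real.abs_exp]
      exact mul_le_mul_of_nonneg_left (u.norm_coe_le_norm σ) (Real.exp_pos _).le
    · rw [MeasureTheory.integral_mul_const]
  refine ⟨J, l.mkContinuous C hl, fun u => ?_, fun u => ?_, fun u t ht => ?_⟩
  · have h := MeasureTheory.intervalIntegral_tendsto_integral_Ioi 0 (hIu u) tendsto_id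
    refine Tendsto.congr' ?_ h
    filter_upwards [eventually_ge_atTop (-1 : ℝ)] with s hs
    rw [hJ, clampTime, max_eq_left hs, one_mul, id]
  · rw [hJ, clampTime_zero]; simp
  · have hc : Continuous fun σ => Real.exp (-(1 / 2) * σ) * u σ := hexp.mul u.continuous
    have h := intervalIntegral.integral_hasDerivAt_right (hc.intervalIntegrable 0 t)
      (hc.stronglyMeasurableAtFilter _ _) hc.continuousAt
    rw [decayWeight_apply, (clampTime_eventually ht).self_of_nhds, ← neg_mul]
    refine h.congr_of_eventuallyEq ?_
    filter_upwards [clampTime_eventually ht] with s hs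
    rw [hJ, hs, one_mul]

/-- Products of functions vanishing at `b` have zero derivative at `b`. -/
lemma HasFDerivAt.mul_of_eq_zero {Y A : Type*} [NormedAddCommGroup Y] [NormedSpace ℝ Y]
    [NormedCommRing A] [NormedAlgebra ℝ A] {f g : Y → A} {f' g' : Y →L[ℝ] A} {b : Y}
    (hf : HasFDerivAt f f' b) (hg : HasFDerivAt g g' b) (hf0 : f b = 0) (hg0 : g b = 0) :
    HasFDerivAt (fun x => f x * g x) (0 : Y →L[ℝ] A) b := by
  refine (hf.mul hg).congr_fderiv ?_
  ext v
  simp [hf0, hg0]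

/-- The desingularized system in the unknowns `V₁, V₂, V₃, H, y`. -/
structure IsDesingularized (a k : ℝ) (V₁ V₂ V₃ H y : ℝ → ℝ) (t : ℝ) : Prop where
  hV₁ : HasDerivAt V₁ ((a + 1) * (V₂ t - V₁ t * V₁ t)) t
  hV₂ : HasDerivAt V₂ ((a + 2) * (V₃ t - V₁ t * V₂ t)) t
  hV₃ : HasDerivAt V₃ ((a + 3) * (1 + k * (y t * V₁ t * H t ^ 3 - H t ^ 4) - V₁ t * V₃ t)) t
  hH : HasDerivAt H (-(V₁ t * H t)) t
  hy : HasDerivAt y (-H t) t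

/-- Bounded functions of time for the modes with exponents `2a + 4`, `a + 3/2 - iω` and `1`,
and the initial position. -/
abbrev ModeSpace := (ℝ →ᵇ ℝ) × (ℝ →ᵇ ℂ) × (ℝ →ᵇ ℝ) × ℝ

/-- The five quadratic nonlinearities of the desingularized system. -/
abbrev QuadSpace := (ℝ →ᵇ ℝ) × (ℝ →ᵇ ℝ) × (ℝ →ᵇ ℝ) × (ℝ →ᵇ ℝ) × (ℝ →ᵇ ℝ)

/-- The line `V = 1`, `H = 0` of equilibria attracts its neighbourhood, and the limit point
depends on the initial data in a `C¹` way. -/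
theorem exists_asymptoticPhase {a : ℝ} (k : ℝ) (ha : 0 < a) (ys : ℝ) :
    ∃ T : ℝ × ℝ × ℝ × ℝ × ℝ → ℝ, ContDiffAt ℝ 1 T (1, 1, 1, 0, ys) ∧
      (∀ᶠ s in 𝓝 ys, T (1, 1, 1, 0, s) = s) ∧
      ∀ᶠ P in 𝓝 ((1, 1, 1, 0, ys) : ℝ × ℝ × ℝ × ℝ × ℝ), ∃ V₁ V₂ V₃ H y : ℝ → ℝ,
        Continuous V₁ ∧ (V₁ 0, V₂ 0, V₃ 0, H 0, y 0) = P ∧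
        (∀ t, -1 < t → IsDesingularized a k V₁ V₂ V₃ H y t) ∧
        Tendsto V₁ atTop (𝓝 1) ∧ Tendsto V₂ atTop (𝓝 1) ∧ Tendsto V₃ atTop (𝓝 1) ∧
        Tendsto H atTop (𝓝 0) ∧ Tendsto y atTop (𝓝 (T P)) := by
  -- With `V = 1 + X` the linear part is `X₁' = (a+1)(X₂ - 2X₁)`, `X₂' = (a+2)(X₃ - X₁ - X₂)`, `X₃'
  -- = -(a+3)(X₁ + X₃)`, with eigenvalues `-(2a+4)` and `-(a+3/2) ± iω`. All unknowns are divided by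
  -- `exp(-t/2)` below, which lowers each decay rate by `1/2`: hence the rates `2a+7/2`, `a+1`, and
  -- `1/2` for `H`.
  obtain ⟨ω, hω0, hω⟩ : ∃ ω : ℝ, 0 < ω ∧ ω ^ 2 = a ^ 2 + 5 * a + 15 / 4 :=
    ⟨√(a ^ 2 + 5 * a + 15 / 4), Real.sqrt_pos.2 (by positivity), Real.sq_sqrt (by positivity)⟩
  -- solution operators of the three linear equations
  obtain ⟨Sq, Eq, -, hEq, hSq, -⟩ := exists_duhamel (𝕜 := ℝ) continuous_clampTime
    (κ := 1) (l := 2 * a + 7 / 2) (c := -(2 * a + 7 / 2))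
    (e := fun t => Real.exp (-(2 * a + 7 / 2) * t)) (by positivity) zero_le_one
    neg_one_le_clampTime (by simp) (fun t => by rw [← Real.exp_add]; simp)
    (fun t => by
      refine (((hasDerivAt_id t).const_mul (-(2 * a + 7 / 2))).exp).congr_deriv ?_
      simp only [id]; ring)
    (fun t => by rw [Real.norm_eq_abs, Real.abs_exp, neg_mul])
  obtain ⟨SH, EH, -, hEH, hSH, -⟩ := exists_duhamel (𝕜 := ℝ) continuous_clampTime
    (κ := 1) (l := 1 / 2) (c := -(1 / 2))
    (e := fun t => Real.exp (-(1 / 2) * t)) (by positivity) zero_le_one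
    neg_one_le_clampTime (by simp) (fun t => by rw [← Real.exp_add]; simp)
    (fun t => by
      refine (((hasDerivAt_id t).const_mul (-(1 / 2) : ℝ)).exp).congr_deriv ?_
      simp only [id]; ring)
    (fun t => by rw [Real.norm_eq_abs, Real.abs_exp, neg_mul])
  obtain ⟨Sz, Ez, -, hEz, hSz, -⟩ := exists_duhamel (𝕜 := ℂ) continuous_clampTime
    (κ := 1) (l := a + 1) (c := -(a + 1) + ω * Complex.I)
    (e := fun t => Complex.exp ((-(a + 1) + ω * Complex.I) * t)) (by positivity) zero_le_one
    neg_one_le_clampTime (by simp) (fun t => by rw [← Complex.exp_add]; simp)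
    (fun t => by
      have := ((hasDerivAt_id (t : ℂ)).const_mul (-(a + 1) + ω * Complex.I : ℂ)).cexp.comp_ofReal
      refine this.congr_deriv ?_
      simp only [id]; ring)
    (fun t => by rw [Complex.norm_exp]; congr 1; simp; ring)
  obtain ⟨J, J₁, hJlim, hJ0, hJd⟩ := exists_weightedIntegral
  obtain ⟨re, hre⟩ : ∃ L : (ℝ →ᵇ ℂ) →L[ℝ] (ℝ →ᵇ ℝ), ∀ z t, L z t = (z t).re :=
    ⟨Complex.reCLM.compLeftContinuousBounded ℝ, fun _ _ => rfl⟩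
  obtain ⟨im, him⟩ : ∃ L : (ℝ →ᵇ ℂ) →L[ℝ] (ℝ →ᵇ ℝ), ∀ z t, L z t = (z t).im :=
    ⟨Complex.imCLM.compLeftContinuousBounded ℝ, fun _ _ => rfl⟩
  obtain ⟨q, hq⟩ : ∃ L : ModeSpace →L[ℝ] (ℝ →ᵇ ℝ), ∀ x, L x = x.1 :=
    ⟨ContinuousLinearMap.fst ℝ _ _, fun _ => rfl⟩
  obtain ⟨z, hz⟩ : ∃ L : ModeSpace →L[ℝ] (ℝ →ᵇ ℂ), ∀ x, L x = x.2.1 :=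
    ⟨(ContinuousLinearMap.fst ℝ _ _).comp (ContinuousLinearMap.snd ℝ _ _), fun _ => rfl⟩
  obtain ⟨h, hh⟩ : ∃ L : ModeSpace →L[ℝ] (ℝ →ᵇ ℝ), ∀ x, L x = x.2.2.1 :=
    ⟨(ContinuousLinearMap.fst ℝ _ _).comp
      ((ContinuousLinearMap.snd ℝ _ _).comp (ContinuousLinearMap.snd ℝ _ _)), fun _ => rfl⟩
  obtain ⟨s, hs⟩ : ∃ L : ModeSpace →L[ℝ] ℝ, ∀ x, L x = x.2.2.2 :=
    ⟨(ContinuousLinearMap.snd ℝ _ _).comp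
      ((ContinuousLinearMap.snd ℝ _ _).comp (ContinuousLinearMap.snd ℝ _ _)), fun _ => rfl⟩
  -- `q` and `z` are the coordinates given by left eigenvectors (see `hqX`, `hiX`, `hrX`).
  -- Eliminating `X₂` and `X₃` among them leaves `-D X₁`, and the three formulas that follow invert
  -- the change of coordinates.
  obtain ⟨D, hDdef⟩ : ∃ D : ℝ, D = 2 * (a ^ 2 + 5 * a + 5) := ⟨_, rfl⟩
  have hD : D ≠ 0 := by rw [hDdef]; positivity
  obtain ⟨X₁, hX₁⟩ : ∃ X : ModeSpace →L[ℝ] (ℝ →ᵇ ℝ), ∀ x t, X x t =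
      -((z x t).re - (a + 1) * q x t - (a + 5 / 2) * (ω⁻¹ * (z x t).im)) / D :=
    ⟨(-D⁻¹) • (re.comp z - (a + 1) • q - ((a + 5 / 2) * ω⁻¹) • im.comp z), fun x t => by
      simp [hre, him]; ring⟩
  obtain ⟨X₂, hX₂⟩ : ∃ X : ModeSpace →L[ℝ] (ℝ →ᵇ ℝ), ∀ x t, X x t =
      (ω⁻¹ * (z x t).im - 2 * X₁ x t) / (a + 1) :=
    ⟨(a + 1)⁻¹ • (ω⁻¹ • im.comp z - (2:ℝ) • X₁), fun x t => by
      simp [him]; ring⟩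
  obtain ⟨X₃, hX₃⟩ : ∃ X : ModeSpace →L[ℝ] (ℝ →ᵇ ℝ), ∀ x t, X x t =
      (q x t - (a + 2) * X₁ x t + (a + 1) * X₂ x t) / (a + 2) :=
    ⟨(a + 2)⁻¹ • (q - (a + 2) • X₁ + (a + 1) • X₂), fun x t => by
      simp; ring⟩
  -- Since `dy/dt = -H`, the position is its initial value minus the primitive of `H = m h`.
  obtain ⟨W, hW⟩ : ∃ X : ModeSpace →L[ℝ] (ℝ →ᵇ ℝ), ∀ x t, X x t = s x - J (h x) t :=
    ⟨s.smulRight (1 : ℝ →ᵇ ℝ) - J.comp h, fun x t => by simp⟩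
  let m : (ℝ →ᵇ ℝ) := decayWeight
  -- the quadratic terms
  let n₁ : ModeSpace → (ℝ →ᵇ ℝ) := fun x => X₁ x * X₁ x
  let n₂ : ModeSpace → (ℝ →ᵇ ℝ) := fun x => X₁ x * X₂ x
  let n₃ : ModeSpace → (ℝ →ᵇ ℝ) := fun x => X₁ x * X₃ x
  -- `h * G` is `y V₁ H³ - H⁴` divided by `m²`. Both factors vanish at `b`, so the product has zero
  -- derivative there.
  let G : ModeSpace → (ℝ →ᵇ ℝ) := fun x => m * W x * (1 + m * X₁ x) * h x ^ 2 - m ^ 2 * h x ^ 3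
  let n₄ : ModeSpace → (ℝ →ᵇ ℝ) := fun x => h x * G x
  let n₅ : ModeSpace → (ℝ →ᵇ ℝ) := fun x => X₁ x * h x
  let Q : ModeSpace → QuadSpace := fun x => (n₁ x, n₂ x, n₃ x, n₄ x, n₅ x)
  let b : ModeSpace := (0, 0, 0, ys)
  have hG : ContDiff ℝ 1 G := by fun_prop
  have hQ : ContDiff ℝ 1 Q := by fun_prop
  have hX₁b : X₁ b = 0 := by ext t; rw [hX₁]; simp [hq, hz, b]
  have hX₂b : X₂ b = 0 := by ext t; rw [hX₂, hX₁b]; simp [hz, b]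
  have hX₃b : X₃ b = 0 := by ext t; rw [hX₃, hX₁b, hX₂b]; simp [hq, b]
  have hhb : h b = 0 := hh b
  have hGb : G b = 0 := by simp [G, hhb]
  have hQb : HasFDerivAt Q (0 : ModeSpace →L[ℝ] QuadSpace) b := by
    have h1 : HasFDerivAt n₁ 0 b := X₁.hasFDerivAt.mul_of_eq_zero X₁.hasFDerivAt hX₁b hX₁b
    have h2 : HasFDerivAt n₂ 0 b := X₁.hasFDerivAt.mul_of_eq_zero X₂.hasFDerivAt hX₁b hX₂b
    have h3 : HasFDerivAt n₃ 0 b := X₁.hasFDerivAt.mul_of_eq_zero X₃.hasFDerivAt hX₁b hX₃b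
    have h4 : HasFDerivAt n₄ 0 b := h.hasFDerivAt.mul_of_eq_zero
      (hG.differentiable one_ne_zero b).hasFDerivAt hhb hGb
    have h5 : HasFDerivAt n₅ 0 b := X₁.hasFDerivAt.mul_of_eq_zero h.hasFDerivAt hX₁b hhb
    exact h1.prodMk (h2.prodMk (h3.prodMk (h4.prodMk h5)))
  have hQ0 : Q b = 0 := by
    simp only [Q, n₁, n₂, n₃, n₄, n₅, hX₁b, hhb, zero_mul]
    rfl
  -- the linear combinations of the quadratic terms driving the three modes
  let M : (ℝ →ᵇ ℝ) →L[ℝ] (ℝ →ᵇ ℝ) := ContinuousLinearMap.mul ℝ (ℝ →ᵇ ℝ) m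
  have hM : ∀ u t, M u t = m t * u t := fun _ _ => rfl
  let p₁ : QuadSpace →L[ℝ] (ℝ →ᵇ ℝ) := ContinuousLinearMap.fst ℝ _ _
  let r₁ : QuadSpace →L[ℝ] _ := ContinuousLinearMap.snd ℝ _ _
  let p₂ : QuadSpace →L[ℝ] (ℝ →ᵇ ℝ) := (ContinuousLinearMap.fst ℝ _ _).comp r₁
  let r₂ : QuadSpace →L[ℝ] _ := (ContinuousLinearMap.snd ℝ _ _).comp r₁
  let p₃ : QuadSpace →L[ℝ] (ℝ →ᵇ ℝ) := (ContinuousLinearMap.fst ℝ _ _).comp r₂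
  let r₃ : QuadSpace →L[ℝ] _ := (ContinuousLinearMap.snd ℝ _ _).comp r₂
  let p₄ : QuadSpace →L[ℝ] (ℝ →ᵇ ℝ) := (ContinuousLinearMap.fst ℝ _ _).comp r₃
  let p₅ : QuadSpace →L[ℝ] (ℝ →ᵇ ℝ) := (ContinuousLinearMap.snd ℝ _ _).comp r₃
  obtain ⟨Nq, hNq⟩ : ∃ L : QuadSpace →L[ℝ] (ℝ →ᵇ ℝ), ∀ x t, L (Q x) t = m t *
      (-((a + 1) * (a + 2) * n₁ x t) + (a + 1) * (a + 2) * n₂ x t +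
        (a + 2) * (a + 3) * (-n₃ x t + k * n₄ x t)) :=
    ⟨M.comp (-(((a + 1) * (a + 2)) • p₁) + ((a + 1) * (a + 2)) • p₂ +
        ((a + 2) * (a + 3)) • (-p₃ + k • p₄)), fun x t => rfl⟩
  obtain ⟨Nr, hNr⟩ : ∃ L : QuadSpace →L[ℝ] (ℝ →ᵇ ℝ), ∀ x t, L (Q x) t = m t *
      (-((3 / 4 - ω ^ 2) * (a + 1) * n₁ x t) - 3 / 2 * (a + 1) * (a + 2) * n₂ x t +
        (a + 1) * (a + 2) * (a + 3) * (-n₃ x t + k * n₄ x t)) :=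
    ⟨M.comp (-(((3 / 4 - ω ^ 2) * (a + 1)) • p₁) - (3 / 2 * (a + 1) * (a + 2)) • p₂ +
        ((a + 1) * (a + 2) * (a + 3)) • (-p₃ + k • p₄)), fun x t => rfl⟩
  obtain ⟨Ni, hNi⟩ : ∃ L : QuadSpace →L[ℝ] (ℝ →ᵇ ℝ), ∀ x t, L (Q x) t = m t *
      (-(2 * ω * (a + 1) * n₁ x t) - ω * (a + 1) * (a + 2) * n₂ x t) :=
    ⟨M.comp (-((2 * ω * (a + 1)) • p₁) - (ω * (a + 1) * (a + 2)) • p₂), fun x t => rfl⟩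
  obtain ⟨Nz, hNz⟩ : ∃ L : QuadSpace →L[ℝ] (ℝ →ᵇ ℂ), ∀ u t,
      (L u t).re = Nr u t ∧ (L u t).im = Ni u t :=
    ⟨(Complex.ofRealCLM.compLeftContinuousBounded ℝ).comp Nr +
      ((ContinuousLinearMap.toSpanSingleton ℝ Complex.I).compLeftContinuousBounded ℝ).comp Ni,
      fun u t => by
        have h1 : ((Complex.ofRealCLM.compLeftContinuousBounded ℝ).comp Nr +
          ((ContinuousLinearMap.toSpanSingleton ℝ Complex.I).compLeftContinuousBounded ℝ).comp Ni)
            u t = (Nr u t : ℂ) + (Ni u t) • Complex.I := rfl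
        rw [h1]
        simp⟩
  obtain ⟨Nh, hNh⟩ : ∃ L : QuadSpace →L[ℝ] (ℝ →ᵇ ℝ), ∀ x t, L (Q x) t = m t * -(n₅ x t) :=
    ⟨M.comp (-p₅), fun x t => rfl⟩
  -- The last slot has no forcing: the position enters only through its initial value.
  let Λ : QuadSpace →L[ℝ] ModeSpace :=
    (Sq.comp Nq).prod ((Sz.comp Nz).prod ((SH.comp Nh).prod 0))
  let R : ModeSpace → ModeSpace := fun x => Λ (Q x)
  have hRb : R b = 0 := by simp [R, hQ0]
  -- The derivative of `R` at `b` is zero, so `id - R` is invertible nearby. With `E P` the linear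
  -- evolution of the initial state `P` in mode coordinates, `σ (E P)` is the trajectory issuing
  -- from `P`.
  obtain ⟨σ, hσc, -, hσr, hσl⟩ := exists_localInverse_id_sub (R := R) (b := b)
    (Λ.contDiff.comp hQ).contDiffAt (R' := 0)
    ((Λ.hasFDerivAt.comp b hQb).congr_fderiv (by simp)) (by simp)
  rw [hRb, sub_zero] at hσc hσr
  let E : ℝ × ℝ × ℝ × ℝ × ℝ → ModeSpace := fun P =>
    (Eq ((a + 2) * (P.1 - 1) - (a + 1) * (P.2.1 - 1) + (a + 2) * (P.2.2.1 - 1)),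
      Ez (((3 / 4 - ω ^ 2) * (P.1 - 1) + 3 / 2 * (a + 1) * (P.2.1 - 1) +
        (a + 1) * (a + 2) * (P.2.2.1 - 1)) • (1 : ℂ) +
        (2 * ω * (P.1 - 1) + ω * (a + 1) * (P.2.1 - 1)) • Complex.I),
      EH P.2.2.2.1, P.2.2.2.2)
  have hEc : ContDiff ℝ 1 E := by fun_prop
  have hEline : ∀ s : ℝ, E (1, 1, 1, 0, s) = (0, 0, 0, s) := by
    intro s; simp [E]
  -- The limit of `y = s - J h` as `t → ∞`.
  refine ⟨fun P => s (σ (E P)) - J₁ (h (σ (E P))), ?_, ?_, ?_⟩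
  · have h1 : ContDiffAt ℝ 1 (fun P => σ (E P)) (1, 1, 1, 0, ys) :=
      ContDiffAt.comp _ (by rw [hEline]; exact hσc) hEc.contDiffAt
    have h2 : ContDiff ℝ 1 (fun x => s x - J₁ (h x)) := by fun_prop
    exact h2.contDiffAt.comp _ h1
  · have h1 : Tendsto (fun r : ℝ => ((0, 0, 0, r) : ModeSpace)) (𝓝 ys) (𝓝 b) :=
      Continuous.tendsto (by fun_prop) ys
    filter_upwards [h1.eventually hσl] with r hr
    -- `R` vanishes at every equilibrium of the line, not only at `b`, so `σ` fixes the line near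
    -- `b`.
    have h2 : R ((0, 0, 0, r) : ModeSpace) = 0 := by
      have e1 : X₁ ((0, 0, 0, r) : ModeSpace) = 0 := by ext t; rw [hX₁]; simp [hq, hz]
      have e2 : Q ((0, 0, 0, r) : ModeSpace) = 0 := by
        simp only [Q, n₁, n₂, n₃, n₄, n₅, e1, hh, zero_mul]
        rfl
      simp [R, e2]
    rw [h2, sub_zero] at hr
    rw [hEline, hr, hs, hh]
    simp
  · have h1 : Tendsto E (𝓝 (1, 1, 1, 0, ys)) (𝓝 b) := by
      have := hEc.continuous.tendsto (1, 1, 1, 0, ys)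
      rwa [hEline] at this
    filter_upwards [h1.eventually hσr] with P hP
    obtain ⟨x, hx⟩ : ∃ x, x = σ (E P) := ⟨_, rfl⟩
    rw [← hx] at hP ⊢
    have hωi : ω⁻¹ * ω = 1 := inv_mul_cancel₀ hω0.ne'
    have ha1 : a + 1 ≠ 0 := by positivity
    have ha2 : a + 2 ≠ 0 := by positivity
    have hqx : q x = Eq ((a + 2) * (P.1 - 1) - (a + 1) * (P.2.1 - 1) + (a + 2) * (P.2.2.1 - 1)) + Sq (Nq (Q x)) := by
      rw [hq]; exact sub_eq_iff_eq_add.1 (congrArg (fun y : ModeSpace => y.1) hP)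
    have hzx : z x = Ez (((3 / 4 - ω ^ 2) * (P.1 - 1) + 3 / 2 * (a + 1) * (P.2.1 - 1) +
        (a + 1) * (a + 2) * (P.2.2.1 - 1)) • (1 : ℂ) +
        (2 * ω * (P.1 - 1) + ω * (a + 1) * (P.2.1 - 1)) • Complex.I) + Sz (Nz (Q x)) := by
      rw [hz]; exact sub_eq_iff_eq_add.1 (congrArg (fun y : ModeSpace => y.2.1) hP)
    have hhx : h x = EH P.2.2.2.1 + SH (Nh (Q x)) := by
      rw [hh]; exact sub_eq_iff_eq_add.1 (congrArg (fun y : ModeSpace => y.2.2.1) hP)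
    have hsx : s x = P.2.2.2.2 := by
      rw [hs]
      have := congrArg (fun y : ModeSpace => y.2.2.2) hP
      simpa [R, Λ, E] using this
    obtain ⟨hq0, hqd⟩ := hSq _ _ _ hqx
    obtain ⟨hz0, hzd⟩ := hSz _ _ _ hzx
    obtain ⟨hh0, hhd⟩ := hSH _ _ _ hhx
    replace hq0 := hq0 0 clampTime_zero
    replace hz0 := hz0 0 clampTime_zero
    replace hh0 := hh0 0 clampTime_zero
    have hm0 : m 0 = 1 := by simp [m, decayWeight_apply, clampTime_zero]
    have hqX : ∀ t, q x t = (a + 2) * X₁ x t - (a + 1) * X₂ x t + (a + 2) * X₃ x t := by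
      intro t; rw [hX₃]; field_simp; ring
    have hiX : ∀ t, (z x t).im = ω * (2 * X₁ x t + (a + 1) * X₂ x t) := by
      intro t; rw [hX₂]; field_simp; ring
    have hrX : ∀ t, (z x t).re = (3 / 4 - ω ^ 2) * X₁ x t + 3 / 2 * (a + 1) * X₂ x t +
        (a + 1) * (a + 2) * X₃ x t := by
      intro t
      have e1 := hX₁ x t
      rw [eq_div_iff hD, hDdef, hiX, hqX] at e1
      linear_combination e1 + (a + 5 / 2) * (2 * X₁ x t + (a + 1) * X₂ x t) * hωi +
        X₁ x t * hω
    -- Injectivity of the change to mode coordinates: agreement of the modes at `t = 0` gives `V(0)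
    -- = P`.
    have hinit : ∀ {u v w : ℝ}, (a + 2) * u - (a + 1) * v + (a + 2) * w =
          (a + 2) * (P.1 - 1) - (a + 1) * (P.2.1 - 1) + (a + 2) * (P.2.2.1 - 1) →
        ω * (2 * u + (a + 1) * v) = 2 * ω * (P.1 - 1) + ω * (a + 1) * (P.2.1 - 1) →
        (3 / 4 - ω ^ 2) * u + 3 / 2 * (a + 1) * v + (a + 1) * (a + 2) * w =
          (3 / 4 - ω ^ 2) * (P.1 - 1) + 3 / 2 * (a + 1) * (P.2.1 - 1) +
            (a + 1) * (a + 2) * (P.2.2.1 - 1) →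
        u = P.1 - 1 ∧ v = P.2.1 - 1 ∧ w = P.2.2.1 - 1 := by
      intro u v w e1 e2 e3
      have e2' : 2 * (u - (P.1 - 1)) + (a + 1) * (v - (P.2.1 - 1)) = 0 := by
        apply mul_left_cancel₀ hω0.ne'
        linear_combination e2
      have e4 : u = P.1 - 1 := by
        rw [← sub_eq_zero]
        apply mul_left_cancel₀ hD
        rw [hDdef]
        linear_combination -e3 + (a + 1) * e1 + (a + 5 / 2) * e2' - (u - (P.1 - 1)) * hω
      have e5 : v = P.2.1 - 1 := by
        apply mul_left_cancel₀ ha1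
        linear_combination e2' - 2 * e4
      refine ⟨e4, e5, ?_⟩
      apply mul_left_cancel₀ ha2
      linear_combination e1 - (a + 2) * e4 + (a + 1) * e5
    obtain ⟨hi1, hi2, hi3⟩ := hinit (by rw [← hqX, hq0])
      (by rw [← hiX, hz0]; simp [-Complex.ofReal_pow]) (by rw [← hrX, hz0]; simp [-Complex.ofReal_pow])
    have hlim : ∀ u : ℝ →ᵇ ℝ, Tendsto (fun t => 1 + m t * u t) atTop (𝓝 1) := fun u => by
      simpa using (tendsto_decayWeight_mul u).const_add 1
    refine ⟨fun t => 1 + m t * X₁ x t, fun t => 1 + m t * X₂ x t, fun t => 1 + m t * X₃ x t,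
      fun t => m t * h x t, W x, ?_, ?_, fun t ht => ?_, hlim _, hlim _, hlim _,
      tendsto_decayWeight_mul _, ?_⟩
    · exact continuous_const.add (m.continuous.mul (X₁ x).continuous)
    · ext
      · simp [hm0, hi1]
      · simp [hm0, hi2]
      · simp [hm0, hi3]
      · simp [hm0, hh0]
      · simp [hW, hsx, hJ0]
    · have dm : HasDerivAt m (-(1 / 2) * m t) t := hasDerivAt_decayWeight ht
      have dq := hqd t (clampTime_eventually ht)
      have dz := hzd t (clampTime_eventually ht)
      have dh := hhd t (clampTime_eventually ht)
      have dr : HasDerivAt (fun t => (z x t).re)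
          (-(a + 1) * (z x t).re - ω * (z x t).im + Nr (Q x) t) t := by
        refine (Complex.reCLM.hasFDerivAt.comp_hasDerivAt t dz).congr_deriv ?_
        simp [(hNz (Q x) t).1]
      have di : HasDerivAt (fun t => (z x t).im)
          (-(a + 1) * (z x t).im + ω * (z x t).re + Ni (Q x) t) t := by
        refine (Complex.imCLM.hasFDerivAt.comp_hasDerivAt t dz).congr_deriv ?_
        simp [(hNz (Q x) t).2]
      rw [hNr] at dr
      rw [hNi] at di
      rw [hNq] at dq
      rw [hNh] at dh
      -- The equations for `X₁, X₂, X₃` are recovered from the mode equations through the inverse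
      -- formulas; the value of `ω²` enters here.
      have d1 : HasDerivAt (X₁ x) ((a + 1) * (X₂ x t - 2 * X₁ x t) + X₁ x t / 2 -
          (a + 1) * m t * n₁ x t) t := by
        have : ⇑(X₁ x) = fun t =>
            -((z x t).re - (a + 1) * q x t - (a + 5 / 2) * (ω⁻¹ * (z x t).im)) / D := by
          ext t; exact hX₁ x t
        rw [this]
        refine ((((dr.sub (dq.const_mul (a + 1))).sub ((di.const_mul ω⁻¹).const_mul
          (a + 5 / 2))).neg).div_const D).congr_deriv ?_
        rw [hiX, hrX, hqX, ← this, div_eq_iff hD, hDdef]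
        linear_combination (2 * X₁ x t + (a + 1) * X₂ x t - (a + 1) * X₁ x t -
          m t * (a + 1) * n₁ x t - (a + 5 / 2) * X₁ x t) * hω +
          (a + 5 / 2) * (-(a + 1) * (2 * X₁ x t + (a + 1) * X₂ x t) +
          ((3 / 4 - ω ^ 2) * X₁ x t + 3 / 2 * (a + 1) * X₂ x t + (a + 1) * (a + 2) * X₃ x t) +
          m t * (-(2 * (a + 1) * n₁ x t) - (a + 1) * (a + 2) * n₂ x t)) * hωi
      have d2 : HasDerivAt (X₂ x) ((a + 2) * (X₃ x t - X₁ x t - X₂ x t) + X₂ x t / 2 -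
          (a + 2) * m t * n₂ x t) t := by
        have : ⇑(X₂ x) = fun t => (ω⁻¹ * (z x t).im - 2 * X₁ x t) / (a + 1) := by
          ext t; exact hX₂ x t
        rw [this]
        refine (((di.const_mul ω⁻¹).sub (d1.const_mul 2)).div_const (a + 1)).congr_deriv ?_
        rw [hiX, hrX, ← this, div_eq_iff ha1]
        linear_combination -X₁ x t * hω + (-(a + 1) * (2 * X₁ x t + (a + 1) * X₂ x t) +
          ((3 / 4 - ω ^ 2) * X₁ x t + 3 / 2 * (a + 1) * X₂ x t + (a + 1) * (a + 2) * X₃ x t) +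
          m t * (-(2 * (a + 1) * n₁ x t) - (a + 1) * (a + 2) * n₂ x t)) * hωi
      have d3 : HasDerivAt (X₃ x) ((a + 3) * (-X₁ x t - X₃ x t) + X₃ x t / 2 +
          (a + 3) * m t * (-n₃ x t + k * n₄ x t)) t := by
        have : ⇑(X₃ x) = fun t => (q x t - (a + 2) * X₁ x t + (a + 1) * X₂ x t) / (a + 2) := by
          ext t; exact hX₃ x t
        rw [this]
        refine (((dq.sub (d1.const_mul (a + 2))).add (d2.const_mul (a + 1))).div_const
          (a + 2)).congr_deriv ?_
        rw [hqX, ← this, div_eq_iff ha2]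
        ring
      have e1 : n₁ x t = X₁ x t * X₁ x t := rfl
      have e2 : n₂ x t = X₁ x t * X₂ x t := rfl
      have e3 : n₃ x t = X₁ x t * X₃ x t := rfl
      have e4 : n₄ x t = h x t * (m t * W x t * (1 + m t * X₁ x t) * h x t ^ 2 -
        m t ^ 2 * h x t ^ 3) := rfl
      have e5 : n₅ x t = X₁ x t * h x t := rfl
      refine ⟨?_, ?_, ?_, ?_, ?_⟩
      · refine ((dm.mul d1).const_add 1).congr_deriv ?_
        rw [e1]; ring
      · refine ((dm.mul d2).const_add 1).congr_deriv ?_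
        rw [e2]; ring
      · refine ((dm.mul d3).const_add 1).congr_deriv ?_
        rw [e3, e4]; ring
      · refine (dm.mul dh).congr_deriv ?_
        rw [e5]; ring
      · have : ⇑(W x) = fun t => s x - J (h x) t := by ext t; exact hW x t
        rw [this]
        exact (hJd (h x) t ht).const_sub (s x)
    · have : ⇑(W x) = fun t => s x - J (h x) t := by ext t; exact hW x t
      rw [this]
      exact (hJlim (h x)).const_sub (s x)

/-! ### The nonlinearity -/

/-- Away from `0` this is a power. At `0` the factor `|x| ^ (p - 1)` tends to `0` because `p > 1`,
so the function is `o(x)`. It is not `C²` at `0` when `p < 2`, hence the `C¹` framework. -/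
lemma hasDerivAt_abs_rpow_mul {p : ℝ} (hp : 1 < p) (x : ℝ) :
    HasDerivAt (fun x : ℝ => |x| ^ (p - 1) * x) (p * |x| ^ (p - 1)) x := by
  rcases lt_trichotomy x 0 with hx | rfl | hx
  · have h : (fun x : ℝ => |x| ^ (p - 1) * x) =ᶠ[𝓝 x] fun x => -((-x) ^ p) := by
      filter_upwards [gt_mem_nhds hx] with y hy
      have : (-y) ^ p = (-y) ^ (p - 1) * (-y) := by
        rw [← Real.rpow_add_one (by linarith)]; ring_nf
      rw [abs_of_neg hy, this]; ring
    refine HasDerivAt.congr_of_eventuallyEq ?_ h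
    have := ((hasDerivAt_neg x).rpow_const (p := p) (Or.inl (by linarith))).neg
    refine this.congr_deriv ?_
    rw [abs_of_neg hx]; ring
  · have hp0 : p - 1 ≠ 0 := by linarith
    rw [hasDerivAt_iff_isLittleO_nhds_zero]
    simp only [zero_add, abs_zero, Real.zero_rpow hp0, mul_zero, sub_zero, smul_zero]
    have h1 : Tendsto (fun x : ℝ => |x| ^ (p - 1)) (𝓝 0) (𝓝 0) := by
      have : Continuous fun x : ℝ => |x| ^ (p - 1) :=
        continuous_abs.rpow_const fun _ => Or.inr (by linarith)
      simpa [Real.zero_rpow hp0] using this.tendsto 0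
    have := ((isLittleO_one_iff ℝ).2 h1).mul_isBigO (isBigO_refl (fun x : ℝ => x) (𝓝 0))
    simpa using this
  · have h : (fun x : ℝ => |x| ^ (p - 1) * x) =ᶠ[𝓝 x] fun x => x ^ p := by
      filter_upwards [lt_mem_nhds hx] with y hy
      rw [abs_of_pos hy, ← Real.rpow_add_one hy.ne']; ring_nf
    refine HasDerivAt.congr_of_eventuallyEq ?_ h
    rw [abs_of_pos hx]
    exact Real.hasDerivAt_rpow_const (Or.inl hx.ne')

lemma continuous_abs_rpow {p : ℝ} (hp : 1 < p) : Continuous fun x : ℝ => p * |x| ^ (p - 1) :=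
  continuous_const.mul (continuous_abs.rpow_const fun _ => Or.inr (by linarith))

lemma continuous_abs_rpow_mul {p : ℝ} (hp : 1 < p) :
    Continuous fun x : ℝ => |x| ^ (p - 1) * x :=
  continuous_iff_continuousAt.2 fun x => (hasDerivAt_abs_rpow_mul hp x).continuousAt

/-! ### Iterated derivatives from a chain of derivatives -/

/-- Lets iterated derivatives be read off from explicit candidates (powers, components of the
system), each checked to differentiate to the next. -/
lemma iteratedDeriv_eq_of_chain {E : Type*} [NormedAddCommGroup E] [NormedSpace ℝ E] {s : Set ℝ}
    (hs : IsOpen s) {n : ℕ} {g : ℕ → ℝ → E}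
    (hg : ∀ k < n, ∀ x ∈ s, HasDerivAt (g k) (g (k + 1) x) x) :
    ∀ k ≤ n, ∀ x ∈ s, iteratedDeriv k (g 0) x = g k x := by
  intro k
  induction k with
  | zero => intro _ x _; rw [iteratedDeriv_zero]
  | succ k ih =>
    intro hk x hx
    rw [iteratedDeriv_succ]
    have h : iteratedDeriv k (g 0) =ᶠ[𝓝 x] g k := by
      filter_upwards [hs.mem_nhds hx] with y hy
      exact ih (by omega) y hy
    rw [h.deriv_eq]
    exact (hg k (by omega) x hx).deriv

lemma contDiffOn_of_chain {E : Type*} [NormedAddCommGroup E] [NormedSpace ℝ E] {s : Set ℝ}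
    (hs : IsOpen s) : ∀ (n : ℕ) {g : ℕ → ℝ → E},
    (∀ k < n, ∀ x ∈ s, HasDerivAt (g k) (g (k + 1) x) x) → ContinuousOn (g n) s →
    ContDiffOn ℝ n (g 0) s := by
  intro n
  induction n with
  | zero => intro g _ hc; exact contDiffOn_zero.2 hc
  | succ n ih =>
    intro g hg hc
    have h1 := ih (g := fun k => g (k + 1)) (fun k hk => hg (k + 1) (by omega)) hc
    push_cast
    rw [contDiffOn_succ_iff_deriv_of_isOpen hs]
    refine ⟨fun x hx => (hg 0 (by omega) x hx).differentiableAt.differentiableWithinAt,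
      fun h => by simp at h, h1.congr fun x hx => (hg 0 (by omega) x hx).deriv⟩

lemma hasDerivAt_iteratedDeriv {E : Type*} [NormedAddCommGroup E] [NormedSpace ℝ E] {s : Set ℝ}
    (hs : IsOpen s) {n k : ℕ} {f : ℝ → E} (hf : ContDiffOn ℝ n f s) (hk : k < n) {x : ℝ}
    (hx : x ∈ s) : HasDerivAt (iteratedDeriv k f) (iteratedDeriv (k + 1) f x) x := by
  have h1 := (hf.differentiableOn_iteratedDerivWithin (m := k) (by exact_mod_cast hk)
    hs.uniqueDiffOn).congr fun y hy => (iteratedDerivWithin_of_isOpen hs hy).symm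
  rw [iteratedDeriv_succ]
  exact (h1.differentiableAt (hs.mem_nhds hx)).hasDerivAt

/-! ### The first-order system -/

/-- The first-order system in `ℝ⁴` equivalent to the similarity equation. -/
def similarityField (p y : ℝ) (x : Fin 4 → ℝ) : Fin 4 → ℝ :=
  ![x 1, x 2, x 3, |x 0| ^ (p - 1) * x 0 - 1 / 4 * y * x 1 - 1 / (p - 1) * x 0]

/-- `U` is a solution of the first-order system on `s`. -/
def IsSystemSol (p : ℝ) (s : Set ℝ) (U : ℝ → Fin 4 → ℝ) : Prop :=
  ∀ y ∈ s, HasDerivAt U (similarityField p y (U y)) y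

lemma IsSystemSol.mono {p : ℝ} {s t : Set ℝ} {U : ℝ → Fin 4 → ℝ} (h : IsSystemSol p t U)
    (hst : s ⊆ t) : IsSystemSol p s U := fun y hy => h y (hst hy)

lemma isSystemSol_iff {p : ℝ} {s : Set ℝ} {U : ℝ → Fin 4 → ℝ} :
    IsSystemSol p s U ↔ ∀ y ∈ s,
      HasDerivAt (fun y => U y 0) (U y 1) y ∧ HasDerivAt (fun y => U y 1) (U y 2) y ∧
      HasDerivAt (fun y => U y 2) (U y 3) y ∧ HasDerivAt (fun y => U y 3)
        (|U y 0| ^ (p - 1) * U y 0 - 1 / 4 * y * U y 1 - 1 / (p - 1) * U y 0) y := by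
  refine forall₂_congr fun y _ => ?_
  rw [hasDerivAt_pi]
  constructor
  · exact fun h => ⟨h 0, h 1, h 2, h 3⟩
  · rintro ⟨h0, h1, h2, h3⟩ i
    fin_cases i
    exacts [h0, h1, h2, h3]

lemma SolvesSimilarityODE.isSystemSol {p a b : ℝ} {f : ℝ → ℝ} (h : SolvesSimilarityODE p a b f) :
    IsSystemSol p (Ioo a b) (cauchyData f) := by
  rw [isSystemSol_iff]
  intro y hy
  have hd : ∀ k < 4, HasDerivAt (iteratedDeriv k f) (iteratedDeriv (k + 1) f y) y := fun k hk =>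
    hasDerivAt_iteratedDeriv isOpen_Ioo h.1 hk hy
  refine ⟨hd 0 (by norm_num), hd 1 (by norm_num), hd 2 (by norm_num),
    (hd 3 (by norm_num)).congr_deriv ?_⟩
  have := h.2 y hy
  simp only [cauchyData, Fin.val_zero, Fin.val_one, iteratedDeriv_zero, iteratedDeriv_one]
  linarith

lemma IsSystemSol.solvesSimilarityODE {p a b : ℝ} {U : ℝ → Fin 4 → ℝ}
    (hp : 1 < p) (h : IsSystemSol p (Ioo a b) U) :
    SolvesSimilarityODE p a b (fun y => U y 0) ∧
      ∀ y ∈ Ioo a b, cauchyData (fun y => U y 0) y = U y := by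
  have h' := isSystemSol_iff.1 h
  let r : ℝ → ℝ := fun y =>
    |U y 0| ^ (p - 1) * U y 0 - 1 / 4 * y * U y 1 - 1 / (p - 1) * U y 0
  let g : ℕ → ℝ → ℝ := fun k => match k with
    | 0 => fun y => U y 0
    | 1 => fun y => U y 1
    | 2 => fun y => U y 2
    | 3 => fun y => U y 3
    | _ => r
  have hg : ∀ k < 4, ∀ x ∈ Ioo a b, HasDerivAt (g k) (g (k + 1) x) x := by
    intro k hk x hx
    obtain ⟨h0, h1, h2, h3⟩ := h' x hx
    interval_cases k
    exacts [h0, h1, h2, h3]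
  have hit := iteratedDeriv_eq_of_chain isOpen_Ioo hg
  have hr : ContinuousOn r (Ioo a b) := by
    have c0 : ContinuousOn (fun y => U y 0) (Ioo a b) := HasDerivAt.continuousOn (hg 0 (by omega))
    have c1 : ContinuousOn (fun y => U y 1) (Ioo a b) := HasDerivAt.continuousOn (hg 1 (by omega))
    exact (((continuous_abs_rpow_mul hp).comp_continuousOn c0).sub
      ((continuousOn_const.mul continuousOn_id).mul c1)).sub (continuousOn_const.mul c0)
  refine ⟨⟨contDiffOn_of_chain isOpen_Ioo 4 hg hr, fun y hy => ?_⟩, fun y hy => ?_⟩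
  · have e4 := hit 4 le_rfl y hy
    have e1 := (hg 0 (by omega) y hy).deriv
    change iteratedDeriv 4 (fun y => U y 0) y = r y at e4
    change deriv (fun y => U y 0) y = U y 1 at e1
    rw [e4, e1]
    simp only [r]
    ring
  · ext i
    fin_cases i
    exacts [hit 0 (by omega) y hy, hit 1 (by omega) y hy, hit 2 (by omega) y hy,
      hit 3 (by omega) y hy]

lemma lipschitzOnWith_similarityField {p : ℝ} (hp : 1 < p) {R M : ℝ} (hR : 0 ≤ R) (hM : 0 ≤ M) :
    ∃ K, ∀ y, |y| ≤ M → LipschitzOnWith K (similarityField p y) (Metric.closedBall 0 R) := by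
  have hp1 : 0 < p - 1 := by linarith
  have hC : 0 ≤ p * R ^ (p - 1) + M + 1 / (p - 1) + 1 := by positivity
  refine ⟨⟨p * R ^ (p - 1) + M + 1 / (p - 1) + 1, hC⟩, fun y hy => ?_⟩
  refine LipschitzOnWith.of_dist_le_mul fun x hx x' hx' => ?_
  rw [mem_closedBall_zero_iff] at hx hx'
  rw [dist_eq_norm, dist_eq_norm]
  change _ ≤ (p * R ^ (p - 1) + M + 1 / (p - 1) + 1) * ‖x - x'‖
  have hcomp : ∀ i, |x i - x' i| ≤ ‖x - x'‖ := fun i => norm_le_pi_norm (x - x') i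
  have hn := norm_nonneg (x - x')
  have h1 : 0 ≤ p * R ^ (p - 1) := by positivity
  have h2 : 0 ≤ 1 / (p - 1) := by positivity
  have hpow : |(|x 0| ^ (p - 1) * x 0) - (|x' 0| ^ (p - 1) * x' 0)| ≤
      p * R ^ (p - 1) * ‖x - x'‖ := by
    have := Convex.norm_image_sub_le_of_norm_hasDerivWithin_le (s := Icc (-R) R)
      (f := fun x : ℝ => |x| ^ (p - 1) * x) (f' := fun x => p * |x| ^ (p - 1))
      (C := p * R ^ (p - 1)) (x := x' 0) (y := x 0)
      (fun t _ => (hasDerivAt_abs_rpow_mul hp t).hasDerivWithinAt)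
      (fun t ht => by
        rw [Real.norm_eq_abs, abs_of_nonneg (by positivity)]
        have : |t| ≤ R := abs_le.2 ht
        gcongr)
      (convex_Icc _ _) (abs_le.1 ((norm_le_pi_norm x' 0).trans hx'))
      (abs_le.1 ((norm_le_pi_norm x 0).trans hx))
    refine this.trans ?_
    exact mul_le_mul_of_nonneg_left (hcomp 0) h1
  refine (pi_norm_le_iff_of_nonneg (by positivity)).2 fun i => ?_
  have hone : ∀ i, |x i - x' i| ≤ (p * R ^ (p - 1) + M + 1 / (p - 1) + 1) * ‖x - x'‖ := fun i =>
    (hcomp i).trans (by nlinarith)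
  fin_cases i
  · exact hone 1
  · exact hone 2
  · exact hone 3
  · change |(|x 0| ^ (p - 1) * x 0 - 1 / 4 * y * x 1 - 1 / (p - 1) * x 0) -
      (|x' 0| ^ (p - 1) * x' 0 - 1 / 4 * y * x' 1 - 1 / (p - 1) * x' 0)| ≤ _
    have e : (|x 0| ^ (p - 1) * x 0 - 1 / 4 * y * x 1 - 1 / (p - 1) * x 0) -
      (|x' 0| ^ (p - 1) * x' 0 - 1 / 4 * y * x' 1 - 1 / (p - 1) * x' 0) =
      ((|x 0| ^ (p - 1) * x 0) - (|x' 0| ^ (p - 1) * x' 0)) +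
        (-(1 / 4 * y) * (x 1 - x' 1) + -(1 / (p - 1)) * (x 0 - x' 0)) := by ring
    rw [e]
    refine (abs_add_le _ _).trans ?_
    have h3 := abs_add_le (-(1 / 4 * y) * (x 1 - x' 1)) (-(1 / (p - 1)) * (x 0 - x' 0))
    rw [abs_mul, abs_mul, abs_neg, abs_neg, abs_of_nonneg h2, abs_mul,
      abs_of_pos (by norm_num : (0:ℝ) < 1 / 4)] at h3
    have h4 : 1 / 4 * |y| * |x 1 - x' 1| ≤ M * ‖x - x'‖ := by
      apply mul_le_mul _ (hcomp 1) (abs_nonneg _) hM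
      linarith [abs_nonneg y]
    have h5 := mul_le_mul_of_nonneg_left (hcomp 0) h2
    linarith

lemma IsSystemSol.continuousOn {p : ℝ} {s : Set ℝ} {U : ℝ → Fin 4 → ℝ} (h : IsSystemSol p s U) :
    ContinuousOn U s := HasDerivAt.continuousOn h

/-- Solutions which agree at one point of an interval agree on the interval. -/
lemma IsSystemSol.eqOn {p a b : ℝ} (hp : 1 < p) {U V : ℝ → Fin 4 → ℝ}
    (hU : IsSystemSol p (Ioo a b) U) (hV : IsSystemSol p (Ioo a b) V) {c : ℝ} (hc : c ∈ Ioo a b)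
    (h : U c = V c) : EqOn U V (Ioo a b) := by
  intro y hy
  -- On a compact subinterval around both points the two solutions stay in one ball, where the field
  -- is Lipschitz.
  obtain ⟨a', ha'⟩ := exists_between (lt_min hc.1 hy.1)
  obtain ⟨b', hb'⟩ := exists_between (max_lt hc.2 hy.2)
  have hsub : Icc a' b' ⊆ Ioo a b := Icc_subset_Ioo ha'.1 hb'.2
  obtain ⟨R₁, hR₁⟩ := isCompact_Icc.exists_bound_of_continuousOn (hU.continuousOn.mono hsub)
  obtain ⟨R₂, hR₂⟩ := isCompact_Icc.exists_bound_of_continuousOn (hV.continuousOn.mono hsub)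
  obtain ⟨K, hK⟩ := lipschitzOnWith_similarityField hp (R := max (max R₁ R₂) 0)
    (M := max |a'| |b'|) (le_max_right _ _) (by positivity)
  have key := ODE_solution_unique_of_mem_Ioo (f := U) (g := V) (a := a') (b := b') (t₀ := c)
    (K := K) (v := similarityField p) (s := fun _ => Metric.closedBall 0 (max (max R₁ R₂) 0))
    (fun t ht => hK t (abs_le_max_abs_abs ht.1.le ht.2.le))
    ⟨ha'.2.trans_le (min_le_left _ _), (le_max_left _ _).trans_lt hb'.1⟩
    (fun t ht => ⟨hU t (hsub (Ioo_subset_Icc_self ht)), by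
      rw [mem_closedBall_zero_iff]
      exact (hR₁ t (Ioo_subset_Icc_self ht)).trans
        ((le_max_left _ _).trans (le_max_left _ _))⟩)
    (fun t ht => ⟨hV t (hsub (Ioo_subset_Icc_self ht)), by
      rw [mem_closedBall_zero_iff]
      exact (hR₂ t (Ioo_subset_Icc_self ht)).trans
        ((le_max_right _ _).trans (le_max_left _ _))⟩) h
  exact key ⟨ha'.2.trans_le (min_le_right _ _), (le_max_right _ _).trans_lt hb'.1⟩

/-- Two solutions which agree at a common point can be glued there. -/
lemma IsSystemSol.glue {p a b c d e : ℝ} {U V : ℝ → Fin 4 → ℝ}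
    (hU : IsSystemSol p (Ioo a b) U) (hV : IsSystemSol p (Ioo c d) V) (heU : e ∈ Ioo a b)
    (heV : e ∈ Ioo c d) (h : U e = V e) :
    IsSystemSol p (Ioo a d) (fun y => if y ≤ e then U y else V y) := by
  intro y hy
  rcases lt_trichotomy y e with hye | rfl | hye
  · have hev : (fun y => if y ≤ e then U y else V y) =ᶠ[𝓝 y] U := by
      filter_upwards [gt_mem_nhds hye] with x hx
      rw [if_pos hx.le]
    rw [hev.self_of_nhds]
    exact (hU y ⟨hy.1, hye.trans heU.2⟩).congr_of_eventuallyEq hev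
  · have e0 : (fun x => if x ≤ y then U x else V x) y = U y := if_pos le_rfl
    rw [e0]
    have hl : HasDerivWithinAt (fun x => if x ≤ y then U x else V x)
        (similarityField p y (U y)) (Iic y) y :=
      (hU y heU).hasDerivWithinAt.congr (fun x hx => if_pos hx) (if_pos le_rfl)
    have hr : HasDerivWithinAt (fun x => if x ≤ y then U x else V x)
        (similarityField p y (U y)) (Ici y) y := by
      rw [h]
      refine (hV y heV).hasDerivWithinAt.congr (fun x hx => ?_) (by rw [if_pos le_rfl, h])
      rcases eq_or_lt_of_le (mem_Ici.1 hx) with rfl | hlt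
      · rw [if_pos le_rfl, h]
      · rw [if_neg (not_le.2 hlt)]
    have := hl.union hr
    rwa [Iic_union_Ici, hasDerivWithinAt_univ] at this
  · have hev : (fun y => if y ≤ e then U y else V y) =ᶠ[𝓝 y] V := by
      filter_upwards [lt_mem_nhds hye] with x hx
      rw [if_neg (not_le.2 hx)]
    rw [hev.self_of_nhds]
    exact (hV y ⟨heV.1.trans hye, hy.2⟩).congr_of_eventuallyEq hev

/-- The blow-up point of a solution is unique. -/
lemma IsSystemSol.blowUp_unique {p a b a' b' c : ℝ} (hp : 1 < p) {U V : ℝ → Fin 4 → ℝ}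
    (hU : IsSystemSol p (Ioo a b) U) (hV : IsSystemSol p (Ioo a' b') V) (hc : c ∈ Ioo a b)
    (hc' : c ∈ Ioo a' b') (h : U c = V c) (hUb : Tendsto (fun y => |U y 0|) (𝓝[>] a) atTop)
    (hVb : Tendsto (fun y => |V y 0|) (𝓝[>] a') atTop) : a = a' := by
  -- If `a < a'`, then `U` is continuous at `a'`, yet it coincides to the right of `a'` with `V`,
  -- which blows up there.
  have key : ∀ {a b a' b' : ℝ} {U V : ℝ → Fin 4 → ℝ}, IsSystemSol p (Ioo a b) U →
      IsSystemSol p (Ioo a' b') V → c ∈ Ioo a b → c ∈ Ioo a' b' → U c = V c →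
      Tendsto (fun y => |V y 0|) (𝓝[>] a') atTop → ¬ a < a' := by
    intro a b a' b' U V hU hV hc hc' h hVb hlt
    have he : EqOn U V (Ioo a' (min b b')) :=
      IsSystemSol.eqOn hp (hU.mono (Ioo_subset_Ioo hlt.le (min_le_left _ _)))
        (hV.mono (Ioo_subset_Ioo le_rfl (min_le_right _ _))) ⟨hc'.1, lt_min hc.2 hc'.2⟩ h
    have hcont : ContinuousAt U a' := (hU a' ⟨hlt, hc'.1.trans hc.2⟩).continuousAt
    have hlim : Tendsto (fun y => |U y 0|) (𝓝[>] a') (𝓝 |U a' 0|) :=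
      (((continuous_apply 0).continuousAt.comp hcont).abs).tendsto.mono_left nhdsWithin_le_nhds
    refine not_tendsto_nhds_of_tendsto_atTop hVb _ (hlim.congr' ?_)
    filter_upwards [Ioo_mem_nhdsGT (lt_min (hc'.1.trans hc.2) (hc'.1.trans hc'.2))] with y hy
    rw [he hy]
  exact le_antisymm (not_lt.1 (key hV hU hc' hc h.symm hUb)) (not_lt.1 (key hU hV hc hc' h hVb))

/-- The flow of the first-order system along a given solution is `C¹` in the initial data. -/
theorem exists_flow {p : ℝ} (hp : 1 < p) {c d y₁ y₂ : ℝ} {U : ℝ → Fin 4 → ℝ}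
    (hU : IsSystemSol p (Ioo c d) U) (h₁ : y₁ ∈ Ioo c d) (h₂ : y₂ ∈ Ioo c d) :
    ∃ Φ : (Fin 4 → ℝ) → (Fin 4 → ℝ), ContDiffAt ℝ 1 Φ (U y₁) ∧ Φ (U y₁) = U y₂ ∧
      ∀ᶠ z in 𝓝 (U y₁), ∃ (c' d' : ℝ) (V : ℝ → Fin 4 → ℝ), IsSystemSol p (Ioo c' d') V ∧
        y₁ ∈ Ioo c' d' ∧ y₂ ∈ Ioo c' d' ∧ V y₁ = z ∧ V y₂ = Φ z := by
  -- time runs from `y₁` towards `y₂`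
  obtain ⟨ς, l, hς, hl0, hl⟩ : ∃ ς l : ℝ, (ς = 1 ∨ ς = -1) ∧ 0 ≤ l ∧ y₂ = y₁ + ς * l := by
    rcases le_total y₁ y₂ with h | h
    · exact ⟨1, y₂ - y₁, Or.inl rfl, by linarith, by ring⟩
    · exact ⟨-1, y₁ - y₂, Or.inr rfl, by linarith, by ring⟩
  have hς2 : ς * ς = 1 := by rcases hς with rfl | rfl <;> norm_num
  have hςa : |ς| = 1 := by rcases hς with rfl | rfl <;> norm_num
  obtain ⟨ε₀, hε₀, hin⟩ : ∃ ε₀ > 0, ∀ τ ∈ Icc (-ε₀) (l + ε₀), y₁ + ς * τ ∈ Ioo c d := by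
    refine ⟨min (min (y₁ - c) (d - y₁)) (min (y₂ - c) (d - y₂)) / 2, ?_, fun τ hτ => ?_⟩
    · have := sub_pos.2 h₁.1; have := sub_pos.2 h₁.2
      have := sub_pos.2 h₂.1; have := sub_pos.2 h₂.2
      positivity
    · have hm : 0 < min (min (y₁ - c) (d - y₁)) (min (y₂ - c) (d - y₂)) :=
        lt_min (lt_min (sub_pos.2 h₁.1) (sub_pos.2 h₁.2))
          (lt_min (sub_pos.2 h₂.1) (sub_pos.2 h₂.2))
      have a1 := (min_le_left (min (y₁ - c) (d - y₁)) (min (y₂ - c) (d - y₂))).trans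
        (min_le_left _ _)
      have a2 := (min_le_left (min (y₁ - c) (d - y₁)) (min (y₂ - c) (d - y₂))).trans
        (min_le_right _ _)
      have a3 := (min_le_right (min (y₁ - c) (d - y₁)) (min (y₂ - c) (d - y₂))).trans
        (min_le_left _ _)
      have a4 := (min_le_right (min (y₁ - c) (d - y₁)) (min (y₂ - c) (d - y₂))).trans
        (min_le_right _ _)
      obtain ⟨b1, b2⟩ := hτ
      rcases hς with rfl | rfl <;> constructor <;> linarith
  -- bounds along the given solution
  have hcomp : ContinuousOn (fun τ => U (y₁ + ς * τ)) (Icc (-ε₀) (l + ε₀)) :=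
    hU.continuousOn.comp (by fun_prop) hin
  obtain ⟨G, hG⟩ := (isCompact_Icc (a := -ε₀) (b := l + ε₀)).exists_bound_of_continuousOn
    (f := fun τ => p * |U (y₁ + ς * τ) 0| ^ (p - 1))
    ((continuous_abs_rpow hp).comp_continuousOn ((continuous_apply 0).comp_continuousOn hcomp))
  have hG0 : 0 ≤ G := (norm_nonneg _).trans (hG 0 ⟨by linarith, by linarith⟩)
  have hp1 : 0 < p - 1 := by linarith
  -- `C` bounds the linearized field along the given solution. Unknowns are weighted by `exp(-L τ)`,
  -- for which the integral operator has norm at most `2 / L`; `L = 4 C` makes the linearization a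
  -- contraction with ratio `1/2`, however long the time interval.
  obtain ⟨C, hC⟩ : ∃ C : ℝ, C = 1 + G + (|y₁| + l + ε₀) + 1 / (p - 1) := ⟨_, rfl⟩
  have hip : 0 < 1 / (p - 1) := by positivity
  have hCpos : 0 < C := by rw [hC]; positivity
  obtain ⟨L, hL⟩ : ∃ L : ℝ, L = 4 * C := ⟨_, rfl⟩
  have hLpos : 0 < L := by rw [hL]; positivity
  -- `ε` lets solutions run past both end points; `ε ≤ log 2 / L` keeps the weight below `2` at
  -- negative times.
  obtain ⟨ε, hε, hεε₀, hεL⟩ : ∃ ε > 0, ε < ε₀ ∧ ε ≤ Real.log 2 / L := by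
    refine ⟨min (ε₀ / 2) (Real.log 2 / L), ?_, ?_, min_le_right _ _⟩
    · have := Real.log_pos (by norm_num : (1:ℝ) < 2)
      positivity
    · exact (min_le_left _ _).trans_lt (by linarith)
  let θ : ℝ → ℝ := fun t => max (-ε) (min t (l + ε))
  have hθc : Continuous θ := by fun_prop
  have hθmem : ∀ t, θ t ∈ Icc (-ε) (l + ε) := fun t =>
    ⟨le_max_left _ _, max_le (by linarith) (min_le_right _ _)⟩
  have hθid : ∀ t ∈ Icc (-ε) (l + ε), θ t = t := fun t ht => by
    simp only [θ]; rw [min_eq_left ht.2, max_eq_right ht.1]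
  have hθev : ∀ t ∈ Ioo (-ε) (l + ε), ∀ᶠ s in 𝓝 t, θ s = s := fun t ht => by
    filter_upwards [isOpen_Ioo.mem_nhds ht] with s hs
    exact hθid s (Ioo_subset_Icc_self hs)
  have hθabs : ∀ t, |θ t| ≤ l + ε₀ := fun t => by
    have := hθmem t
    rw [abs_le]; constructor <;> linarith [this.1, this.2]
  have hθin : ∀ t, y₁ + ς * θ t ∈ Ioo c d := fun t =>
    hin _ ⟨by linarith [(hθmem t).1], by linarith [(hθmem t).2]⟩
  obtain ⟨S, E, hS, hE, hSE, hSE'⟩ := exists_duhamel (𝕜 := ℝ) hθc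
    (κ := Real.log 2 / L) (l := L) (c := -L) (e := fun t => Real.exp (-L * t)) hLpos
    (by have := Real.log_pos (by norm_num : (1:ℝ) < 2); positivity)
    (fun t => by linarith [(hθmem t).1]) (by simp) (fun t => by rw [← Real.exp_add]; simp)
    (fun t => by
      refine (((hasDerivAt_id t).const_mul (-L)).exp).congr_deriv ?_
      simp only [id]; ring)
    (fun t => by rw [Real.norm_eq_abs, Real.abs_exp, neg_mul])
  have hS2 : ‖S‖ ≤ 2 / L := by
    rwa [mul_div_cancel₀ _ hLpos.ne', Real.exp_log (by norm_num)] at hS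
  have hexpB : ∀ a : ℝ, ∃ e : ℝ →ᵇ ℝ, ∀ t, e t = Real.exp (a * θ t) := fun a =>
    ⟨BoundedContinuousFunction.ofNormedAddCommGroup (fun t => Real.exp (a * θ t))
      (by fun_prop) (Real.exp (|a| * (l + ε₀))) (fun t => by
        rw [Real.norm_eq_abs, Real.abs_exp]
        apply Real.exp_le_exp.2
        calc a * θ t ≤ |a * θ t| := le_abs_self _
          _ = |a| * |θ t| := abs_mul _ _
          _ ≤ _ := mul_le_mul_of_nonneg_left (hθabs t) (abs_nonneg _)), fun t => rfl⟩
  obtain ⟨e₁, he₁⟩ := hexpB L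
  obtain ⟨e₂, he₂⟩ := hexpB (-L)
  have he12 : ∀ t, e₂ t * e₁ t = 1 := fun t => by
    rw [he₁, he₂, ← Real.exp_add]; simp
  obtain ⟨Y, hY⟩ : ∃ Y : ℝ →ᵇ ℝ, ∀ t, Y t = y₁ + ς * θ t :=
    ⟨BoundedContinuousFunction.ofNormedAddCommGroup (fun t => y₁ + ς * θ t) (by fun_prop)
      (|y₁| + (l + ε₀)) (fun t => by
        rw [Real.norm_eq_abs]
        refine (abs_add_le _ _).trans ?_
        rw [abs_mul, hςa, one_mul]
        linarith [hθabs t]), fun t => rfl⟩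
  let g : (ℝ →ᵇ ℝ) → (ℝ →ᵇ ℝ) := superpose _ (continuous_abs_rpow_mul hp)
  have hgd := hasFDerivAt_superpose (continuous_abs_rpow_mul hp) (continuous_abs_rpow hp)
    (hasDerivAt_abs_rpow_mul hp)
  have hgc : ContDiff ℝ 1 g := contDiff_superpose (continuous_abs_rpow_mul hp)
    (continuous_abs_rpow hp) (hasDerivAt_abs_rpow_mul hp)
  -- the forcing terms of the weighted system
  let N : (Fin 4 → ℝ →ᵇ ℝ) → Fin 4 → ℝ →ᵇ ℝ := fun w =>
    ![ς • w 1, ς • w 2, ς • w 3,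
      ς • (e₂ * g (e₁ * w 0) - (1 / 4 : ℝ) • (Y * w 1) - (1 / (p - 1)) • w 0)]
  let R : (Fin 4 → ℝ →ᵇ ℝ) → Fin 4 → ℝ →ᵇ ℝ := fun w i => S (N w i)
  have hNc : ∀ i, ContDiff ℝ 1 fun w => N w i := by
    intro i
    fin_cases i
    · change ContDiff ℝ 1 fun w : Fin 4 → ℝ →ᵇ ℝ => ς • w 1
      fun_prop
    · change ContDiff ℝ 1 fun w : Fin 4 → ℝ →ᵇ ℝ => ς • w 2
      fun_prop
    · change ContDiff ℝ 1 fun w : Fin 4 → ℝ →ᵇ ℝ => ς • w 3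
      fun_prop
    · change ContDiff ℝ 1 fun w : Fin 4 → ℝ →ᵇ ℝ =>
        ς • (e₂ * g (e₁ * w 0) - (1 / 4 : ℝ) • (Y * w 1) - (1 / (p - 1)) • w 0)
      fun_prop
  have hRc : ContDiff ℝ 1 R := contDiff_pi.2 fun i => S.contDiff.comp (hNc i)
  obtain ⟨b, hb⟩ : ∃ b : Fin 4 → ℝ →ᵇ ℝ, ∀ i t,
      b i t = Real.exp (-L * θ t) * U (y₁ + ς * θ t) i := by
    have hcont : ∀ i, Continuous fun t => U (y₁ + ς * θ t) i := fun i =>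
      (continuous_apply i).comp (hU.continuousOn.comp_continuous (by fun_prop) hθin)
    have hbd : ∀ i, ∃ M, ∀ t, ‖Real.exp (-L * θ t) * U (y₁ + ς * θ t) i‖ ≤ M := by
      intro i
      obtain ⟨M, hM⟩ := (isCompact_Icc (a := -ε₀) (b := l + ε₀)).exists_bound_of_continuousOn
        (f := fun τ => Real.exp (-L * τ) * U (y₁ + ς * τ) i)
        ((by fun_prop : Continuous fun τ : ℝ => Real.exp (-L * τ)).continuousOn.mul
          ((continuous_apply i).comp_continuousOn hcomp))
      exact ⟨M, fun t => hM _ ⟨by linarith [(hθmem t).1], by linarith [(hθmem t).2]⟩⟩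
    choose M hM using hbd
    exact ⟨fun i => BoundedContinuousFunction.ofNormedAddCommGroup _
      ((by fun_prop : Continuous fun t : ℝ => Real.exp (-L * θ t)).mul (hcont i)) (M i) (hM i),
      fun i t => rfl⟩
  have hNapply : ∀ (w : Fin 4 → ℝ →ᵇ ℝ) (x : Fin 4 → ℝ) t,
      (∀ i, w i t = Real.exp (-L * θ t) * x i) → ∀ i, N w i t =
        ς * (Real.exp (-L * θ t) * similarityField p (y₁ + ς * θ t) x i) := by
    intro w x t hw i
    have e0 : e₁ t * w 0 t = x 0 := by
      rw [hw, ← he₂]; linear_combination x 0 * he12 t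
    fin_cases i
    · change ς * w 1 t = _
      rw [hw]; rfl
    · change ς * w 2 t = _
      rw [hw]; rfl
    · change ς * w 3 t = _
      rw [hw]; rfl
    · change ς * (e₂ t * (|e₁ t * w 0 t| ^ (p - 1) * (e₁ t * w 0 t)) - 1 / 4 * (Y t * w 1 t) -
        1 / (p - 1) * w 0 t) = ς * (_ * (|x 0| ^ (p - 1) * x 0 - 1 / 4 * (y₁ + ς * θ t) * x 1 -
          1 / (p - 1) * x 0))
      rw [e0, hw, hw, he₂, hY]
      ring
  -- the derivative of `R` at the given solution is a contraction
  have hderiv : ∃ R' : (Fin 4 → ℝ →ᵇ ℝ) →L[ℝ] (Fin 4 → ℝ →ᵇ ℝ), HasFDerivAt R R' b ∧ ‖R'‖ < 1 := by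
    let mul := fun u : ℝ →ᵇ ℝ => ContinuousLinearMap.mul ℝ (ℝ →ᵇ ℝ) u
    let pr : Fin 4 → ((Fin 4 → ℝ →ᵇ ℝ) →L[ℝ] (ℝ →ᵇ ℝ)) := fun i => ContinuousLinearMap.proj i
    let k := superpose _ (continuous_abs_rpow hp) (e₁ * b 0)
    let A : Fin 4 → ((Fin 4 → ℝ →ᵇ ℝ) →L[ℝ] (ℝ →ᵇ ℝ)) :=
      ![ς • pr 1, ς • pr 2, ς • pr 3,
        ς • ((mul e₂).comp ((mul k).comp ((mul e₁).comp (pr 0))) -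
          (1 / 4 : ℝ) • (mul Y).comp (pr 1) - (1 / (p - 1)) • pr 0)]
    have hNA : ∀ i, HasFDerivAt (fun w => N w i) (A i) b := by
      intro i
      fin_cases i
      · exact (ς • pr 1).hasFDerivAt
      · exact (ς • pr 2).hasFDerivAt
      · exact (ς • pr 3).hasFDerivAt
      · have a1 : HasFDerivAt (fun w : Fin 4 → ℝ →ᵇ ℝ => e₁ * w 0) ((mul e₁).comp (pr 0)) b :=
          ((mul e₁).comp (pr 0)).hasFDerivAt
        have a2 : HasFDerivAt (fun w : Fin 4 → ℝ →ᵇ ℝ => e₂ * g (e₁ * w 0))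
            ((mul e₂).comp ((mul k).comp ((mul e₁).comp (pr 0)))) b :=
          have a3 : HasFDerivAt (fun w : Fin 4 → ℝ →ᵇ ℝ => g (e₁ * w 0))
              ((mul k).comp ((mul e₁).comp (pr 0))) b :=
            HasFDerivAt.comp (g := g) b (hgd (e₁ * b 0)) a1
          (mul e₂).hasFDerivAt.comp b a3
        exact ((a2.sub ((1 / 4 : ℝ) • (mul Y).comp (pr 1)).hasFDerivAt).sub
          ((1 / (p - 1)) • pr 0).hasFDerivAt).const_smul ς
    have hA : ∀ i δ, ‖A i δ‖ ≤ C * ‖δ‖ := by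
      intro i δ
      have hδ : ∀ j t, |δ j t| ≤ ‖δ‖ := fun j t =>
        ((δ j).norm_coe_le_norm t).trans (norm_le_pi_norm δ j)
      have hn := norm_nonneg δ
      have h1C : (1:ℝ) ≤ C := by
        rw [hC]; linarith [abs_nonneg y₁]
      have hsimple : ∀ j, ‖ς • δ j‖ ≤ C * ‖δ‖ := by
        intro j
        rw [norm_smul, Real.norm_eq_abs, hςa, one_mul]
        exact (norm_le_pi_norm δ j).trans (by nlinarith)
      fin_cases i
      · exact hsimple 1
      · exact hsimple 2
      · exact hsimple 3
      · refine (BoundedContinuousFunction.norm_le (by positivity)).2 fun t => ?_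
        change |ς * (e₂ t * (p * |e₁ t * b 0 t| ^ (p - 1) * (e₁ t * δ 0 t)) -
          1 / 4 * (Y t * δ 1 t) - 1 / (p - 1) * δ 0 t)| ≤ _
        have e0 : e₁ t * b 0 t = U (y₁ + ς * θ t) 0 := by
          rw [hb, ← he₂]; linear_combination U (y₁ + ς * θ t) 0 * he12 t
        have hk := hG (θ t) ⟨by linarith [(hθmem t).1], by linarith [(hθmem t).2]⟩
        rw [Real.norm_eq_abs] at hk
        rw [abs_mul, hςa, one_mul, e0]
        have e1 : e₂ t * (p * |U (y₁ + ς * θ t) 0| ^ (p - 1) * (e₁ t * δ 0 t)) -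
            1 / 4 * (Y t * δ 1 t) - 1 / (p - 1) * δ 0 t =
            p * |U (y₁ + ς * θ t) 0| ^ (p - 1) * δ 0 t + (-(1 / 4 * Y t) * δ 1 t +
              -(1 / (p - 1)) * δ 0 t) := by
          linear_combination p * |U (y₁ + ς * θ t) 0| ^ (p - 1) * δ 0 t * he12 t
        have hYt : |1 / 4 * Y t| ≤ |y₁| + l + ε₀ := by
          rw [abs_mul, abs_of_pos (by norm_num : (0:ℝ) < 1 / 4), hY]
          have := abs_add_le y₁ (ς * θ t)
          rw [abs_mul, hςa, one_mul] at this
          linarith [hθabs t, abs_nonneg (y₁ + ς * θ t)]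
        rw [e1]
        refine (abs_add_le _ _).trans ((add_le_add_right (abs_add_le _ _) _).trans ?_)
        rw [abs_mul (p * _), abs_mul (-(1 / 4 * Y t)), abs_mul (-(1 / (p - 1))), abs_neg, abs_neg,
          abs_of_pos hip]
        have b1 := mul_le_mul hk (hδ 0 t) (abs_nonneg _) hG0
        have b2 := mul_le_mul hYt (hδ 1 t) (abs_nonneg _) (by positivity)
        have b3 := mul_le_mul_of_nonneg_left (hδ 0 t) hip.le
        rw [hC]
        linarith
    refine ⟨ContinuousLinearMap.pi fun i => S.comp (A i),
      hasFDerivAt_pi.2 fun i => S.hasFDerivAt.comp b (hNA i), ?_⟩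
    refine lt_of_le_of_lt (ContinuousLinearMap.opNorm_le_bound _ (M := 1 / 2) (by norm_num)
      fun δ => ?_) (by norm_num)
    refine (pi_norm_le_iff_of_nonneg (by positivity)).2 fun i => ?_
    calc ‖S (A i δ)‖ ≤ ‖S‖ * ‖A i δ‖ := S.le_opNorm _
      _ ≤ 2 / L * (C * ‖δ‖) := mul_le_mul hS2 (hA i δ) (norm_nonneg _) (by positivity)
      _ = 1 / 2 * ‖δ‖ := by rw [hL]; field_simp; norm_num
  obtain ⟨R', hR', hR'1⟩ := hderiv
  obtain ⟨σ, hσc, hσb, hσr, -⟩ := exists_localInverse_id_sub hRc.contDiffAt hR' hR'1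
  let F : (Fin 4 → ℝ) → Fin 4 → ℝ →ᵇ ℝ := fun z i => E (z i)
  have hFc : ContDiff ℝ 1 F := by fun_prop
  -- The weighted given solution solves the integral equation: this is the converse half of the
  -- Duhamel lemma.
  have hFb : b - R b = F (U y₁) := by
    ext1 i
    have h3 := hSE' (N b i) (b i) (fun τ => Real.exp (-L * τ) * U (y₁ + ς * τ) i) (hb i) (by
      intro t τ hτ
      have hτ' : τ ∈ Icc (-ε) (l + ε) :=
        uIcc_subset_Icc ⟨by linarith, by linarith⟩ (hθmem t) hτ
      have hτin : y₁ + ς * τ ∈ Ioo c d :=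
        hin τ ⟨by linarith [hτ'.1], by linarith [hτ'.2]⟩
      have d1 := (((hasDerivAt_id τ).const_mul (-L)).exp).mul
        (((hasDerivAt_pi.1 (hU _ hτin) i)).comp τ
          (((hasDerivAt_id τ).const_mul ς).const_add y₁))
      refine d1.congr_deriv ?_
      rw [hNapply b (U (y₁ + ς * θ τ)) τ (fun i => hb i τ), hθid τ hτ']
      simp only [id, Function.comp]
      ring)
    simp only [mul_zero, Real.exp_zero, add_zero, one_mul] at h3
    exact sub_eq_iff_eq_add.2 h3
  rw [hFb] at hσc hσr hσb
  -- Evaluation at time `l`, with the weight undone.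
  refine ⟨fun z i => Real.exp (L * l) * σ (F z) i l, ?_, ?_, ?_⟩
  · have h3 : ContDiffAt ℝ 1 (fun z => σ (F z)) (U y₁) := hσc.comp _ hFc.contDiffAt
    have h4 : ContDiff ℝ 1 (fun (w : Fin 4 → ℝ →ᵇ ℝ) (i : Fin 4) => Real.exp (L * l) * w i l) := by
      refine contDiff_pi.2 fun i => contDiff_const.mul ?_
      obtain ⟨ev, hev⟩ : ∃ ev : (ℝ →ᵇ ℝ) →L[ℝ] ℝ, ∀ u, ev u = u l :=
        ⟨BoundedContinuousFunction.evalCLM ℝ l, fun _ => rfl⟩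
      simp_rw [← hev]
      exact ev.contDiff.comp (contDiff_apply ℝ _ i)
    exact h4.contDiffAt.comp _ h3
  · ext i
    change Real.exp (L * l) * σ (F (U y₁)) i l = _
    rw [hσb, hb, hθid l ⟨by linarith, by linarith⟩, ← hl, ← mul_assoc, ← Real.exp_add]
    simp
  · filter_upwards [(hFc.continuous.tendsto (U y₁)).eventually hσr] with z hz
    obtain ⟨w, hw⟩ : ∃ w, w = σ (F z) := ⟨_, rfl⟩
    rw [← hw] at hz ⊢
    have hwi : ∀ i, w i = E (z i) + S (N w i) := fun i =>
      sub_eq_iff_eq_add.1 (congrFun hz i)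
    have hd := fun i => hSE (N w i) (w i) (z i) (hwi i)
    have hmemy : ∀ y ∈ Ioo (min y₁ y₂ - ε) (max y₁ y₂ + ε), ς * (y - y₁) ∈ Ioo (-ε) (l + ε) := by
      intro y hy
      rcases hς with rfl | rfl
      · rw [min_eq_left (by linarith), max_eq_right (by linarith)] at hy
        constructor <;> linarith [hy.1, hy.2]
      · rw [min_eq_right (by linarith), max_eq_left (by linarith)] at hy
        constructor <;> linarith [hy.1, hy.2]
    refine ⟨min y₁ y₂ - ε, max y₁ y₂ + ε,
      fun y i => Real.exp (L * (ς * (y - y₁))) * w i (ς * (y - y₁)), ?_, ?_, ?_, ?_, ?_⟩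
    · intro y hy
      refine hasDerivAt_pi.2 fun i => ?_
      have ht := hmemy y hy
      have d1 := (hd i).2 _ (hθev _ ht)
      have d2 : HasDerivAt (fun y => ς * (y - y₁)) ς y := by
        simpa using ((hasDerivAt_id y).sub_const y₁).const_mul ς
      refine (((d2.const_mul L).exp).mul (d1.comp y d2)).congr_deriv ?_
      have hθt := hθid _ (Ioo_subset_Icc_self ht)
      rw [hNapply w (fun i => Real.exp (L * (ς * (y - y₁))) * w i (ς * (y - y₁))) _ (fun i => by
        rw [hθt, ← mul_assoc, ← Real.exp_add]; simp), hθt,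
        show y₁ + ς * (ς * (y - y₁)) = y by linear_combination (y - y₁) * hς2]
      have e1 : Real.exp (L * (ς * (y - y₁))) * Real.exp (-L * (ς * (y - y₁))) = 1 := by
        rw [← Real.exp_add]; simp
      simp only [Function.comp]
      linear_combination (ς * ς * similarityField p y
        (fun i => Real.exp (L * (ς * (y - y₁))) * w i (ς * (y - y₁))) i) * e1 +
        similarityField p y
        (fun i => Real.exp (L * (ς * (y - y₁))) * w i (ς * (y - y₁))) i * hς2
    · exact ⟨by linarith [min_le_left y₁ y₂], by linarith [le_max_left y₁ y₂]⟩
    · exact ⟨by linarith [min_le_right y₁ y₂], by linarith [le_max_right y₁ y₂]⟩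
    · ext i
      simp only [sub_self, mul_zero, Real.exp_zero, one_mul]
      exact (hd i).1 0 (hθid 0 ⟨by linarith, by linarith⟩)
    · ext i
      rw [hl]
      beta_reduce
      rw [show ς * (y₁ + ς * l - y₁) = (ς * ς) * l by ring, hς2, one_mul]

/-! ### The explicit profile -/

lemma hasDerivAt_sub_rpow {y₀ y : ℝ} (hy : y₀ < y) (s : ℝ) :
    HasDerivAt (fun x => (x - y₀) ^ s) (s * (y - y₀) ^ (s - 1)) y := by
  have := ((hasDerivAt_id y).sub_const y₀).rpow_const (p := s) (Or.inl (sub_pos.2 hy).ne')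
  simpa using this

lemma eulerPhi_neg (a : ℝ) : eulerPhi (-a) = a * (a + 1) * (a + 2) * (a + 3) := by
  rw [eulerPhi]; ring

lemma eulerPhi_neg_pos {a : ℝ} (ha : 0 < a) : 0 < eulerPhi (-a) := by
  rw [eulerPhi_neg]; positivity

lemma four_div_pos {p : ℝ} (hp : 1 < p) : 0 < 4 / (p - 1) :=
  div_pos (by norm_num) (by linarith)

/-- `p a = a + 4` trades the factor `a` of `Φ(-a)` for `a + 4`. -/
lemma mul_eulerPhi {p : ℝ} (hp : 1 < p) : p * eulerPhi (-(4 / (p - 1))) =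
    (4 / (p - 1) + 1) * (4 / (p - 1) + 2) * (4 / (p - 1) + 3) * (4 / (p - 1) + 4) := by
  rw [eulerPhi_neg]
  have : p - 1 ≠ 0 := by linarith
  field_simp
  ring

lemma blowUpAmp_pos {p : ℝ} (hp : 1 < p) : 0 < blowUpAmp p :=
  Real.rpow_pos_of_pos (eulerPhi_neg_pos (four_div_pos hp)) _

lemma blowUpAmp_rpow {p : ℝ} (hp : 1 < p) :
    blowUpAmp p ^ (p - 1) = eulerPhi (-(4 / (p - 1))) := by
  have : p - 1 ≠ 0 := by linarith
  rw [blowUpAmp, ← Real.rpow_mul (eulerPhi_neg_pos (four_div_pos hp)).le, one_div,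
    inv_mul_cancel₀ this, Real.rpow_one]

/-- The coefficients of the derivatives of `r ^ (-a)`. -/
def fallingCoef (a : ℝ) : ℕ → ℝ
  | 0 => 1
  | k + 1 => fallingCoef a k * (-a - k)

lemma iteratedDeriv_blowUpProfile {p y₀ : ℝ} (n : ℕ) :
    ContDiffOn ℝ n (blowUpProfile p y₀) (Ioi y₀) ∧ ∀ k ≤ n, ∀ y ∈ Ioi y₀,
      iteratedDeriv k (blowUpProfile p y₀) y =
        blowUpAmp p * fallingCoef (4 / (p - 1)) k * (y - y₀) ^ (-(4 / (p - 1)) - k) := by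
  let g : ℕ → ℝ → ℝ := fun k y =>
    blowUpAmp p * fallingCoef (4 / (p - 1)) k * (y - y₀) ^ (-(4 / (p - 1)) - k)
  have h0 : blowUpProfile p y₀ = g 0 := by
    ext y; simp [g, blowUpProfile, fallingCoef]
  have hg : ∀ k, ∀ x ∈ Ioi y₀, HasDerivAt (g k) (g (k + 1) x) x := by
    intro k x hx
    refine ((hasDerivAt_sub_rpow hx _).const_mul _).congr_deriv ?_
    simp only [g, fallingCoef]
    push_cast
    rw [show -(4 / (p - 1)) - (k:ℝ) - 1 = -(4 / (p - 1)) - (k + 1) by ring]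
    ring
  rw [h0]
  exact ⟨contDiffOn_of_chain isOpen_Ioi n (fun k _ => hg k)
      (HasDerivAt.continuousOn (hg n)),
    iteratedDeriv_eq_of_chain isOpen_Ioi fun k _ => hg k⟩

lemma blowUpProfile_pos {p y₀ y : ℝ} (hp : 1 < p) (hy : y₀ < y) : 0 < blowUpProfile p y₀ y :=
  mul_pos (blowUpAmp_pos hp) (Real.rpow_pos_of_pos (sub_pos.2 hy) _)

lemma blowUpProfile_rpow {p y₀ y : ℝ} (hp : 1 < p) (hy : y₀ < y) :
    |blowUpProfile p y₀ y| ^ (p - 1) = eulerPhi (-(4 / (p - 1))) / (y - y₀) ^ 4 := by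
  have hr := sub_pos.2 hy
  rw [abs_of_pos (blowUpProfile_pos hp hy), blowUpProfile,
    Real.mul_rpow (blowUpAmp_pos hp).le (Real.rpow_nonneg hr.le _), blowUpAmp_rpow hp,
    ← Real.rpow_mul hr.le]
  have : p - 1 ≠ 0 := by linarith
  rw [show -(4 / (p - 1)) * (p - 1) = -((4 : ℕ) : ℝ) by field_simp; norm_num,
    Real.rpow_neg hr.le, Real.rpow_natCast]
  exact (div_eq_mul_inv _ _).symm

lemma fallingCoef_four (a : ℝ) : fallingCoef a 4 = eulerPhi (-a) := by
  simp only [fallingCoef, eulerPhi]; push_cast; ring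

lemma blowUpProfile_ode {p y₀ y : ℝ} (hp : 1 < p) (hy : y₀ < y) :
    iteratedDeriv 4 (blowUpProfile p y₀) y =
      |blowUpProfile p y₀ y| ^ (p - 1) * blowUpProfile p y₀ y := by
  have hr := sub_pos.2 hy
  rw [(iteratedDeriv_blowUpProfile 4).2 4 le_rfl y hy, blowUpProfile_rpow hp hy, fallingCoef_four,
    blowUpProfile, Real.rpow_sub hr, Real.rpow_natCast]
  ring

lemma hasDerivAt_linearization {p y₀ : ℝ} (hp : 1 < p) {Y : ℝ → ℝ}
    (hY : ContDiffOn ℝ 4 Y (Ioi y₀)) {y : ℝ} (hy : y ∈ Ioi y₀) :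
    HasDerivAt
      (fun ε : ℝ => iteratedDeriv 4 (fun x => blowUpProfile p y₀ x + ε * Y x) y -
        |blowUpProfile p y₀ y + ε * Y y| ^ (p - 1) * (blowUpProfile p y₀ y + ε * Y y))
      (iteratedDeriv 4 Y y - p * eulerPhi (-(4 / (p - 1))) / (y - y₀) ^ 4 * Y y) 0 := by
  have hn : Ioi y₀ ∈ 𝓝 y := isOpen_Ioi.mem_nhds hy
  have h1 : ∀ ε : ℝ, iteratedDeriv 4 (fun x => blowUpProfile p y₀ x + ε * Y x) y =
      iteratedDeriv 4 (blowUpProfile p y₀) y + ε * iteratedDeriv 4 Y y := by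
    intro ε
    have hYc : ContDiffAt ℝ (4 : ℕ) Y y := hY.contDiffAt hn
    rw [← iteratedDeriv_const_mul ε hYc]
    exact iteratedDeriv_add ((iteratedDeriv_blowUpProfile 4).1.contDiffAt hn)
      (contDiffAt_const.mul hYc)
  simp_rw [h1]
  have h2 : HasDerivAt (fun ε : ℝ => blowUpProfile p y₀ y + ε * Y y) (Y y) 0 := by
    simpa using ((hasDerivAt_id (0:ℝ)).mul_const (Y y)).const_add (blowUpProfile p y₀ y)
  have h3 : HasDerivAt (fun ε : ℝ => iteratedDeriv 4 (blowUpProfile p y₀) y +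
      ε * iteratedDeriv 4 Y y) (iteratedDeriv 4 Y y) 0 := by
    simpa using ((hasDerivAt_id (0:ℝ)).mul_const (iteratedDeriv 4 Y y)).const_add
      (iteratedDeriv 4 (blowUpProfile p y₀) y)
  have h4 := (hasDerivAt_abs_rpow_mul hp (blowUpProfile p y₀ y + 0 * Y y)).comp 0 h2
  refine (h3.sub h4).congr_deriv ?_
  rw [zero_mul, add_zero, blowUpProfile_rpow hp hy]
  ring

/-! ### Euler's equation -/

lemma hasDerivAt_sub_cpow {y₀ y : ℝ} (hy : y₀ < y) (m : ℂ) :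
    HasDerivAt (fun x : ℝ => ((x - y₀ : ℝ) : ℂ) ^ m) (m * ((y - y₀ : ℝ) : ℂ) ^ (m - 1)) y := by
  have h1 : HasDerivAt (fun x : ℝ => ((x - y₀ : ℝ) : ℂ)) ((1:ℝ) : ℂ) y :=
    ((hasDerivAt_id y).sub_const y₀).ofReal_comp
  have h2 : HasDerivAt (fun z : ℂ => z ^ m) (m * ((y - y₀ : ℝ) : ℂ) ^ (m - 1))
      ((y - y₀ : ℝ) : ℂ) :=
    (Complex.hasStrictDerivAt_cpow_const (Complex.ofReal_mem_slitPlane.2 (sub_pos.2 hy))).hasDerivAt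
  refine (h2.scomp y h1).congr_deriv ?_
  simp

/-- The chain of derivatives of `(y - y₀) ^ m`. -/
lemma cpow_chain {y₀ y : ℝ} (hy : y₀ < y) (m : ℂ) (k : ℕ) :
    HasDerivAt (fun x : ℝ => (∏ i ∈ Finset.range k, (m - i)) * ((x - y₀ : ℝ) : ℂ) ^ (m - k))
      ((∏ i ∈ Finset.range (k + 1), (m - i)) * ((y - y₀ : ℝ) : ℂ) ^ (m - (k + 1 : ℕ))) y := by
  refine ((hasDerivAt_sub_cpow hy (m - k)).const_mul _).congr_deriv ?_
  rw [Finset.prod_range_succ, show m - (k:ℂ) - 1 = m - ((k + 1 : ℕ) : ℂ) by push_cast; ring]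
  ring

lemma prod_range_four (m : ℂ) : ∏ i ∈ Finset.range 4, (m - i) = eulerPhi m := by
  simp [Finset.prod_range_succ, eulerPhi]

lemma pow_four_mul_cpow {r : ℝ} (hr : 0 < r) (m : ℂ) :
    (r : ℂ) ^ 4 * (r : ℂ) ^ (m - (4 : ℕ)) = (r : ℂ) ^ m := by
  have : (r : ℂ) ≠ 0 := Complex.ofReal_ne_zero.2 hr.ne'
  rw [Complex.cpow_sub _ _ this, Complex.cpow_natCast]
  field_simp

lemma euler_cpow_iff (y₀ : ℝ) (m K : ℂ) :
    (∀ y ∈ Ioi y₀, ((y - y₀ : ℝ) : ℂ) ^ 4 *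
      iteratedDeriv 4 (fun x : ℝ => ((x - y₀ : ℝ) : ℂ) ^ m) y = K * ((y - y₀ : ℝ) : ℂ) ^ m) ↔
      eulerPhi m = K := by
  have h : ∀ y ∈ Ioi y₀, ((y - y₀ : ℝ) : ℂ) ^ 4 *
      iteratedDeriv 4 (fun x : ℝ => ((x - y₀ : ℝ) : ℂ) ^ m) y =
        eulerPhi m * ((y - y₀ : ℝ) : ℂ) ^ m := by
    intro y hy
    have h1 := iteratedDeriv_eq_of_chain isOpen_Ioi (n := 4) (s := Ioi y₀)
      (g := fun k x => (∏ i ∈ Finset.range k, (m - i)) * ((x - y₀ : ℝ) : ℂ) ^ (m - k))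
      (fun k _ x hx => cpow_chain hx m k) 4 le_rfl y hy
    simp only [Finset.range_zero, Finset.prod_empty, Nat.cast_zero, sub_zero, one_mul] at h1
    rw [h1, prod_range_four, mul_left_comm, pow_four_mul_cpow (sub_pos.2 hy)]
  constructor
  · intro h'
    -- At distance `1` from `y₀` every power equals `1`, so this single point decides the equation.
    have h1 := h (y₀ + 1) (by simp)
    rw [h' (y₀ + 1) (by simp)] at h1
    simpa using h1.symm
  · rintro rfl y hy
    exact h y hy

lemma cpow_re_im {r : ℝ} (hr : 0 < r) (s ω : ℝ) :
    ((r : ℂ) ^ ((s : ℂ) + ω * Complex.I)).re = r ^ s * Real.cos (ω * Real.log r) ∧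
      ((r : ℂ) ^ ((s : ℂ) + ω * Complex.I)).im = r ^ s * Real.sin (ω * Real.log r) := by
  rw [Complex.cpow_def_of_ne_zero (Complex.ofReal_ne_zero.2 hr.ne'), ← Complex.ofReal_log hr.le,
    Complex.exp_re, Complex.exp_im, Real.rpow_def_of_pos hr]
  simp [mul_comm]

lemma isLittleO_sub_rpow {y₀ s t : ℝ} (h : t < s) :
    (fun y => (y - y₀) ^ s) =o[𝓝[>] y₀] fun y => (y - y₀) ^ t := by
  have hpos : ∀ᶠ y in 𝓝[>] y₀, 0 < y - y₀ := by
    filter_upwards [self_mem_nhdsWithin] with y hy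
    exact sub_pos.2 hy
  rw [isLittleO_iff_tendsto' (by
    filter_upwards [hpos] with y hy h0
    exact absurd h0 (Real.rpow_pos_of_pos hy _).ne')]
  have h1 : Tendsto (fun y => (y - y₀) ^ (s - t)) (𝓝[>] y₀) (𝓝 0) := by
    have : Continuous fun y : ℝ => (y - y₀) ^ (s - t) :=
      (continuous_id.sub continuous_const).rpow_const fun _ => Or.inr (by linarith)
    have h2 := (this.tendsto y₀).mono_left (nhdsWithin_le_nhds (s := Ioi y₀))
    rwa [sub_self, Real.zero_rpow (by linarith)] at h2
  refine h1.congr' ?_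
  filter_upwards [hpos] with y hy
  rw [Real.rpow_sub hy]


/-- `Φ` is symmetric under `m ↦ 3 - m`, so the root `a + 4` brings `-a - 1`. Dividing out this pair
leaves `(m - 3/2)² + ω²`. -/
lemma euler_roots {a ω : ℝ} (hω : ω ^ 2 = (a + 1) * (a + 4) - 1 / 4) (m : ℂ) :
    eulerPhi m = (((a + 1) * (a + 2) * (a + 3) * (a + 4) : ℝ) : ℂ) ↔
      m = ((a + 4 : ℝ) : ℂ) ∨ m = ((-a - 1 : ℝ) : ℂ) ∨
        m = 3 / 2 + (ω : ℂ) * Complex.I ∨ m = 3 / 2 - (ω : ℂ) * Complex.I := by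
  have hω' : (ω : ℂ) ^ 2 = (a + 1) * (a + 4) - 1 / 4 := by
    rw [← Complex.ofReal_pow, hω]; push_cast; ring
  have key : eulerPhi m - (((a + 1) * (a + 2) * (a + 3) * (a + 4) : ℝ) : ℂ) =
      (m - ((a + 4 : ℝ) : ℂ)) * ((m - ((-a - 1 : ℝ) : ℂ)) *
        ((m - (3 / 2 + (ω : ℂ) * Complex.I)) * (m - (3 / 2 - (ω : ℂ) * Complex.I)))) := by
    have h1 : (m - (3 / 2 + (ω : ℂ) * Complex.I)) * (m - (3 / 2 - (ω : ℂ) * Complex.I)) =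
        (m - 3 / 2) ^ 2 + ((a + 1) * (a + 4) - 1 / 4) := by
      rw [← hω']
      linear_combination (-(ω : ℂ) ^ 2) * Complex.I_sq
    rw [h1, eulerPhi]
    push_cast
    ring
  rw [← sub_eq_zero, key]
  simp only [mul_eq_zero, sub_eq_zero]

/-- The general element of the span of the three decaying Euler modes is a solution. -/
lemma solvesEuler_of_modes {p y₀ s ω : ℝ} {Y : ℝ → ℝ} (C₁ C₂ C₃ : ℝ)
    (hs : eulerPhi (s : ℂ) = ((p * eulerPhi (-(4 / (p - 1))) : ℝ) : ℂ))
    (hω : eulerPhi (((3 / 2 : ℝ) : ℂ) + (ω : ℂ) * Complex.I) =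
      ((p * eulerPhi (-(4 / (p - 1))) : ℝ) : ℂ))
    (hY : ∀ y ∈ Ioi y₀, Y y = C₁ * (y - y₀) ^ s +
      (y - y₀) ^ (3 / 2 : ℝ) * (C₂ * Real.cos (ω * Real.log (y - y₀)) +
        C₃ * Real.sin (ω * Real.log (y - y₀)))) : SolvesEuler p y₀ Y := by
  set n : ℂ := ((3 / 2 : ℝ) : ℂ) + (ω : ℂ) * Complex.I with hn
  -- With this `c` the oscillating part is the real part of `c (y - y₀) ^ n`, so only complex powers
  -- need differentiating.
  set c : ℂ := (C₂ : ℂ) - C₃ * Complex.I with hc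
  let G : ℕ → ℝ → ℂ := fun k x =>
    (C₁ : ℂ) * ((∏ i ∈ Finset.range k, ((s : ℂ) - i)) * ((x - y₀ : ℝ) : ℂ) ^ ((s : ℂ) - k)) +
      c * ((∏ i ∈ Finset.range k, (n - i)) * ((x - y₀ : ℝ) : ℂ) ^ (n - k))
  have hG : ∀ k, ∀ x ∈ Ioi y₀, HasDerivAt (fun x => (G k x).re) (G (k + 1) x).re x := fun k x hx =>
    Complex.reCLM.hasFDerivAt.comp_hasDerivAt x
      (((cpow_chain hx (s : ℂ) k).const_mul _).add ((cpow_chain hx n k).const_mul _))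
  have h0 : ∀ y ∈ Ioi y₀, Y y = (G 0 y).re := by
    intro y hy
    have hr := sub_pos.2 (show y₀ < y from hy)
    obtain ⟨h1, h2⟩ := cpow_re_im hr (3 / 2) ω
    have h3 : (((y - y₀ : ℝ) : ℂ) ^ (s : ℂ)) = (((y - y₀) ^ s : ℝ) : ℂ) :=
      (Complex.ofReal_cpow hr.le s).symm
    rw [hY y hy]
    simp only [G, Finset.range_zero, Finset.prod_empty, Nat.cast_zero, sub_zero, one_mul, h3]
    rw [Complex.add_re, Complex.mul_re c, hn, h1, h2, ← Complex.ofReal_mul, Complex.ofReal_re]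
    simp [hc]
    ring
  refine ⟨(contDiffOn_of_chain isOpen_Ioi 4 (fun k _ => hG k)
    (HasDerivAt.continuousOn (hG 4))).congr h0, fun y hy => ?_⟩
  have hev : Y =ᶠ[𝓝 y] fun x => (G 0 x).re := by
    filter_upwards [isOpen_Ioi.mem_nhds hy] with x hx using h0 x hx
  rw [hev.iteratedDeriv_eq, iteratedDeriv_eq_of_chain isOpen_Ioi (n := 4)
    (g := fun k x => (G k x).re) (fun k _ => hG k) 4 le_rfl y hy, h0 y hy]
  have hr := sub_pos.2 (show y₀ < y from hy)
  rw [← Complex.re_ofReal_mul, ← Complex.re_ofReal_mul]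
  congr 1
  simp only [G, prod_range_four, Finset.range_zero, Finset.prod_empty, Nat.cast_zero, sub_zero,
    one_mul, hs, hω]
  rw [← pow_four_mul_cpow hr s, ← pow_four_mul_cpow hr n]
  push_cast
  ring

/-- The first integrals of Euler's equation attached to the characteristic roots. -/
lemma SolvesEuler.firstIntegral {p y₀ : ℝ} {Y : ℝ → ℝ} (h : SolvesEuler p y₀ Y) {m : ℂ}
    (hm : eulerPhi m = ((p * eulerPhi (-(4 / (p - 1))) : ℝ) : ℂ)) :
    ∃ c : ℂ, ∀ y ∈ Ioi y₀, (((y - y₀) ^ 3 * iteratedDeriv 3 Y y : ℝ) : ℂ) +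
      (m - 3) * (((y - y₀) ^ 2 * iteratedDeriv 2 Y y : ℝ) : ℂ) +
      (m - 2) * (m - 3) * (((y - y₀) * iteratedDeriv 1 Y y : ℝ) : ℂ) +
      (m - 1) * (m - 2) * (m - 3) * (Y y : ℂ) = c * ((y - y₀ : ℝ) : ℂ) ^ m := by
  have hD : ∀ k < 4, ∀ y ∈ Ioi y₀, HasDerivAt (fun x => ((iteratedDeriv k Y x : ℝ) : ℂ))
      ((iteratedDeriv (k + 1) Y y : ℝ) : ℂ) y := fun k hk y hy =>
    (hasDerivAt_iteratedDeriv isOpen_Ioi h.1 hk hy).ofReal_comp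
  have hr : ∀ y, HasDerivAt (fun x : ℝ => ((x - y₀ : ℝ) : ℂ)) ((1 : ℝ) : ℂ) y := fun y =>
    ((hasDerivAt_id y).sub_const y₀).ofReal_comp
  -- With `θ = (y - y₀) d/dy`, the combination is `q(θ) Y` where `Φ(θ) - Φ(m) = (θ - m) q(θ)`.
  -- Euler's equation therefore makes it an eigenfunction of `θ` with eigenvalue `m`, a multiple of
  -- the power `m`.
  have hd : ∀ y ∈ Ioi y₀, HasDerivAt (fun y : ℝ => (((y - y₀ : ℝ) : ℂ) ^ 3 *
      ((iteratedDeriv 3 Y y : ℝ) : ℂ) +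
      (m - 3) * (((y - y₀ : ℝ) : ℂ) ^ 2 * ((iteratedDeriv 2 Y y : ℝ) : ℂ)) +
      (m - 2) * (m - 3) * (((y - y₀ : ℝ) : ℂ) * ((iteratedDeriv 1 Y y : ℝ) : ℂ)) +
      (m - 1) * (m - 2) * (m - 3) * ((iteratedDeriv 0 Y y : ℝ) : ℂ)) *
        ((y - y₀ : ℝ) : ℂ) ^ (-m)) 0 y := by
    intro y hy
    have hy' : ((y - y₀ : ℝ) : ℂ) ≠ 0 := Complex.ofReal_ne_zero.2 (sub_pos.2 hy).ne'
    refine (((((((hr y).pow 3).mul (hD 3 (by norm_num) y hy)).add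
      ((((hr y).pow 2).mul (hD 2 (by norm_num) y hy)).const_mul _)).add
      (((hr y).mul (hD 1 (by norm_num) y hy)).const_mul _)).add
      ((hD 0 (by norm_num) y hy).const_mul _)).mul (hasDerivAt_sub_cpow hy (-m))).congr_deriv ?_
    have e : ((y - y₀ : ℝ) : ℂ) ^ (-m) = ((y - y₀ : ℝ) : ℂ) * ((y - y₀ : ℝ) : ℂ) ^ (-m - 1) := by
      rw [Complex.cpow_sub _ _ hy', Complex.cpow_one]
      field_simp
    have e4 : ((y - y₀ : ℝ) : ℂ) ^ 4 * ((iteratedDeriv 4 Y y : ℝ) : ℂ) =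
        eulerPhi m * ((iteratedDeriv 0 Y y : ℝ) : ℂ) := by
      rw [hm, iteratedDeriv_zero]
      exact_mod_cast congrArg Complex.ofReal (h.2 y hy)
    rw [e]
    simp only [eulerPhi, Pi.add_apply, Pi.mul_apply, Pi.pow_apply, Complex.ofReal_one,
      Nat.reduceSub, Nat.reduceAdd] at e4 ⊢
    push_cast at e4 ⊢
    linear_combination (((y : ℂ) - y₀) ^ (-m - 1)) * e4
  obtain ⟨c, hc⟩ := isOpen_Ioi.exists_is_const_of_deriv_eq_zero isPreconnected_Ioi
    (fun y hy => (hd y hy).differentiableAt.differentiableWithinAt)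
    (fun y hy => (hd y hy).deriv)
  refine ⟨c, fun y hy => ?_⟩
  have hy' : ((y - y₀ : ℝ) : ℂ) ≠ 0 := Complex.ofReal_ne_zero.2 (sub_pos.2 hy).ne'
  rw [← hc y hy, mul_assoc _ (_ ^ (-m)), ← Complex.cpow_add _ _ hy', neg_add_cancel, Complex.cpow_zero, mul_one,
    iteratedDeriv_zero]
  push_cast
  ring

/-- Real solutions of Euler's equation in terms of the characteristic roots. -/
lemma SolvesEuler.exists_modes {p y₀ ω ν : ℝ} {Y : ℝ → ℝ} (h : SolvesEuler p y₀ Y)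
    (hω : 0 < ω) (hν : 0 < ν)
    (h₁ : eulerPhi (((3 / 2 + ν : ℝ) : ℂ)) = ((p * eulerPhi (-(4 / (p - 1))) : ℝ) : ℂ))
    (h₂ : eulerPhi (((3 / 2 - ν : ℝ) : ℂ)) = ((p * eulerPhi (-(4 / (p - 1))) : ℝ) : ℂ))
    (h₃ : eulerPhi (((3 / 2 : ℝ) : ℂ) + (ω : ℂ) * Complex.I) =
      ((p * eulerPhi (-(4 / (p - 1))) : ℝ) : ℂ)) :
    ∃ C₀ C₁ C₂ C₃ : ℝ, ∀ y ∈ Ioi y₀, Y y = C₀ * (y - y₀) ^ (3 / 2 - ν) +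
      (C₁ * (y - y₀) ^ (3 / 2 + ν) +
      (y - y₀) ^ (3 / 2 : ℝ) * (C₂ * Real.cos (ω * Real.log (y - y₀)) +
        C₃ * Real.sin (ω * Real.log (y - y₀)))) := by
  obtain ⟨c₁, hc₁⟩ := h.firstIntegral h₁
  obtain ⟨c₂, hc₂⟩ := h.firstIntegral h₂
  obtain ⟨c₃, hc₃⟩ := h.firstIntegral h₃
  have hq : 0 < ν ^ 2 + ω ^ 2 := by positivity
  -- Lagrange interpolation at the roots: `Y` is the sum of `c_m (y - y₀) ^ m / Φ'(m)`, where
  -- `Φ'(3/2 ± ν) = ± 2ν(ν² + ω²)` and `Φ'(3/2 + iω) = -2iω(ν² + ω²)`.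
  refine ⟨-(c₂.re / (2 * ν)) / (ν ^ 2 + ω ^ 2), c₁.re / (2 * ν) / (ν ^ 2 + ω ^ 2),
    -(c₃.im / ω) / (ν ^ 2 + ω ^ 2), -(c₃.re / ω) / (ν ^ 2 + ω ^ 2), fun y hy => ?_⟩
  have hr := sub_pos.2 (show y₀ < y from hy)
  obtain ⟨e1, e2⟩ := cpow_re_im hr (3 / 2) ω
  have k₁ := congrArg Complex.re (hc₁ y hy)
  have k₂ := congrArg Complex.re (hc₂ y hy)
  have k₃ := congrArg Complex.im (hc₃ y hy)
  rw [← Complex.ofReal_cpow hr.le, Complex.re_mul_ofReal] at k₁ k₂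
  rw [Complex.mul_im, e1, e2] at k₃
  simp only [Complex.add_re, Complex.add_im, Complex.mul_re, Complex.mul_im, Complex.sub_re,
    Complex.sub_im, Complex.ofReal_re, Complex.ofReal_im, Complex.I_re, Complex.I_im, Complex.re_ofNat, Complex.im_ofNat, Complex.one_re, Complex.one_im] at k₁ k₂ k₃
  generalize (y - y₀) ^ (3 / 2 + ν) = R₁ at *
  generalize (y - y₀) ^ (3 / 2 - ν) = R₂ at *
  field_simp
  linear_combination ω * k₁ - ω * k₂ - 2 * ν * k₃

/-- The characteristic roots, and the solutions of Euler's equation that are small compared with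
the profile. -/
lemma euler_classification {p : ℝ} (hp : 1 < p) :
    ∃ mplus mminus ω : ℝ, 3 < mplus ∧ mminus < -(4 / (p - 1)) ∧ 0 < ω ∧
      (∀ m : ℂ, eulerPhi m = (p : ℂ) * eulerPhi (-(4 / ((p : ℂ) - 1))) ↔
        m = mplus ∨ m = mminus ∨
          m = 3 / 2 + (ω : ℂ) * Complex.I ∨ m = 3 / 2 - (ω : ℂ) * Complex.I) ∧
      ∀ (y₀ : ℝ) (Y : ℝ → ℝ),
        (SolvesEuler p y₀ Y ∧ Y =o[𝓝[>] y₀] blowUpProfile p y₀) ↔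
        ∃ C₁ C₂ C₃ : ℝ, ∀ y ∈ Ioi y₀,
          Y y = C₁ * (y - y₀) ^ mplus +
            (y - y₀) ^ (3 / 2 : ℝ) * (C₂ * Real.cos (ω * Real.log (y - y₀)) +
              C₃ * Real.sin (ω * Real.log (y - y₀))) := by
  have ha := four_div_pos hp
  have hK := mul_eulerPhi hp
  have hKC : (p : ℂ) * eulerPhi (-(4 / ((p : ℂ) - 1))) =
      ((p * eulerPhi (-(4 / (p - 1))) : ℝ) : ℂ) := by
    simp only [eulerPhi]; push_cast; rfl
  rw [hKC]
  set a := 4 / (p - 1) with ha'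
  have hpos : 0 < (a + 1) * (a + 4) - 1 / 4 := by nlinarith
  set ω := √((a + 1) * (a + 4) - 1 / 4) with hω'
  have hω : 0 < ω := Real.sqrt_pos.2 hpos
  have hω2 : ω ^ 2 = (a + 1) * (a + 4) - 1 / 4 := Real.sq_sqrt hpos.le
  have hroots := euler_roots hω2
  rw [← hK] at hroots
  have e1 : (3 / 2 + (a + 5 / 2) : ℝ) = a + 4 := by ring
  have e2 : (3 / 2 - (a + 5 / 2) : ℝ) = -a - 1 := by ring
  have r1 := (hroots ((a + 4 : ℝ) : ℂ)).2 (Or.inl rfl)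
  have r2 := (hroots ((-a - 1 : ℝ) : ℂ)).2 (Or.inr (Or.inl rfl))
  have r3 := (hroots (((3 / 2 : ℝ) : ℂ) + (ω : ℂ) * Complex.I)).2
    (Or.inr (Or.inr (Or.inl (by push_cast; rfl))))
  have hsmall : ∀ (y₀ : ℝ) (Y : ℝ → ℝ) (C₁ C₂ C₃ : ℝ), (∀ y ∈ Ioi y₀,
      Y y = C₁ * (y - y₀) ^ (a + 4) +
        (y - y₀) ^ (3 / 2 : ℝ) * (C₂ * Real.cos (ω * Real.log (y - y₀)) +
          C₃ * Real.sin (ω * Real.log (y - y₀)))) → Y =o[𝓝[>] y₀] fun y => (y - y₀) ^ (-a) := by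
    intro y₀ Y C₁ C₂ C₃ hY
    have h1 : (fun y => C₁ * (y - y₀) ^ (a + 4)) =o[𝓝[>] y₀] fun y => (y - y₀) ^ (-a) :=
      (isLittleO_sub_rpow (by linarith)).const_mul_left _
    have hb : (fun y => C₂ * Real.cos (ω * Real.log (y - y₀)) +
          C₃ * Real.sin (ω * Real.log (y - y₀))) =O[𝓝[>] y₀] fun _ => (1 : ℝ) := by
      refine IsBigO.of_bound (|C₂| + |C₃|) (Eventually.of_forall fun y => ?_)
      rw [Real.norm_eq_abs, norm_one, mul_one]
      refine (abs_add_le _ _).trans (add_le_add ?_ ?_) <;> rw [abs_mul]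
      · exact mul_le_of_le_one_right (abs_nonneg _) (Real.abs_cos_le_one _)
      · exact mul_le_of_le_one_right (abs_nonneg _) (Real.abs_sin_le_one _)
    have h2 := (isLittleO_sub_rpow (y₀ := y₀) (show -a < 3 / 2 by linarith)).mul_isBigO hb
    simp only [mul_one] at h2
    refine (h1.add h2).congr' ?_ EventuallyEq.rfl
    filter_upwards [self_mem_nhdsWithin] with y hy using (hY y hy).symm
  have hprof : ∀ (y₀ : ℝ) (Y : ℝ → ℝ), Y =o[𝓝[>] y₀] blowUpProfile p y₀ ↔
      Y =o[𝓝[>] y₀] fun y => (y - y₀) ^ (-a) := fun y₀ Y =>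
    isLittleO_const_mul_right_iff (blowUpAmp_pos hp).ne'
  refine ⟨a + 4, -a - 1, ω, by linarith, by linarith, hω, hroots, fun y₀ Y => ⟨?_, ?_⟩⟩
  · rintro ⟨hE, ho⟩
    obtain ⟨C₀, C₁, C₂, C₃, hC⟩ := hE.exists_modes hω (show 0 < a + 5 / 2 by linarith)
      (by rw [e1]; exact r1) (by rw [e2]; exact r2) r3
    rw [e1, e2] at hC
    have h1 := ((hprof y₀ Y).1 ho).sub (hsmall y₀ _ C₁ C₂ C₃ fun y _ => rfl)
    -- Removing the three small modes leaves `C₀ (y - y₀) ^ (-a - 1)`. It is `o` of the profile,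
    -- hence `o` of the larger power `(y - y₀) ^ (-a - 1)`, which forces `C₀ = 0`.
    have h2 : (fun y => C₀ * (y - y₀) ^ (-a - 1)) =o[𝓝[>] y₀] fun y => (y - y₀) ^ (-a - 1) := by
      refine (h1.congr' ?_ EventuallyEq.rfl).trans (isLittleO_sub_rpow (by linarith))
      filter_upwards [self_mem_nhdsWithin] with y hy
      rw [hC y hy]; ring
    have h3 : C₀ = 0 := by
      by_contra h0
      have h4 := (isLittleO_const_mul_left_iff h0).1 h2
      refine isLittleO_irrefl (Eventually.frequently ?_) h4
      filter_upwards [self_mem_nhdsWithin] with y hy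
      exact (Real.rpow_pos_of_pos (sub_pos.2 hy) _).ne'
    refine ⟨C₁, C₂, C₃, fun y hy => ?_⟩
    rw [hC y hy, h3, zero_mul, zero_add]
  · rintro ⟨C₁, C₂, C₃, hY⟩
    exact ⟨solvesEuler_of_modes C₁ C₂ C₃ r1 r3 hY, (hprof y₀ Y).2 (hsmall y₀ Y C₁ C₂ C₃ hY)⟩

/-! ### Signs of the derivatives near a blow-up point -/

/-- Mean value inequality on a bounded interval. It is used contrapositively: unboundedness passes
from a function to its derivative. -/
lemma isBigO_one_of_hasDerivAt {F G : ℝ → ℝ} {c : ℝ}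
    (hF : ∀ᶠ y in 𝓝[>] c, HasDerivAt F (G y) y) (hG : G =O[𝓝[>] c] fun _ => (1 : ℝ)) :
    F =O[𝓝[>] c] fun _ => (1 : ℝ) := by
  obtain ⟨M, hM⟩ := hG.bound
  obtain ⟨d, hd, h⟩ := mem_nhdsGT_iff_exists_Ioo_subset.1 (hF.and hM)
  obtain ⟨e, he⟩ := exists_between (show c < d from hd)
  refine IsBigO.of_bound (‖F e‖ + M * (d - c)) ?_
  filter_upwards [Ioo_mem_nhdsGT hd] with y hy
  have h1 := (convex_Ioo c d).norm_image_sub_le_of_norm_hasDerivWithin_le (f := F) (f' := G)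
    (C := M) (fun x hx => (h hx).1.hasDerivWithinAt)
    (fun x hx => by simpa using (h hx).2) (show e ∈ Ioo c d from he) hy
  have hM0 : 0 ≤ M := by
    have := (norm_nonneg _).trans (h he).2
    simpa using this
  have h2 : ‖y - e‖ ≤ d - c := by
    rw [Real.norm_eq_abs, abs_le]; constructor <;> linarith [hy.1, hy.2, he.1, he.2]
  have h3 : ‖F y‖ ≤ ‖F e‖ + ‖F y - F e‖ := by
    simpa using norm_add_le (F e) (F y - F e)
  rw [norm_one, mul_one]
  nlinarith [mul_le_mul_of_nonneg_left h2 hM0]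

/-- An increasing function is bounded above near the left end point, so it can be unbounded there
only by tending to `-∞`. -/
lemma tendsto_atBot_of_hasDerivAt_pos {F G : ℝ → ℝ} {c : ℝ}
    (hF : ∀ᶠ y in 𝓝[>] c, HasDerivAt F (G y) y) (hG : ∀ᶠ y in 𝓝[>] c, 0 < G y)
    (hb : ¬ F =O[𝓝[>] c] fun _ => (1 : ℝ)) : Tendsto F (𝓝[>] c) atBot := by
  obtain ⟨d, hd, h⟩ := mem_nhdsGT_iff_exists_Ioo_subset.1 (hF.and hG)
  have hmono : StrictMonoOn F (Ioo c d) := by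
    refine strictMonoOn_of_deriv_pos (convex_Ioo c d)
      (HasDerivAt.continuousOn fun x hx => (h hx).1) fun x hx => ?_
    rw [interior_Ioo] at hx
    rw [(h hx).1.deriv]
    exact (h hx).2
  obtain ⟨e, he⟩ := exists_between (show c < d from hd)
  rw [tendsto_atBot]
  intro M
  by_cases hM : ∃ x ∈ Ioo c d, F x ≤ M
  · obtain ⟨x, hx, hxM⟩ := hM
    filter_upwards [Ioo_mem_nhdsGT hx.1] with y hy
    exact (hmono ⟨hy.1, hy.2.trans hx.2⟩ hx hy.2).le.trans hxM
  · push Not at hM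
    refine absurd (IsBigO.of_bound (|M| + |F e|) ?_) hb
    filter_upwards [Ioo_mem_nhdsGT he.1] with y hy
    have hy' : y ∈ Ioo c d := ⟨hy.1, hy.2.trans he.2⟩
    have h1 := hM y hy'
    have h2 := hmono hy' he hy.2
    rw [norm_one, mul_one, Real.norm_eq_abs, abs_le]
    constructor
    · linarith [neg_abs_le M, abs_nonneg (F e)]
    · linarith [le_abs_self (F e), abs_nonneg M]

/-- If `F₀` blows up at `c⁺` and its fourth derivative is positive there, then the derivatives
alternate in sign. -/
lemma alternating_of_blowUp {F₀ F₁ F₂ F₃ F₄ : ℝ → ℝ} {c : ℝ}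
    (h₀ : ∀ᶠ y in 𝓝[>] c, HasDerivAt F₀ (F₁ y) y) (h₁ : ∀ᶠ y in 𝓝[>] c, HasDerivAt F₁ (F₂ y) y)
    (h₂ : ∀ᶠ y in 𝓝[>] c, HasDerivAt F₂ (F₃ y) y) (h₃ : ∀ᶠ y in 𝓝[>] c, HasDerivAt F₃ (F₄ y) y)
    (h₄ : ∀ᶠ y in 𝓝[>] c, 0 < F₄ y) (hF : Tendsto F₀ (𝓝[>] c) atTop) :
    (∀ᶠ y in 𝓝[>] c, F₁ y < 0) ∧ (∀ᶠ y in 𝓝[>] c, 0 < F₂ y) ∧ ∀ᶠ y in 𝓝[>] c, F₃ y < 0 := by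
  -- Unboundedness climbs from `F₀` to `F₃`; the sign of `F₄` then descends, reversing at each
  -- level.
  have b₀ : ¬ F₀ =O[𝓝[>] c] fun _ => (1 : ℝ) := fun h =>
    not_isBoundedUnder_of_tendsto_atTop (tendsto_norm_atTop_atTop.comp hF)
      ((isBigO_one_iff ℝ).1 h)
  have b₁ := fun h => b₀ (isBigO_one_of_hasDerivAt h₀ h)
  have b₂ := fun h => b₁ (isBigO_one_of_hasDerivAt h₁ h)
  have b₃ := fun h => b₂ (isBigO_one_of_hasDerivAt h₂ h)
  have t₃ := (tendsto_atBot_of_hasDerivAt_pos h₃ h₄ b₃).eventually (eventually_lt_atBot 0)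
  have t₂ : ∀ᶠ y in 𝓝[>] c, 0 < F₂ y := by
    have := tendsto_atBot_of_hasDerivAt_pos (F := fun y => -F₂ y) (G := fun y => -F₃ y)
      (h₂.mono fun y hy => hy.neg) (t₃.mono fun y hy => neg_pos.2 hy)
      (fun h => b₂ (isBigO_neg_left.1 h))
    exact (this.eventually (eventually_lt_atBot 0)).mono fun y hy => neg_lt_zero.1 hy
  exact ⟨(tendsto_atBot_of_hasDerivAt_pos h₁ t₂ b₁).eventually (eventually_lt_atBot 0), t₂, t₃⟩

/-! ### Convergence to the profile -/

/-- A Gronwall-type lemma in the time `-log H`. -/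
lemma eventually_le_of_dissipative {H h Λ Λ' : ℝ → ℝ} {c κ : ℝ} (hκ : 0 < κ)
    (hH : ∀ᶠ y in 𝓝[>] c, 0 < H y ∧ HasDerivAt H (h y) y)
    (hH0 : Tendsto H (𝓝[>] c) (𝓝 0)) (hΛ : ∀ᶠ y in 𝓝[>] c, HasDerivAt Λ (Λ' y) y)
    (hd : ∀ ε > 0, ∀ᶠ y in 𝓝[>] c, -(H y * Λ' y) ≤ h y * (-(κ * Λ y) + ε)) :
    ∀ ε > 0, ∀ᶠ y in 𝓝[>] c, Λ y ≤ ε := by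
  intro ε hε
  obtain ⟨d, hdc, hs⟩ := mem_nhdsGT_iff_exists_Ioo_subset.1
    (hH.and (hΛ.and (hd (κ * ε / 2) (by positivity))))
  -- `H ^ (-κ)` is the integrating factor. Dissipation makes the product nondecreasing in `y`, hence
  -- bounded above as `y` decreases to `c`, and multiplying back by `H ^ κ → 0` leaves `Λ - ε / 2`
  -- asymptotically nonpositive.
  have hD : ∀ y ∈ Ioo c d, HasDerivAt (fun y => H y ^ (-κ) * (Λ y - ε / 2))
      ((h y * (-κ) * H y ^ (-κ - 1)) * (Λ y - ε / 2) + H y ^ (-κ) * Λ' y) y := fun y hy =>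
    ((hs hy).1.2.rpow_const (Or.inl (hs hy).1.1.ne')).mul ((hs hy).2.1.sub_const _)
  have hmono : MonotoneOn (fun y => H y ^ (-κ) * (Λ y - ε / 2)) (Ioo c d) := by
    refine monotoneOn_of_deriv_nonneg (convex_Ioo c d) (HasDerivAt.continuousOn hD)
      (fun x hx => (hD x (interior_subset hx)).differentiableAt.differentiableWithinAt) ?_
    intro y hy
    rw [interior_Ioo] at hy
    rw [(hD y hy).deriv]
    obtain ⟨⟨hpos, -⟩, -, hle⟩ := hs hy
    have e : H y ^ (-κ) = H y * H y ^ (-κ - 1) := by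
      rw [Real.rpow_sub_one hpos.ne']; field_simp
    rw [e]
    have := Real.rpow_pos_of_pos hpos (-κ - 1)
    nlinarith
  obtain ⟨e, he⟩ := exists_between (show c < d from hdc)
  set M := H e ^ (-κ) * (Λ e - ε / 2)
  have hlim : Tendsto (fun y => |M| * H y ^ κ) (𝓝[>] c) (𝓝 0) := by
    have := (hH0.rpow_const (p := κ) (Or.inr hκ.le)).const_mul |M|
    rwa [Real.zero_rpow hκ.ne', mul_zero] at this
  filter_upwards [hlim.eventually (gt_mem_nhds (half_pos hε)), Ioo_mem_nhdsGT he.1] with y hy1 hy2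
  have hy' : y ∈ Ioo c d := ⟨hy2.1, hy2.2.trans he.2⟩
  have h1 : H y ^ (-κ) * (Λ y - ε / 2) ≤ M := hmono hy' he hy2.2.le
  have hpos := (hs hy').1.1
  have h2 : H y ^ κ * (H y ^ (-κ) * (Λ y - ε / 2)) = Λ y - ε / 2 := by
    rw [← mul_assoc, ← Real.rpow_add hpos, add_neg_cancel, Real.rpow_zero, one_mul]
  have h3 := mul_le_mul_of_nonneg_left (h1.trans (le_abs_self M)) (Real.rpow_nonneg hpos.le κ)
  rw [h2] at h3
  linarith

/-! Elementary inequalities for the potential `n ^ 3 + 3 / (2 n ^ 2) - 5 / 2`. -/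

/-- Coercivity of the potential about its minimum at `n = 1`, from an exact factorization with the
factor `(n - 1)²`. -/
lemma potential_ge {n : ℝ} (hn : 0 < n) :
    2 * (n - 1) ^ 2 ≤ n ^ 3 + 3 / 2 * (1 / n ^ 2) - 5 / 2 := by
  have : n ^ 3 + 3 / 2 * (1 / n ^ 2) - 5 / 2 - 2 * (n - 1) ^ 2 =
      (n - 1) ^ 2 * (2 * n ^ 3 + 6 * n + 3) / (2 * n ^ 2) := by
    field_simp; ring
  have h : 0 ≤ (n - 1) ^ 2 * (2 * n ^ 3 + 6 * n + 3) / (2 * n ^ 2) := by positivity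
  linarith

/-- The right side is the dissipation of the planar system in the `n` direction. Domination of the
potential by it yields exponential decay rather than mere monotonicity. -/
lemma potential_le {n : ℝ} (hn : 0 < n) :
    n ^ 3 + 3 / 2 * (1 / n ^ 2) - 5 / 2 ≤ (n ^ 3 - 1) * (1 - 1 / n ^ 5) := by
  have : (n ^ 3 - 1) * (1 - 1 / n ^ 5) - (n ^ 3 + 3 / 2 * (1 / n ^ 2) - 5 / 2) =
      (n - 1) ^ 2 * (3 * n ^ 3 + 6 * n ^ 2 + 4 * n + 2) / (2 * n ^ 5) := by
    field_simp; ring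
  have h : 0 ≤ (n - 1) ^ 2 * (3 * n ^ 3 + 6 * n ^ 2 + 4 * n + 2) / (2 * n ^ 5) := by positivity
  linarith

lemma one_div_sq_le {n : ℝ} (hn : 0 < n) :
    1 / n ^ 2 ≤ (n ^ 3 + 3 / 2 * (1 / n ^ 2) - 5 / 2) + 2 := by
  rcases le_total n 1 with h | h
  · have : 1 ≤ 1 / n ^ 2 := by
      rw [le_div_iff₀ (by positivity)]; nlinarith
    have := pow_pos hn 3
    linarith
  · have := one_le_pow₀ h (n := 3)
    have : 0 ≤ 1 / n ^ 2 := by positivity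
    linarith

/-- Near `n = 0` the perturbation factor is unbounded, but there `(n³ - 1)² ≥ 1/2`, so `n⁻⁵` is
controlled by `n⁻⁵ (n³ - 1)²`, itself below the dissipation. For `n ≥ 1/2` one has `n⁻⁵ ≤ 32`. The
inequality `2|xy| ≤ x² + y²` combines the two. -/
lemma abs_dissipation_le {n : ℝ} (hn : 0 < n) :
    |1 / n ^ 5 * (n ^ 3 - 1)| ≤ 16 + 2 * ((n ^ 3 - 1) * (1 - 1 / n ^ 5)) := by
  have h5 : 0 < 1 / n ^ 5 := by positivity
  have h1 : 1 / n ^ 5 * (n ^ 3 - 1) ^ 2 ≤ (n ^ 3 - 1) * (1 - 1 / n ^ 5) := by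
    have e : (n ^ 3 - 1) * (1 - 1 / n ^ 5) - 1 / n ^ 5 * (n ^ 3 - 1) ^ 2 =
        n ^ 3 * (n - 1) ^ 2 * (n + 1) * (n ^ 2 + n + 1) * (1 / n ^ 5) := by
      field_simp; ring
    have : 0 ≤ n ^ 3 * (n - 1) ^ 2 * (n + 1) * (n ^ 2 + n + 1) * (1 / n ^ 5) := by positivity
    linarith
  have h2 : 1 / n ^ 5 ≤ 32 + 2 * (1 / n ^ 5 * (n ^ 3 - 1) ^ 2) := by
    rcases le_total n (1 / 2) with h | h
    · have : n ^ 3 ≤ 1 / 8 := by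
        have := pow_le_pow_left₀ hn.le h 3
        norm_num at this ⊢; exact this
      have : 1 / 2 ≤ (n ^ 3 - 1) ^ 2 := by nlinarith
      nlinarith
    · have : 1 / n ^ 5 ≤ 32 := by
        rw [div_le_iff₀ (by positivity)]
        have := pow_le_pow_left₀ (by norm_num) h 5
        norm_num at this ⊢; linarith
      nlinarith [sq_nonneg (n ^ 3 - 1)]
  have h3 : |1 / n ^ 5 * (n ^ 3 - 1)| ≤ 1 / 2 * (1 / n ^ 5 + 1 / n ^ 5 * (n ^ 3 - 1) ^ 2) := by
    rw [abs_le]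
    constructor <;> nlinarith [mul_nonneg h5.le (sq_nonneg (n ^ 3)), mul_nonneg h5.le (sq_nonneg (n ^ 3 - 2))]
  have h4 : 0 ≤ 1 / n ^ 5 * (n ^ 3 - 1) ^ 2 := by positivity
  linarith

/-- The dissipation inequality, in which `u = Z - 1`, `δ` and `η` are the perturbations. -/
lemma dissipation_le {a n u δ η ε : ℝ} (ha : 0 < a) (hn : 0 < n)
    (hs : 3 * (a + 1) / 2 * |δ| + 3 / 2 * (a + 2) * |η| + 3 / 4 * |δ| ≤ (a + 3) / 4)
    (he : 12 * (a + 1) * |δ| + 3 * (a + 2) * |η| + 3 / 2 * |δ| ≤ ε) :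
    -(3 * (a + 1) / 2 * ((a + 3) / 2) * (u ^ 2 + (n ^ 3 - 1) * (1 - 1 / n ^ 5))) +
      1 / 2 * (3 * (a + 1) / 2) * δ * (1 / n ^ 5 * (n ^ 3 - 1)) +
      3 / 2 * (a + 2) * (1 / n ^ 2) * η ≤
    -(1 / 2 * (3 * (a + 1) / 2) * u ^ 2 +
      (a + 3) / 2 * (n ^ 3 + 3 / 2 * (1 / n ^ 2) - 5 / 2) + 3 / 4 * δ * (1 / n ^ 2)) + ε := by
  have h1 := potential_ge hn
  have h2 := potential_le hn
  have h3 := one_div_sq_le hn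
  have h4 := abs_dissipation_le hn
  have h5 : 0 ≤ 1 / n ^ 2 := by positivity
  set W := n ^ 3 + 3 / 2 * (1 / n ^ 2) - 5 / 2
  set R := (n ^ 3 - 1) * (1 - 1 / n ^ 5)
  have hW : 0 ≤ W := (by positivity : (0:ℝ) ≤ 2 * (n - 1) ^ 2).trans h1
  have e1 : δ * (1 / n ^ 5 * (n ^ 3 - 1)) ≤ |δ| * (16 + 2 * R) :=
    (le_abs_self _).trans (by rw [abs_mul]; exact mul_le_mul_of_nonneg_left h4 (abs_nonneg _))
  have e2 : 1 / n ^ 2 * η ≤ |η| * (R + 2) := by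
    calc 1 / n ^ 2 * η ≤ 1 / n ^ 2 * |η| := mul_le_mul_of_nonneg_left (le_abs_self _) h5
      _ ≤ (R + 2) * |η| := mul_le_mul_of_nonneg_right (by linarith) (abs_nonneg _)
      _ = _ := mul_comm _ _
  have e3 : δ * (1 / n ^ 2) ≤ |δ| * (R + 2) := by
    calc δ * (1 / n ^ 2) ≤ |δ| * (1 / n ^ 2) := mul_le_mul_of_nonneg_right (le_abs_self _) h5
      _ ≤ |δ| * (R + 2) := mul_le_mul_of_nonneg_left (by linarith) (abs_nonneg _)
  -- The dissipation exceeds what decay at rate `1` requires by at least `(a + 3) / 4 * R`.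
  -- Hypothesis `hs` fits the perturbation terms proportional to `R` into this surplus, and `he`
  -- puts the constant ones into `ε`.
  have g1 := mul_le_mul_of_nonneg_left e1 (show 0 ≤ 1 / 2 * (3 * (a + 1) / 2) by positivity)
  have g2 := mul_le_mul_of_nonneg_left e2 (show 0 ≤ 3 / 2 * (a + 2) by positivity)
  have hR : 0 ≤ R := hW.trans h2
  have g3 := mul_le_mul_of_nonneg_right hs hR
  have g4 : 0 ≤ (a + 1) * (a + 1 + 1) * u ^ 2 := by positivity
  have g5 : 0 ≤ (a + 3) * a * R := by positivity
  have g6 := mul_le_mul_of_nonneg_left h2 (show 0 ≤ (a + 3) / 2 by positivity)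
  have g7 : 0 ≤ a * ((a + 1) * u ^ 2) := by positivity
  have g8 : 0 ≤ (a + 1) * u ^ 2 := by positivity
  have g9 : 0 ≤ (a + 3) * R := by positivity
  nlinarith

/-- The desingularized equation near a blow-up point, in the variable `y`: here `H` is a power of
the solution and `V₁, V₂, V₃, V₄` are its normalized derivatives. -/
structure IsNormalizedAt (a : ℝ) (H V₁ V₂ V₃ V₄ : ℝ → ℝ) (y : ℝ) : Prop where
  posH : 0 < H y
  posV : 0 < V₁ y
  hH : HasDerivAt H (V₁ y) y
  hV₁ : HasDerivAt V₁ (-(a + 1) * (V₂ y - V₁ y * V₁ y) / H y) y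
  hV₂ : HasDerivAt V₂ (-(a + 2) * (V₃ y - V₁ y * V₂ y) / H y) y
  hV₃ : HasDerivAt V₃ (-(a + 3) * (V₄ y - V₁ y * V₃ y) / H y) y

/-- The quadratic form is the normalized `2 f' f''' - f''²`, whose derivative `2 f' f''''` involves
no other derivative products. Here the `V₂ V₃` terms cancel and the equation closes up, with `V₄` as
forcing. -/
lemma IsNormalizedAt.hasDerivAt_quadratic {a y : ℝ} {H V₁ V₂ V₃ V₄ : ℝ → ℝ}
    (hy : IsNormalizedAt a H V₁ V₂ V₃ V₄ y) :
    HasDerivAt (fun y => 2 * (a + 2) * (V₁ y * V₃ y) - (a + 1) * (V₂ y * V₂ y))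
      (-(2 * (a + 2) * V₁ y * ((a + 3) * V₄ y -
        (2 * (a + 2) * (V₁ y * V₃ y) - (a + 1) * (V₂ y * V₂ y)))) / H y) y := by
  have hne := hy.posH.ne'
  refine (((hy.hV₁.mul hy.hV₃).const_mul _).sub ((hy.hV₂.mul hy.hV₂).const_mul _)).congr_deriv ?_
  field_simp
  ring

/-- In the time `-log H`, `Q` relaxes to `(a + 3) V₄` at rate `2(a + 2)`, and `V₄ → 1`. The squared
distance to `a + 3` is a Lyapunov function, and no bound on the `Vᵢ` is needed. -/
lemma tendsto_quadratic {a c : ℝ} (ha : 0 < a) {H V₁ V₂ V₃ V₄ : ℝ → ℝ}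
    (h : ∀ᶠ y in 𝓝[>] c, IsNormalizedAt a H V₁ V₂ V₃ V₄ y) (hH : Tendsto H (𝓝[>] c) (𝓝 0))
    (hV₄ : Tendsto V₄ (𝓝[>] c) (𝓝 1)) :
    Tendsto (fun y => 2 * (a + 2) * (V₁ y * V₃ y) - (a + 1) * (V₂ y * V₂ y)) (𝓝[>] c)
      (𝓝 (a + 3)) := by
  set Q : ℝ → ℝ := fun y => 2 * (a + 2) * (V₁ y * V₃ y) - (a + 1) * (V₂ y * V₂ y) with hQ
  have hd : ∀ᶠ y in 𝓝[>] c, HasDerivAt Q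
      (-(2 * (a + 2) * V₁ y * ((a + 3) * V₄ y - Q y)) / H y) y :=
    h.mono fun y hy => hy.hasDerivAt_quadratic
  have hle := eventually_le_of_dissipative (Λ := fun y => (Q y - (a + 3)) ^ 2)
    (show 0 < 2 * (a + 2) by positivity) (h.mono fun y hy => ⟨hy.posH, hy.hH⟩) hH
    (hd.mono fun y hy => (hy.sub_const (a + 3)).pow 2) ?_
  · rw [Metric.tendsto_nhds]
    intro ε hε
    filter_upwards [hle (ε ^ 2 / 2) (by positivity)] with y hy
    rw [Real.dist_eq]
    exact abs_lt_of_sq_lt_sq (by nlinarith [pow_pos hε 2]) hε.le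
  · intro ε hε
    have h1 : Tendsto (fun y => 2 * (a + 2) * (a + 3) ^ 2 * (V₄ y - 1) ^ 2) (𝓝[>] c) (𝓝 0) := by
      have := ((hV₄.sub_const 1).pow 2).const_mul (2 * (a + 2) * (a + 3) ^ 2)
      simpa using this
    filter_upwards [h, h1.eventually (gt_mem_nhds hε)] with y hy h2
    have hne := hy.posH.ne'
    have hV := hy.posV
    have e : -(H y * (((2 : ℕ) : ℝ) * (Q y - (a + 3)) ^ (2 - 1) *
        (-(2 * (a + 2) * V₁ y * ((a + 3) * V₄ y - Q y)) / H y))) =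
        V₁ y * (4 * (a + 2) * (Q y - (a + 3)) * ((a + 3) * V₄ y - Q y)) := by
      field_simp; norm_num; ring
    rw [e]
    refine mul_le_mul_of_nonneg_left ?_ hV.le
    nlinarith [mul_nonneg (show 0 ≤ 2 * (a + 2) by positivity)
      (sq_nonneg ((Q y - (a + 3)) - (a + 3) * (V₄ y - 1)))]

/-- Once `Q` is known to converge, `V₃` can be eliminated, and `(V₁, V₂)` solves an asymptotically
autonomous planar system with a coercive Lyapunov function. -/
lemma tendsto_normalized {a c : ℝ} (ha : 0 < a) {H V₁ V₂ V₃ V₄ : ℝ → ℝ}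
    (h : ∀ᶠ y in 𝓝[>] c, IsNormalizedAt a H V₁ V₂ V₃ V₄ y) (hH : Tendsto H (𝓝[>] c) (𝓝 0))
    (hV₄ : Tendsto V₄ (𝓝[>] c) (𝓝 1)) :
    Tendsto V₁ (𝓝[>] c) (𝓝 1) ∧ Tendsto V₂ (𝓝[>] c) (𝓝 1) ∧ Tendsto V₃ (𝓝[>] c) (𝓝 1) := by
  have hQ := tendsto_quadratic ha h hH hV₄
  set Q : ℝ → ℝ := fun y => 2 * (a + 2) * (V₁ y * V₃ y) - (a + 1) * (V₂ y * V₂ y) with hQdef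
  have hQd : ∀ᶠ y in 𝓝[>] c, HasDerivAt Q
      (-(2 * (a + 2) * V₁ y * ((a + 3) * V₄ y - Q y)) / H y) y :=
    h.mono fun y hy => hy.hasDerivAt_quadratic
  -- In `n` and `Z`, up to the common time change, `n' = (a+1)/2 (Z - n³)` and `Z' = n² (Q n⁻⁵ -
  -- (a+3) Z) / 2`. For `Q = a + 3` the cross terms cancel in the derivative of a quadratic in `Z -
  -- 1` plus a potential in `n`.
  set n : ℝ → ℝ := fun y => √(V₁ y) with hn
  set Z : ℝ → ℝ := fun y => V₂ y / n y with hZ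
  have hnpos : ∀ᶠ y in 𝓝[>] c, 0 < n y := h.mono fun y hy => Real.sqrt_pos.2 hy.posV
  have hn2 : ∀ᶠ y in 𝓝[>] c, n y ^ 2 = V₁ y := h.mono fun y hy => Real.sq_sqrt hy.posV.le
  have hnd : ∀ᶠ y in 𝓝[>] c, HasDerivAt n (-((a + 1) / 2) * (Z y - n y ^ 3) / H y) y := by
    filter_upwards [h, hnpos, hn2] with y hy h1 h2
    have hne := hy.posH.ne'
    refine (hy.hV₁.sqrt hy.posV.ne').congr_deriv ?_
    change _ / (2 * n y) = _
    simp only [hZ]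
    rw [← h2]
    field_simp
  have hZd : ∀ᶠ y in 𝓝[>] c, HasDerivAt Z
      (-(n y ^ 2) * (1 / 2 * Q y * (1 / n y ^ 5) - (a + 3) / 2 * Z y) / H y) y := by
    filter_upwards [h, hnpos, hn2, hnd] with y hy h1 h2 h3
    have hne := hy.posH.ne'
    refine (hy.hV₂.div h3 h1.ne').congr_deriv ?_
    simp only [hZ, hQdef]
    rw [← h2]
    field_simp
    ring
  set W : ℝ → ℝ := fun y => n y ^ 3 + 3 / 2 * (1 / n y ^ 2) - 5 / 2 with hW
  -- The last term of `Λ` cancels the term `(Z - 1)(Q - (a + 3)) n⁻³` produced by the error in `Q`,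
  -- which could not be absorbed for small `n`.
  set Λ : ℝ → ℝ := fun y => 1 / 2 * (3 * (a + 1) / 2) * (Z y - 1) ^ 2 + (a + 3) / 2 * W y +
    3 / 4 * (Q y - (a + 3)) * (1 / n y ^ 2) with hΛ
  have hΛd : ∀ᶠ y in 𝓝[>] c, HasDerivAt Λ (-(n y ^ 2) * (
      -(3 * (a + 1) / 2 * ((a + 3) / 2) * ((Z y - 1) ^ 2 + (n y ^ 3 - 1) * (1 - 1 / n y ^ 5))) +
      1 / 2 * (3 * (a + 1) / 2) * (Q y - (a + 3)) * (1 / n y ^ 5 * (n y ^ 3 - 1)) +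
      3 / 2 * (a + 2) * (1 / n y ^ 2) * ((a + 3) * V₄ y - Q y)) / H y) y := by
    filter_upwards [h, hnpos, hn2, hnd, hZd, hQd] with y hy h1 h2 h3 h4 h5
    have hne := hy.posH.ne'
    have d2 : HasDerivAt (fun y => 1 / n y ^ 2)
        (-2 / n y ^ 3 * (-((a + 1) / 2) * (Z y - n y ^ 3) / H y)) y := by
      refine ((hasDerivAt_const y (1:ℝ)).div (h3.pow 2) (pow_pos h1 2).ne').congr_deriv ?_
      simp only [Pi.pow_apply]
      field_simp
      ring
    refine ((((h4.sub_const 1).pow 2).const_mul _).add ((((h3.pow 3).add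
      (d2.const_mul (3 / 2))).sub_const (5 / 2)).const_mul _)).add
      (((h5.sub_const (a + 3)).const_mul (3 / 4)).mul d2) |>.congr_deriv ?_
    rw [← h2]
    field_simp
    ring
  have hδ : Tendsto (fun y => |Q y - (a + 3)|) (𝓝[>] c) (𝓝 0) := by
    have := (hQ.sub_const (a + 3)).abs
    simpa using this
  have hη : Tendsto (fun y => |(a + 3) * V₄ y - Q y|) (𝓝[>] c) (𝓝 0) := by
    have := ((hV₄.const_mul (a + 3)).sub hQ).abs
    simpa using this
  have hle := eventually_le_of_dissipative (Λ := Λ) one_pos (h.mono fun y hy => ⟨hy.posH, hy.hH⟩)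
    hH hΛd (fun ε hε => by
      have l1 := ((hδ.const_mul (3 * (a + 1) / 2)).add (hη.const_mul (3 / 2 * (a + 2)))).add
        (hδ.const_mul (3 / 4))
      have l2 := ((hδ.const_mul (12 * (a + 1))).add (hη.const_mul (3 * (a + 2)))).add
        (hδ.const_mul (3 / 2))
      simp only [mul_zero, add_zero] at l1 l2
      filter_upwards [h, hnpos, hn2, l1.eventually (gt_mem_nhds (show 0 < (a + 3) / 4 by positivity)),
        l2.eventually (gt_mem_nhds hε)] with y hy h1 h2 h3 h4
      have hne := hy.posH.ne'
      rw [← h2, mul_div_cancel₀ _ hne, neg_mul, neg_neg, one_mul]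
      exact mul_le_mul_of_nonneg_left (dissipation_le ha h1 h3.le h4.le) (by positivity))
  have hWnn : ∀ᶠ y in 𝓝[>] c, 2 * (n y - 1) ^ 2 ≤ W y := hnpos.mono fun y hy => potential_ge hy
  have hsmall : ∀ ε > 0, ∀ᶠ y in 𝓝[>] c, (Z y - 1) ^ 2 ≤ ε ∧ (n y - 1) ^ 2 ≤ ε := by
    intro ε hε
    filter_upwards [hnpos, hWnn, hle (ε / 8) (by positivity),
      hδ.eventually (gt_mem_nhds (show 0 < min (ε / 12) 1 by positivity))] with y h1 h2 h3 h4
    have h5 := one_div_sq_le h1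
    have h6 : 0 ≤ 1 / n y ^ 2 := by positivity
    have h7 : 0 ≤ W y := (by positivity : (0:ℝ) ≤ 2 * (n y - 1) ^ 2).trans h2
    have h8 : |Q y - (a + 3)| ≤ ε / 12 := h4.le.trans (min_le_left _ _)
    have h9 : |Q y - (a + 3)| ≤ 1 := h4.le.trans (min_le_right _ _)
    have h10 : -((Q y - (a + 3)) * (1 / n y ^ 2)) ≤ |Q y - (a + 3)| * (W y + 2) := by
      rw [← neg_mul]
      exact (mul_le_mul_of_nonneg_right (neg_le_abs _) h6).trans
        (mul_le_mul_of_nonneg_left h5 (abs_nonneg _))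
    have h11 := mul_le_mul_of_nonneg_right h9 h7
    have h12 : 0 ≤ a * (Z y - 1) ^ 2 := by positivity
    have h13 : 0 ≤ a * W y := by positivity
    have h14 : Λ y = 1 / 2 * (3 * (a + 1) / 2) * (Z y - 1) ^ 2 + (a + 3) / 2 * W y +
      3 / 4 * ((Q y - (a + 3)) * (1 / n y ^ 2)) := by simp only [hΛ]; ring
    constructor <;> nlinarith [sq_nonneg (Z y - 1), sq_nonneg (n y - 1)]
  have hsq : ∀ {g : ℝ → ℝ}, (∀ ε > 0, ∀ᶠ y in 𝓝[>] c, (g y - 1) ^ 2 ≤ ε) →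
      Tendsto g (𝓝[>] c) (𝓝 1) := by
    intro g hg
    rw [Metric.tendsto_nhds]
    intro ε hε
    filter_upwards [hg (ε ^ 2 / 2) (by positivity)] with y hy
    rw [Real.dist_eq]
    exact abs_lt_of_sq_lt_sq (by nlinarith [pow_pos hε 2]) hε.le
  have tZ := hsq fun ε hε => (hsmall ε hε).mono fun y hy => hy.1
  have tn := hsq fun ε hε => (hsmall ε hε).mono fun y hy => hy.2
  have t1 : Tendsto V₁ (𝓝[>] c) (𝓝 1) := by
    have := tn.pow 2
    rw [one_pow] at this
    exact this.congr' hn2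
  have t2 : Tendsto V₂ (𝓝[>] c) (𝓝 1) := by
    have := tZ.mul tn
    rw [one_mul] at this
    refine this.congr' ?_
    filter_upwards [hnpos] with y hy
    exact div_mul_cancel₀ _ hy.ne'
  refine ⟨t1, t2, ?_⟩
  -- `V₃` is solved for from the quadratic form.
  have t3 := (hQ.add ((t2.mul t2).const_mul (a + 1))).div (t1.const_mul (2 * (a + 2)))
    (by positivity)
  rw [show (a + 3 + (a + 1) * (1 * 1)) / (2 * (a + 2) * 1) = 1 by field_simp; ring] at t3
  refine t3.congr' ?_
  filter_upwards [h] with y hy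
  have := hy.posV.ne'
  simp only [hQdef, Pi.div_apply]
  field_simp
  ring

/-! ### Blow-up solutions and the stable set of the profile -/

lemma fallingCoef_ne_zero {a : ℝ} (ha : 0 < a) : ∀ k, fallingCoef a k ≠ 0
  | 0 => one_ne_zero
  | k + 1 => mul_ne_zero (fallingCoef_ne_zero ha k) (by
      have : (0:ℝ) ≤ k := Nat.cast_nonneg k
      linarith)

lemma iteratedDeriv_blowUpProfile_ne_zero {p y₀ y : ℝ} (hp : 1 < p) (hy : y₀ < y) (k : ℕ) :
    iteratedDeriv k (blowUpProfile p y₀) y ≠ 0 := by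
  rw [(iteratedDeriv_blowUpProfile k).2 k le_rfl y hy]
  exact mul_ne_zero (mul_ne_zero (blowUpAmp_pos hp).ne' (fallingCoef_ne_zero (four_div_pos hp) k))
    (Real.rpow_pos_of_pos (sub_pos.2 hy) _).ne'

/-- Reduces closeness to the profile to `H ~ y - y₀` and `V → 1`. It serves both arbitrary blow-up
solutions and trajectories of the desingularized system. -/
lemma isEquivalent_iteratedDeriv_blowUpProfile {p y₀ : ℝ} (hp : 1 < p) {H V F : ℝ → ℝ} {k : ℕ}
    (hH : ∀ᶠ y in 𝓝[>] y₀, 0 < H y) (hH1 : Tendsto (fun y => H y / (y - y₀)) (𝓝[>] y₀) (𝓝 1))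
    (hV : Tendsto V (𝓝[>] y₀) (𝓝 1))
    (hF : ∀ᶠ y in 𝓝[>] y₀, F y =
      blowUpAmp p * fallingCoef (4 / (p - 1)) k * H y ^ (-(4 / (p - 1)) - k) * V y) :
    F ~[𝓝[>] y₀] iteratedDeriv k (blowUpProfile p y₀) := by
  have hmem : ∀ᶠ y in 𝓝[>] y₀, y₀ < y := self_mem_nhdsWithin
  rw [isEquivalent_iff_tendsto_one
    (hmem.mono fun y hy => iteratedDeriv_blowUpProfile_ne_zero hp hy k)]
  have h1 := (hH1.rpow_const (p := -(4 / (p - 1)) - k) (Or.inl one_ne_zero)).mul hV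
  rw [Real.one_rpow, one_mul] at h1
  refine h1.congr' ?_
  filter_upwards [hmem, hH, hF] with y hy h2 h3
  have hr := sub_pos.2 hy
  rw [Pi.div_apply, h3, (iteratedDeriv_blowUpProfile k).2 k le_rfl y hy, Real.div_rpow h2.le hr.le]
  have e1 := (Real.rpow_pos_of_pos hr (-(4 / (p - 1)) - k)).ne'
  have e2 := (blowUpAmp_pos hp).ne'
  have e3 := fallingCoef_ne_zero (four_div_pos hp) k
  field_simp

lemma tendsto_div_sub_of_hasDerivAt {H h : ℝ → ℝ} {c : ℝ}
    (hH : ∀ᶠ y in 𝓝[>] c, HasDerivAt H (h y) y) (hH0 : Tendsto H (𝓝[>] c) (𝓝 0))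
    (hh : Tendsto h (𝓝[>] c) (𝓝 1)) : Tendsto (fun y => H y / (y - c)) (𝓝[>] c) (𝓝 1) := by
  refine HasDerivAt.lhopital_zero_nhdsGT (g' := fun _ => 1) hH
    (Eventually.of_forall fun y => (hasDerivAt_id y).sub_const c)
    (Eventually.of_forall fun _ => one_ne_zero) hH0 ?_ (by simpa using hh)
  have : Tendsto (fun y : ℝ => y - c) (𝓝 c) (𝓝 (c - c)) := tendsto_id.sub_const c
  rw [sub_self] at this
  exact this.mono_left nhdsWithin_le_nhds

/-- A positive blow-up solution is asymptotic to the profile, together with its derivatives. -/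
lemma IsBlowUpSolution.isEquivalent {p y₀ b : ℝ} (hp : 1 < p) {f : ℝ → ℝ} (hb : y₀ < b)
    (h : IsBlowUpSolution p y₀ b f) (hf : Tendsto f (𝓝[>] y₀) atTop) {i : ℕ} (hi : i < 4) :
    iteratedDeriv i f ~[𝓝[>] y₀] iteratedDeriv i (blowUpProfile p y₀) := by
  obtain ⟨hode, -, h4⟩ := h
  have ha := four_div_pos hp
  have hA := blowUpAmp_pos hp
  have hp1 : p - 1 ≠ 0 := by linarith
  have hap : 4 / (p - 1) * (p - 1) = 4 := div_mul_cancel₀ _ hp1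
  set a := 4 / (p - 1) with hadef
  set A := blowUpAmp p with hAdef
  have hmem : ∀ᶠ y in 𝓝[>] y₀, y ∈ Ioo y₀ b := Ioo_mem_nhdsGT hb
  have hD : ∀ k < 4, ∀ᶠ y in 𝓝[>] y₀,
      HasDerivAt (iteratedDeriv k f) (iteratedDeriv (k + 1) f y) y := fun k hk =>
    hmem.mono fun y hy => hasDerivAt_iteratedDeriv isOpen_Ioo hode.1 hk hy
  have hfpos : ∀ᶠ y in 𝓝[>] y₀, 0 < f y := hf.eventually (eventually_gt_atTop 0)
  have hpow : ∀ᶠ y in 𝓝[>] y₀, 0 < |f y| ^ (p - 1) * f y := hfpos.mono fun y hy =>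
    mul_pos (Real.rpow_pos_of_pos (abs_pos.2 hy.ne') _) hy
  have h4pos := h4.eventually_pos hpow
  have hf0 : Tendsto (iteratedDeriv 0 f) (𝓝[>] y₀) atTop := by rwa [iteratedDeriv_zero]
  obtain ⟨hs1, hs2, hs3⟩ := alternating_of_blowUp (hD 0 (by norm_num)) (hD 1 (by norm_num))
    (hD 2 (by norm_num)) (hD 3 (by norm_num)) h4pos hf0
  -- `H y` is the distance from its singularity at which the profile takes the value `f y`.
  set H : ℝ → ℝ := fun y => (f y / A) ^ (-(1 / a)) with hHdef
  have hHpos : ∀ᶠ y in 𝓝[>] y₀, 0 < H y := hfpos.mono fun y hy =>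
    Real.rpow_pos_of_pos (div_pos hy hA) _
  have hH0 : Tendsto H (𝓝[>] y₀) (𝓝 0) :=
    (tendsto_rpow_neg_atTop (one_div_pos.2 ha)).comp (hf.atTop_div_const hA)
  have hHa : ∀ᶠ y in 𝓝[>] y₀, H y ^ (-a) = f y / A := by
    filter_upwards [hfpos] with y hy
    rw [hHdef, ← Real.rpow_mul (div_pos hy hA).le]
    rw [show -(1 / a) * -a = 1 by field_simp, Real.rpow_one]
  set V₁ : ℝ → ℝ := fun y => -(iteratedDeriv 1 f y) * H y / (a * iteratedDeriv 0 f y) with hV₁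
  set V₂ : ℝ → ℝ := fun y =>
    iteratedDeriv 2 f y * H y ^ 2 / (a * (a + 1) * iteratedDeriv 0 f y) with hV₂
  set V₃ : ℝ → ℝ := fun y =>
    -(iteratedDeriv 3 f y) * H y ^ 3 / (a * (a + 1) * (a + 2) * iteratedDeriv 0 f y) with hV₃
  set V₄ : ℝ → ℝ := fun y =>
    iteratedDeriv 4 f y * H y ^ 4 / (a * (a + 1) * (a + 2) * (a + 3) * iteratedDeriv 0 f y) with hV₄
  have hHd : ∀ᶠ y in 𝓝[>] y₀, HasDerivAt H (V₁ y) y := by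
    filter_upwards [hfpos, hD 0 (by norm_num)] with y hy h1
    rw [iteratedDeriv_zero] at h1
    refine ((h1.div_const A).rpow_const (Or.inl (div_pos hy hA).ne')).congr_deriv ?_
    rw [Real.rpow_sub_one (div_pos hy hA).ne']
    change _ * (H y / _) = _
    simp only [hV₁, iteratedDeriv_zero]
    field_simp
  have hN : ∀ᶠ y in 𝓝[>] y₀, IsNormalizedAt a H V₁ V₂ V₃ V₄ y := by
    filter_upwards [hfpos, hHpos, hHd, hs1, hD 0 (by norm_num), hD 1 (by norm_num),
      hD 2 (by norm_num), hD 3 (by norm_num)] with y hy hH hHd s1 d0 d1 d2 d3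
    have hy' : 0 < iteratedDeriv 0 f y := by rwa [iteratedDeriv_zero]
    have hne := hy'.ne'
    have hHne := hH.ne'
    refine ⟨hH, div_pos (mul_pos (neg_pos.2 s1) hH) (mul_pos ha hy'), hHd, ?_, ?_, ?_⟩
    · refine ((d1.neg.mul hHd).div (d0.const_mul a) (by positivity)).congr_deriv ?_
      simp only [hV₁, hV₂, Pi.mul_apply, Pi.neg_apply]
      field_simp
      ring
    · refine ((d2.mul (hHd.pow 2)).div (d0.const_mul (a * (a + 1))) (by positivity)).congr_deriv ?_
      simp only [hV₁, hV₂, hV₃, Pi.mul_apply, Pi.pow_apply]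
      field_simp
      ring
    · refine ((d3.neg.mul (hHd.pow 3)).div (d0.const_mul (a * (a + 1) * (a + 2)))
        (by positivity)).congr_deriv ?_
      simp only [hV₁, hV₃, hV₄, Pi.mul_apply, Pi.neg_apply, Pi.pow_apply]
      field_simp
      ring
  have hV₄1 : Tendsto V₄ (𝓝[>] y₀) (𝓝 1) := by
    have h5 := (isEquivalent_iff_tendsto_one (hpow.mono fun y hy => hy.ne')).1 h4
    refine h5.congr' ?_
    filter_upwards [hfpos] with y hy
    have hq := div_pos hy hA
    have e : H y ^ 4 = eulerPhi (-a) / f y ^ (p - 1) := by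
      rw [hHdef, ← Real.rpow_natCast, ← Real.rpow_mul hq.le,
        show -(1 / a) * ((4 : ℕ) : ℝ) = -(p - 1) by
          field_simp; push_cast; linarith, Real.rpow_neg hq.le, Real.div_rpow hy.le hA.le,
        blowUpAmp_rpow hp, inv_div]
    simp only [Pi.div_apply, hV₄]
    rw [e, abs_of_pos hy, iteratedDeriv_zero, eulerPhi_neg]
    have := (Real.rpow_pos_of_pos hy (p - 1)).ne'
    field_simp
  obtain ⟨t1, t2, t3⟩ := tendsto_normalized ha hN hH0 hV₄1
  have hH1 := tendsto_div_sub_of_hasDerivAt hHd hH0 t1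
  have hcoef : ∀ k : ℕ, ∀ᶠ y in 𝓝[>] y₀, H y ^ (-a - k) = f y / A / H y ^ k := by
    intro k
    filter_upwards [hHpos, hHa] with y h1 h2
    rw [Real.rpow_sub h1, h2, Real.rpow_natCast]
  interval_cases i
  · refine isEquivalent_iteratedDeriv_blowUpProfile hp hHpos hH1 tendsto_const_nhds ?_
    filter_upwards [hcoef 0] with y h1
    rw [← hadef, ← hAdef, h1, iteratedDeriv_zero]
    simp only [fallingCoef]
    field_simp
  · refine isEquivalent_iteratedDeriv_blowUpProfile hp hHpos hH1 t1 ?_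
    filter_upwards [hcoef 1, hHpos, hfpos] with y h1 h2 h3
    rw [← hadef, ← hAdef, h1]
    simp only [fallingCoef, hV₁, iteratedDeriv_zero]
    field_simp
    push_cast
    ring
  · refine isEquivalent_iteratedDeriv_blowUpProfile hp hHpos hH1 t2 ?_
    filter_upwards [hcoef 2, hHpos, hfpos] with y h1 h2 h3
    rw [← hadef, ← hAdef, h1]
    simp only [fallingCoef, hV₂, iteratedDeriv_zero]
    field_simp
    push_cast
    ring
  · refine isEquivalent_iteratedDeriv_blowUpProfile hp hHpos hH1 t3 ?_
    filter_upwards [hcoef 3, hHpos, hfpos] with y h1 h2 h3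
    rw [← hadef, ← hAdef, h1]
    simp only [fallingCoef, hV₃, iteratedDeriv_zero]
    field_simp
    push_cast
    ring

/-- A solution asymptotic to the profile is a blow-up solution. -/
lemma isBlowUpSolution_of_isEquivalent {p y₀ b : ℝ} (hp : 1 < p) {f : ℝ → ℝ} (hb : y₀ < b)
    (hode : SolvesSimilarityODE p y₀ b f)
    (h : ∀ i : Fin 4, iteratedDeriv i f ~[𝓝[>] y₀] iteratedDeriv i (blowUpProfile p y₀)) :
    IsBlowUpSolution p y₀ b f := by
  have ha := four_div_pos hp
  have hA := blowUpAmp_pos hp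
  have hmem : ∀ᶠ y in 𝓝[>] y₀, y ∈ Ioo y₀ b := Ioo_mem_nhdsGT hb
  have hsub : Tendsto (fun y => y - y₀) (𝓝[>] y₀) (𝓝[>] 0) := by
    refine tendsto_nhdsWithin_iff.2 ⟨?_, hmem.mono fun y hy => sub_pos.2 hy.1⟩
    have : Tendsto (fun y : ℝ => y - y₀) (𝓝 y₀) (𝓝 (y₀ - y₀)) := tendsto_id.sub_const y₀
    rw [sub_self] at this
    exact this.mono_left nhdsWithin_le_nhds
  have hprof : Tendsto (blowUpProfile p y₀) (𝓝[>] y₀) atTop :=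
    ((tendsto_rpow_neg_nhdsGT_zero (neg_lt_zero.2 ha)).comp hsub).const_mul_atTop hA
  have h0 : f ~[𝓝[>] y₀] blowUpProfile p y₀ := by simpa using h 0
  have hf := h0.symm.tendsto_atTop hprof
  have hfpos : ∀ᶠ y in 𝓝[>] y₀, 0 < f y := hf.eventually (eventually_gt_atTop 0)
  refine ⟨hode, tendsto_abs_atTop_atTop.comp hf, ?_⟩
  -- the nonlinearity is asymptotic to the fourth derivative of the profile
  have hN : (fun y => |f y| ^ (p - 1) * f y) ~[𝓝[>] y₀]
      iteratedDeriv 4 (blowUpProfile p y₀) := by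
    rw [isEquivalent_iff_tendsto_one
      (hmem.mono fun y hy => iteratedDeriv_blowUpProfile_ne_zero hp hy.1 4)]
    have h1 := (isEquivalent_iff_tendsto_one
      (hmem.mono fun y hy => (blowUpProfile_pos hp hy.1).ne')).1 h0
    have h2 := (h1.rpow_const (p := p - 1) (Or.inl one_ne_zero)).mul h1
    rw [Real.one_rpow, one_mul] at h2
    refine h2.congr' ?_
    filter_upwards [hmem, hfpos] with y hy h3
    have h4 := blowUpProfile_pos hp hy.1
    rw [Pi.div_apply, Pi.div_apply, blowUpProfile_ode hp hy.1, abs_of_pos h3, abs_of_pos h4,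
      Real.div_rpow h3.le h4.le]
    have := (Real.rpow_pos_of_pos h4 (p - 1)).ne'
    field_simp
  -- Lower derivatives are negligible against `(y - y₀) ^ (-a - 4)`, so the linear terms of the
  -- equation do not affect the leading behaviour of `f''''`.
  have hsmall : ∀ k < 4, iteratedDeriv k f ~[𝓝[>] y₀] iteratedDeriv k (blowUpProfile p y₀) →
      iteratedDeriv k f =o[𝓝[>] y₀] iteratedDeriv 4 (blowUpProfile p y₀) := by
    intro k hk hkf
    refine hkf.isBigO.trans_isLittleO ?_
    have h1 : (fun y => (y - y₀) ^ (-(4 / (p - 1)) - (k : ℝ))) =o[𝓝[>] y₀]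
        fun y => (y - y₀) ^ (-(4 / (p - 1)) - ((4 : ℕ) : ℝ)) :=
      isLittleO_sub_rpow (by
        have : (k : ℝ) < ((4 : ℕ) : ℝ) := Nat.cast_lt.2 hk
        exact sub_lt_sub_left this _)
    have h2 := (h1.const_mul_left (blowUpAmp p * fallingCoef (4 / (p - 1)) k)).const_mul_right
      (c := blowUpAmp p * fallingCoef (4 / (p - 1)) 4)
      (mul_ne_zero hA.ne' (fallingCoef_ne_zero ha 4))
    refine h2.congr' ?_ ?_
    · filter_upwards [hmem] with y hy
      rw [(iteratedDeriv_blowUpProfile k).2 k le_rfl y hy.1]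
    · filter_upwards [hmem] with y hy
      rw [(iteratedDeriv_blowUpProfile 4).2 4 le_rfl y hy.1]
  have hy1 : (fun y : ℝ => 1 / 4 * y) =O[𝓝[>] y₀] fun _ => (1 : ℝ) := by
    have : Tendsto (fun y : ℝ => 1 / 4 * y) (𝓝 y₀) (𝓝 (1 / 4 * y₀)) := tendsto_id.const_mul _
    exact (this.mono_left nhdsWithin_le_nhds).isBigO_one ℝ
  have hs1 := hy1.mul_isLittleO (hsmall 1 (by norm_num) (h 1))
  have hs0 := (hsmall 0 (by norm_num) (h 0)).const_mul_left (1 / (p - 1))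
  simp only [one_mul] at hs1
  refine IsEquivalent.trans (((hN.sub_isLittleO hs1).sub_isLittleO hs0).congr_left ?_) hN.symm
  filter_upwards [hmem] with y hy
  have := hode.2 y hy
  simp only [Pi.sub_apply, iteratedDeriv_zero, iteratedDeriv_one]
  linarith

lemma SolvesSimilarityODE.neg {p a b : ℝ} {f : ℝ → ℝ} (h : SolvesSimilarityODE p a b f) :
    SolvesSimilarityODE p a b (-f) := by
  refine ⟨h.1.neg, fun y hy => ?_⟩
  have h1 := h.2 y hy
  have h2 : deriv (-f) y = -deriv f y := deriv.neg
  rw [iteratedDeriv_neg, h2, Pi.neg_apply, abs_neg]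
  linarith

lemma IsBlowUpSolution.neg {p y₀ b : ℝ} {f : ℝ → ℝ} (h : IsBlowUpSolution p y₀ b f) :
    IsBlowUpSolution p y₀ b (-f) := by
  refine ⟨h.1.neg, ?_, ?_⟩
  · simpa using h.2.1
  · have e : iteratedDeriv 4 (-f) = fun y => -iteratedDeriv 4 f y := by
      ext y; exact iteratedDeriv_neg 4 f y
    rw [e]
    simpa using h.2.2.neg

lemma cauchyData_neg (f : ℝ → ℝ) (y : ℝ) : cauchyData (-f) y = -cauchyData f y := by
  ext i; exact iteratedDeriv_neg i f y

lemma tendsto_atTop_or_atBot_of_abs {f : ℝ → ℝ} {c d : ℝ} (hcd : c < d)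
    (hf : ContinuousOn f (Ioo c d)) (h : Tendsto (fun y => |f y|) (𝓝[>] c) atTop) :
    Tendsto f (𝓝[>] c) atTop ∨ Tendsto f (𝓝[>] c) atBot := by
  obtain ⟨e, he, hs⟩ := mem_nhdsGT_iff_exists_Ioo_subset.1
    ((h.eventually (eventually_gt_atTop 0)).and (Ioo_mem_nhdsGT hcd))
  have hc : ContinuousOn f (Ioo c e) := hf.mono fun x hx => (hs hx).2
  by_cases hpos : ∃ x ∈ Ioo c e, 0 < f x
  · obtain ⟨x, hx, hfx⟩ := hpos
    left
    refine h.congr' ?_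
    filter_upwards [Ioo_mem_nhdsGT he] with y hy
    refine abs_of_nonneg (le_of_not_gt fun hneg => ?_)
    obtain ⟨z, hz, hz0⟩ := isPreconnected_Ioo.intermediate_value hy hx hc ⟨hneg.le, hfx.le⟩
    have := (hs hz).1
    simp [hz0] at this
  · push Not at hpos
    right
    refine (tendsto_neg_atTop_atBot.comp h).congr' ?_
    filter_upwards [Ioo_mem_nhdsGT he] with y hy
    simp [abs_of_nonpos (hpos y hy)]

lemma blowUpData_eq {p y₀ y₁ : ℝ} (hp : 1 < p) :
    blowUpData p y₀ y₁ = profileStableSet p y₀ y₁ ∪ {z | -z ∈ profileStableSet p y₀ y₁} := by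
  ext z
  constructor
  · rintro ⟨b, f, hy, hf, rfl⟩
    have hb := hy.1.trans hy.2
    rcases tendsto_atTop_or_atBot_of_abs hb hf.1.1.continuousOn hf.2.1 with h | h
    · exact Or.inl ⟨b, f, hy, hf.1, fun i => hf.isEquivalent hp hb h i.2, rfl⟩
    · refine Or.inr ⟨b, -f, hy, hf.neg.1, fun i => hf.neg.isEquivalent hp hb ?_ i.2,
        (cauchyData_neg f y₁).symm⟩
      exact tendsto_neg_atBot_atTop.comp h
  · rintro (⟨b, f, hy, hf, he, rfl⟩ | ⟨b, f, hy, hf, he, hz⟩)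
    · exact ⟨b, f, hy, isBlowUpSolution_of_isEquivalent hp (hy.1.trans hy.2) hf he, rfl⟩
    · refine ⟨b, -f, hy, (isBlowUpSolution_of_isEquivalent hp (hy.1.trans hy.2) hf he).neg, ?_⟩
      rw [cauchyData_neg, ← hz, neg_neg]

/-! ### From the desingularized system back to the equation -/

/-- Inverse of a strictly decreasing trajectory, with its derivative. -/
lemma exists_inverse_trajectory {y H : ℝ → ℝ} {τ : ℝ} (hH : ∀ t, -1 < t → 0 < H t)
    (hy : ∀ t, -1 < t → HasDerivAt y (-H t) t) (hτ : Tendsto y atTop (𝓝 τ)) :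
    ∃ (b : ℝ) (θ : ℝ → ℝ), y 0 ∈ Ioo τ b ∧ θ (y 0) = 0 ∧ Tendsto θ (𝓝[>] τ) atTop ∧
      ∀ x ∈ Ioo τ b, -1 < θ x ∧ y (θ x) = x ∧ HasDerivAt θ (-(H (θ x))⁻¹) x := by
  have hcont : ContinuousOn y (Ioi (-1)) := HasDerivAt.continuousOn fun t ht => hy t ht
  have hanti : StrictAntiOn y (Ioi (-1)) := by
    refine strictAntiOn_of_deriv_neg (convex_Ioi _) hcont fun t ht => ?_
    rw [interior_Ioi] at ht
    rw [(hy t ht).deriv]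
    exact neg_lt_zero.2 (hH t ht)
  have hgt : ∀ t, -1 < t → τ < y t := by
    intro t ht
    have h1 : y (t + 1) < y t := hanti ht (show -1 < t + 1 by linarith) (by linarith)
    refine lt_of_le_of_lt (le_of_tendsto hτ ?_) h1
    filter_upwards [eventually_ge_atTop (t + 1)] with s hs
    exact hanti.antitoneOn (show -1 < t + 1 by linarith) (show -1 < s by linarith) hs
  have hsurj : ∀ x ∈ Ioo τ (y (-1 / 2)), ∃ t, -1 < t ∧ y t = x := by
    intro x hx
    obtain ⟨s, hs1, hs2⟩ := ((hτ.eventually (gt_mem_nhds hx.1)).and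
      (eventually_ge_atTop (-1 / 2))).exists
    obtain ⟨t, ht, rfl⟩ := intermediate_value_Icc' hs2
      (hcont.mono fun t ht => (show -1 < t by linarith [ht.1])) ⟨hs1.le, hx.2.le⟩
    exact ⟨t, by linarith [ht.1], rfl⟩
  -- Outside the interval the inverse takes the default value `0`.
  have hex : ∀ x, ∃ t, x ∈ Ioo τ (y (-1 / 2)) → -1 < t ∧ y t = x := by
    intro x
    by_cases hx : x ∈ Ioo τ (y (-1 / 2))
    · obtain ⟨t, ht⟩ := hsurj x hx
      exact ⟨t, fun _ => ht⟩
    · exact ⟨0, fun h => absurd h hx⟩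
  choose θ hθ using hex
  have h00 : y 0 ∈ Ioo τ (y (-1 / 2)) :=
    ⟨hgt 0 (by norm_num), hanti (by norm_num : (-1 : ℝ) < -1 / 2) (by norm_num : (-1 : ℝ) < 0)
      (by norm_num)⟩
  -- Any time in `(-1, 0)` would give a right end point beyond `y 0`.
  refine ⟨y (-1 / 2), θ, h00,
    hanti.injOn (hθ _ h00).1 (by norm_num : (-1 : ℝ) < 0) (hθ _ h00).2, ?_, fun x hx => ?_⟩
  · rw [tendsto_atTop]
    intro M
    have hM : -1 < max M 0 := lt_of_lt_of_le (by norm_num) (le_max_right _ _)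
    filter_upwards [Ioo_mem_nhdsGT (hgt _ hM), Ioo_mem_nhdsGT (h00.1.trans h00.2)] with x hx hx'
    by_contra hlt
    push Not at hlt
    obtain ⟨h1, h2⟩ := hθ x hx'
    have := hanti.antitoneOn (show -1 < θ x from h1) hM (hlt.le.trans (le_max_left _ _))
    rw [h2] at this
    exact absurd hx.2 (not_lt.2 this)
  · obtain ⟨h1, h2⟩ := hθ x hx
    have hc : ContinuousAt θ x := by
      rw [Metric.continuousAt_iff']
      intro ε hε
      obtain ⟨s, hs⟩ := exists_between (max_lt h1 (sub_lt_self (θ x) hε))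
      have hs1 : -1 < s := (le_max_left _ _).trans_lt hs.1
      have hl : y (θ x + ε) < x := by
        conv_rhs => rw [← h2]
        exact hanti h1 (show -1 < θ x + ε by linarith) (by linarith)
      have hr : x < y s := by
        conv_lhs => rw [← h2]
        exact hanti hs1 h1 hs.2
      filter_upwards [Ioo_mem_nhds hl hr, Ioo_mem_nhds hx.1 hx.2] with x' hx1 hx2
      obtain ⟨k1, k2⟩ := hθ x' hx2
      rw [← k2] at hx1
      have m1 := (hanti.lt_iff_gt (show -1 < θ x + ε by linarith) k1).1 hx1.1
      have m2 := (hanti.lt_iff_gt k1 hs1).1 hx1.2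
      have m3 := (le_max_right _ _).trans_lt hs.1
      rw [Real.dist_eq, abs_lt]
      constructor <;> linarith
    refine ⟨h1, h2, ?_⟩
    rw [← inv_neg]
    refine HasDerivAt.of_local_left_inverse hc (hy _ h1) (neg_ne_zero.2 (hH _ h1).ne') ?_
    filter_upwards [Ioo_mem_nhds hx.1 hx.2] with x' hx' using (hθ x' hx').2

/-- Cauchy data in terms of the desingularizing variables `(V₁, V₂, V₃, H, y)`. -/
def toData (p : ℝ) (P : ℝ × ℝ × ℝ × ℝ × ℝ) : Fin 4 → ℝ := fun i =>
  blowUpAmp p * fallingCoef (4 / (p - 1)) i * P.2.2.2.1 ^ (-(4 / (p - 1)) - ((i : ℕ) : ℝ)) *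
    ![1, P.1, P.2.1, P.2.2.1] i

/-- `H exp(∫ V₁)` is constant, so `H` keeps its sign. -/
lemma pos_of_isDesingularized {a k : ℝ} {V₁ V₂ V₃ H y : ℝ → ℝ} (hV : Continuous V₁)
    (h : ∀ t, -1 < t → IsDesingularized a k V₁ V₂ V₃ H y t) (h0 : 0 < H 0) :
    ∀ t, -1 < t → 0 < H t := by
  have hI : ∀ t, HasDerivAt (fun t => ∫ s in (0:ℝ)..t, V₁ s) (V₁ t) t := fun t =>
    hV.integral_hasStrictDerivAt 0 t |>.hasDerivAt
  have hd : ∀ t ∈ Ioi (-1 : ℝ),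
      HasDerivAt (fun t => H t * Real.exp (∫ s in (0:ℝ)..t, V₁ s)) 0 t := fun t ht =>
    ((h t ht).hH.mul (hI t).exp).congr_deriv (by ring)
  obtain ⟨c, hc⟩ := isOpen_Ioi.exists_is_const_of_deriv_eq_zero isPreconnected_Ioi
    (fun t ht => (hd t ht).differentiableAt.differentiableWithinAt) (fun t ht => (hd t ht).deriv)
  intro t ht
  have h1 := hc 0 (by norm_num : (-1:ℝ) < 0)
  have h2 := hc t ht
  rw [← h1] at h2
  have h3 : 0 < H t * Real.exp (∫ s in (0:ℝ)..t, V₁ s) := by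
    rw [h2]; exact mul_pos h0 (Real.exp_pos _)
  exact (mul_pos_iff_of_pos_right (Real.exp_pos _)).1 h3

/-- The coupling constant of the desingularized system. -/
def couplingConst (p : ℝ) : ℝ :=
  1 / (4 * ((4 / (p - 1) + 1) * (4 / (p - 1) + 2) * (4 / (p - 1) + 3)))

/-- Inverting the trajectory `t ↦ y t` turns `H` and the `Vᵢ` into functions of position, and the
chain rule gives back the equation. Since `dH/dx = V₁ → 1`, l'Hôpital's rule gives `H ~ x - τ`. -/
lemma toData_mem_profileStableSet {p τ : ℝ} (hp : 1 < p) {V₁ V₂ V₃ H y : ℝ → ℝ}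
    (hV : Continuous V₁)
    (h : ∀ t, -1 < t → IsDesingularized (4 / (p - 1)) (couplingConst p) V₁ V₂ V₃ H y t)
    (hH0 : 0 < H 0) (h1 : Tendsto V₁ atTop (𝓝 1)) (h2 : Tendsto V₂ atTop (𝓝 1))
    (h3 : Tendsto V₃ atTop (𝓝 1)) (hH : Tendsto H atTop (𝓝 0)) (hy : Tendsto y atTop (𝓝 τ)) :
    toData p (V₁ 0, V₂ 0, V₃ 0, H 0, y 0) ∈ profileStableSet p τ (y 0) := by
  have ha := four_div_pos hp
  have hA := blowUpAmp_pos hp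
  have hp1 : p - 1 ≠ 0 := by linarith
  have hpos := pos_of_isDesingularized hV h hH0
  obtain ⟨b, θ, hb, hθ0, hθτ, hθ⟩ :=
    exists_inverse_trajectory hpos (fun t ht => (h t ht).hy) hy
  set U : ℝ → Fin 4 → ℝ := fun x =>
    toData p (V₁ (θ x), V₂ (θ x), V₃ (θ x), H (θ x), x) with hU
  have hpow : ∀ x ∈ Ioo τ b, ∀ s : ℝ,
      HasDerivAt (fun x => H (θ x) ^ s) (V₁ (θ x) * s * H (θ x) ^ (s - 1)) x := by
    intro x hx s
    obtain ⟨g1, -, g3⟩ := hθ x hx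
    have hne := (hpos _ g1).ne'
    refine ((((h _ g1).hH.comp x g3)).rpow_const (Or.inl hne)).congr_deriv ?_
    simp only [Function.comp]
    field_simp
  have hsol : IsSystemSol p (Ioo τ b) U := by
    rw [isSystemSol_iff]
    intro x hx
    obtain ⟨g1, g2, g3⟩ := hθ x hx
    have hpx := hpos _ g1
    have hne := hpx.ne'
    have D := h _ g1
    have d1 := D.hV₁.comp x g3
    have d2 := D.hV₂.comp x g3
    have d3 := D.hV₃.comp x g3
    have e : ∀ k : ℝ, H (θ x) ^ (-(4 / (p - 1)) - k) = H (θ x) ^ (-(4 / (p - 1)) - k - 1) * H (θ x) := by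
      intro k
      rw [Real.rpow_sub_one hne]; field_simp
    refine ⟨?_, ?_, ?_, ?_⟩
    · refine (((hpow x hx (-(4 / (p - 1)) - ((0 : ℕ) : ℝ))).const_mul _).mul_const 1).congr_deriv ?_
      simp [hU, toData, fallingCoef]
      ring
    · refine (((hpow x hx (-(4 / (p - 1)) - ((1 : ℕ) : ℝ))).const_mul
        (blowUpAmp p * fallingCoef (4 / (p - 1)) 1)).mul d1).congr_deriv ?_
      rw [e]
      simp [hU, toData, fallingCoef]
      rw [show -(4 / (p - 1)) - (2:ℝ) = -(4 / (p - 1)) - 1 - 1 by ring]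
      field_simp
      ring
    · refine (((hpow x hx (-(4 / (p - 1)) - ((2 : ℕ) : ℝ))).const_mul
        (blowUpAmp p * fallingCoef (4 / (p - 1)) 2)).mul d2).congr_deriv ?_
      rw [e]
      simp [hU, toData, fallingCoef]
      rw [show -(4 / (p - 1)) - (3:ℝ) = -(4 / (p - 1)) - 2 - 1 by ring]
      field_simp
      ring
    · refine (((hpow x hx (-(4 / (p - 1)) - ((3 : ℕ) : ℝ))).const_mul
        (blowUpAmp p * fallingCoef (4 / (p - 1)) 3)).mul d3).congr_deriv ?_
      have hU0 : U x 0 = blowUpAmp p * H (θ x) ^ (-(4 / (p - 1))) := by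
        simp [hU, toData, fallingCoef]
      have hU1 : U x 1 =
          -(blowUpAmp p * (4 / (p - 1)) * H (θ x) ^ (-(4 / (p - 1)) - 1) * V₁ (θ x)) := by
        simp [hU, toData, fallingCoef]
      have hU0pos : 0 < U x 0 := by rw [hU0]; exact mul_pos hA (Real.rpow_pos_of_pos hpx _)
      have hn : |U x 0| ^ (p - 1) = eulerPhi (-(4 / (p - 1))) / H (θ x) ^ 4 := by
        rw [abs_of_pos hU0pos, hU0, Real.mul_rpow hA.le (Real.rpow_nonneg hpx.le _),
          blowUpAmp_rpow hp, ← Real.rpow_mul hpx.le,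
          show -(4 / (p - 1)) * (p - 1) = -((4 : ℕ) : ℝ) by field_simp; norm_num,
          Real.rpow_neg hpx.le, Real.rpow_natCast]
        exact (div_eq_mul_inv _ _).symm
      have e0 : H (θ x) ^ (-(4 / (p - 1))) = H (θ x) ^ (-(4 / (p - 1)) - 4) * H (θ x) ^ 4 := by
        rw [← Real.rpow_natCast, ← Real.rpow_add hpx]; congr 1; push_cast; ring
      have e1 : H (θ x) ^ (-(4 / (p - 1)) - 1) =
          H (θ x) ^ (-(4 / (p - 1)) - 4) * H (θ x) ^ 3 := by
        rw [← Real.rpow_natCast, ← Real.rpow_add hpx]; congr 1; push_cast; ring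
      rw [e, hn, hU0, hU1, e0, e1]
      simp only [Function.comp, g2, couplingConst, fallingCoef, eulerPhi_neg]
      rw [show -(4 / (p - 1)) - ((3 : ℕ) : ℝ) - 1 = -(4 / (p - 1)) - 4 by push_cast; ring]
      -- Both linear terms of the equation thus carry the factor `1/4`, so one coupling constant
      -- suffices.
      rw [show 1 / (p - 1) = 1 / 4 * (4 / (p - 1)) by ring]
      set a := 4 / (p - 1)
      push_cast
      field_simp
      ring
  obtain ⟨hode, hdata⟩ := hsol.solvesSimilarityODE hp
  refine ⟨b, fun x => U x 0, hb, hode, fun i => ?_, ?_⟩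
  · have hmem : ∀ᶠ x in 𝓝[>] τ, x ∈ Ioo τ b := Ioo_mem_nhdsGT (hb.1.trans hb.2)
    have hHd : ∀ᶠ x in 𝓝[>] τ, HasDerivAt (fun x => H (θ x)) (V₁ (θ x)) x := by
      filter_upwards [hmem] with x hx
      obtain ⟨g1, -, g3⟩ := hθ x hx
      have hne := (hpos _ g1).ne'
      refine ((h _ g1).hH.comp x g3).congr_deriv ?_
      field_simp
    have hlim : Tendsto (fun x => ![1, V₁ (θ x), V₂ (θ x), V₃ (θ x)] i) (𝓝[>] τ) (𝓝 1) := by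
      fin_cases i
      · exact tendsto_const_nhds
      · exact h1.comp hθτ
      · exact h2.comp hθτ
      · exact h3.comp hθτ
    refine isEquivalent_iteratedDeriv_blowUpProfile hp
      (hmem.mono fun x hx => hpos _ (hθ x hx).1)
      (tendsto_div_sub_of_hasDerivAt hHd (hH.comp hθτ) (h1.comp hθτ)) hlim ?_
    filter_upwards [hmem] with x hx
    exact congrFun (hdata x hx) i
  · rw [hdata _ hb, hU]
    simp only [hθ0]


/-- The desingularizing variables in terms of Cauchy data at `y`. -/
def ofData (p : ℝ) (E : Fin 4 → ℝ) (y : ℝ) : ℝ × ℝ × ℝ × ℝ × ℝ :=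
  let h : ℝ := (E 0 / blowUpAmp p) ^ (-(1 / (4 / (p - 1))))
  let v : ℕ → ℝ → ℝ := fun k e =>
    e / (blowUpAmp p * fallingCoef (4 / (p - 1)) k * h ^ (-(4 / (p - 1)) - (k : ℝ)))
  (v 1 (E 1), v 2 (E 2), v 3 (E 3), h, y)

lemma toData_ofData {p : ℝ} (hp : 1 < p) {E : Fin 4 → ℝ} (hE : 0 < E 0) (y : ℝ) :
    toData p (ofData p E y) = E := by
  have ha := four_div_pos hp
  have hA := blowUpAmp_pos hp
  have hq := div_pos hE hA
  have hh := Real.rpow_pos_of_pos hq (-(1 / (4 / (p - 1))))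
  have hc : ∀ k : ℕ, blowUpAmp p * fallingCoef (4 / (p - 1)) k *
      ((E 0 / blowUpAmp p) ^ (-(1 / (4 / (p - 1))))) ^ (-(4 / (p - 1)) - (k : ℝ)) ≠ 0 := fun k =>
    mul_ne_zero (mul_ne_zero hA.ne' (fallingCoef_ne_zero ha k)) (Real.rpow_pos_of_pos hh _).ne'
  ext i
  fin_cases i
  · change blowUpAmp p * fallingCoef (4 / (p - 1)) 0 *
      ((E 0 / blowUpAmp p) ^ (-(1 / (4 / (p - 1))))) ^ (-(4 / (p - 1)) - ((0 : ℕ) : ℝ)) * 1 = E 0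
    rw [← Real.rpow_mul hq.le, show -(1 / (4 / (p - 1))) * (-(4 / (p - 1)) - ((0 : ℕ) : ℝ)) = 1 by
      rw [Nat.cast_zero, sub_zero, neg_mul_neg, one_div_mul_cancel ha.ne'], Real.rpow_one,
      fallingCoef]
    field_simp
  · exact mul_div_cancel₀ _ (hc 1)
  · exact mul_div_cancel₀ _ (hc 2)
  · exact mul_div_cancel₀ _ (hc 3)

lemma ofData_pos {p : ℝ} (hp : 1 < p) {E : Fin 4 → ℝ} (hE : 0 < E 0) (y : ℝ) :
    0 < (ofData p E y).2.2.2.1 :=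
  Real.rpow_pos_of_pos (div_pos hE (blowUpAmp_pos hp)) _

lemma contDiffAt_ofData {p : ℝ} (hp : 1 < p) {E : Fin 4 → ℝ} (hE : 0 < E 0) (y : ℝ) :
    ContDiffAt ℝ 1 (fun q : (Fin 4 → ℝ) × ℝ => ofData p q.1 q.2) (E, y) := by
  have ha := four_div_pos hp
  have hA := blowUpAmp_pos hp
  have hq := div_pos hE hA
  have hh := Real.rpow_pos_of_pos hq (-(1 / (4 / (p - 1))))
  have hc : ∀ i : Fin 4, ContDiffAt ℝ 1 (fun q : (Fin 4 → ℝ) × ℝ => q.1 i) (E, y) := fun i =>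
    ((contDiff_apply ℝ ℝ i).comp contDiff_fst).contDiffAt
  have hH : ContDiffAt ℝ 1 (fun q : (Fin 4 → ℝ) × ℝ =>
      (q.1 0 / blowUpAmp p) ^ (-(1 / (4 / (p - 1))))) (E, y) :=
    ((hc 0).div_const _).rpow_const_of_ne hq.ne'
  have hv : ∀ (k : ℕ) (i : Fin 4), ContDiffAt ℝ 1 (fun q : (Fin 4 → ℝ) × ℝ => q.1 i /
      (blowUpAmp p * fallingCoef (4 / (p - 1)) k *
        ((q.1 0 / blowUpAmp p) ^ (-(1 / (4 / (p - 1))))) ^ (-(4 / (p - 1)) - (k : ℝ)))) (E, y) :=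
    fun k i => (hc i).div (contDiffAt_const.mul (hH.rpow_const_of_ne hh.ne'))
      (mul_ne_zero (mul_ne_zero hA.ne' (fallingCoef_ne_zero ha k)) (Real.rpow_pos_of_pos hh _).ne')
  exact (hv 1 1).prodMk ((hv 2 2).prodMk ((hv 3 3).prodMk (hH.prodMk contDiff_snd.contDiffAt)))

/-- Along a solution asymptotic to the profile the desingularizing variables tend to the
equilibrium `(1, 1, 1, 0)`. -/
lemma tendsto_ofData {p y₀ : ℝ} (hp : 1 < p) {f : ℝ → ℝ}
    (h : ∀ i : Fin 4, iteratedDeriv i f ~[𝓝[>] y₀] iteratedDeriv i (blowUpProfile p y₀)) :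
    Tendsto (fun y => ofData p (cauchyData f y) y) (𝓝[>] y₀) (𝓝 (1, 1, 1, 0, y₀)) := by
  have ha := four_div_pos hp
  have hA := blowUpAmp_pos hp
  have hmem : ∀ᶠ y in 𝓝[>] y₀, y₀ < y := self_mem_nhdsWithin
  have hr : Tendsto (fun y => y - y₀) (𝓝[>] y₀) (𝓝 0) := by
    have : Tendsto (fun y : ℝ => y - y₀) (𝓝 y₀) (𝓝 (y₀ - y₀)) := tendsto_id.sub_const y₀
    rw [sub_self] at this
    exact this.mono_left nhdsWithin_le_nhds
  have hi : ∀ i : Fin 4, Tendsto (fun y => iteratedDeriv i f y /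
      iteratedDeriv i (blowUpProfile p y₀) y) (𝓝[>] y₀) (𝓝 1) := fun i =>
    (isEquivalent_iff_tendsto_one
      (hmem.mono fun y hy => iteratedDeriv_blowUpProfile_ne_zero hp hy i)).1 (h i)
  have hpos : ∀ᶠ y in 𝓝[>] y₀, 0 < cauchyData f y 0 :=
    (h 0).eventually_pos (hmem.mono fun y hy => by
      simpa using blowUpProfile_pos hp hy)
  set η : ℝ → ℝ := fun y => (cauchyData f y 0 / blowUpAmp p) ^ (-(1 / (4 / (p - 1)))) with hη
  have hηpos : ∀ᶠ y in 𝓝[>] y₀, 0 < η y := hpos.mono fun y hy =>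
    Real.rpow_pos_of_pos (div_pos hy hA) _
  have h1 : Tendsto (fun y => η y / (y - y₀)) (𝓝[>] y₀) (𝓝 1) := by
    have h2 := (hi 0).rpow_const (p := -(1 / (4 / (p - 1)))) (Or.inl one_ne_zero)
    rw [Real.one_rpow] at h2
    refine h2.congr' ?_
    filter_upwards [hmem, hpos] with y hy h3
    have hry := sub_pos.2 hy
    have hb := Real.rpow_pos_of_pos hry (-(4 / (p - 1)))
    have e : (y - y₀) = ((y - y₀) ^ (-(4 / (p - 1)))) ^ (-(1 / (4 / (p - 1)))) := by
      rw [← Real.rpow_mul hry.le, show -(4 / (p - 1)) * -(1 / (4 / (p - 1))) = 1 by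
        rw [neg_mul_neg, mul_one_div_cancel ha.ne'], Real.rpow_one]
    rw [hη]
    simp only []
    conv_rhs => rw [e]
    rw [← Real.div_rpow (div_pos h3 hA).le hb.le]
    congr 1
    simp only [cauchyData, Fin.val_zero, iteratedDeriv_zero, blowUpProfile]
    field_simp
  have hη0 : Tendsto η (𝓝[>] y₀) (𝓝 0) := by
    have := h1.mul hr
    rw [one_mul] at this
    refine this.congr' ?_
    filter_upwards [hmem] with y hy
    exact div_mul_cancel₀ _ (sub_pos.2 hy).ne'
  have hv : ∀ i : Fin 4, Tendsto (fun y => cauchyData f y i / (blowUpAmp p *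
      fallingCoef (4 / (p - 1)) i * η y ^ (-(4 / (p - 1)) - ((i : ℕ) : ℝ)))) (𝓝[>] y₀) (𝓝 1) := by
    intro i
    have h2 := (hi i).div (h1.rpow_const (p := -(4 / (p - 1)) - ((i : ℕ) : ℝ))
      (Or.inl one_ne_zero)) (by rw [Real.one_rpow]; exact one_ne_zero)
    rw [Real.one_rpow, div_one] at h2
    refine h2.congr' ?_
    filter_upwards [hmem, hηpos] with y hy h3
    have hry := sub_pos.2 hy
    rw [Pi.div_apply, (iteratedDeriv_blowUpProfile i).2 i le_rfl y hy,
      Real.div_rpow h3.le hry.le]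
    have := (Real.rpow_pos_of_pos hry (-(4 / (p - 1)) - ((i : ℕ) : ℝ))).ne'
    simp only [cauchyData]
    field_simp
  exact (hv 1).prodMk_nhds ((hv 2).prodMk_nhds ((hv 3).prodMk_nhds
    (hη0.prodMk_nhds (tendsto_id.mono_left nhdsWithin_le_nhds))))

/-! ### The blow-up point as a differentiable function of the Cauchy data -/

/-- A function giving the blow-up point in the desingularizing variables. -/
lemma exists_blowUpPoint {p : ℝ} (hp : 1 < p) (y₀ : ℝ) :
    ∃ T : ℝ × ℝ × ℝ × ℝ × ℝ → ℝ, ContDiffAt ℝ 1 T (1, 1, 1, 0, y₀) ∧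
      (∀ᶠ s in 𝓝 y₀, T (1, 1, 1, 0, s) = s) ∧ ∀ᶠ P in 𝓝 ((1, 1, 1, 0, y₀) : ℝ × ℝ × ℝ × ℝ × ℝ),
        0 < P.2.2.2.1 → toData p P ∈ profileStableSet p (T P) P.2.2.2.2 := by
  obtain ⟨T, hT, hT0, h⟩ := exists_asymptoticPhase (couplingConst p) (four_div_pos hp) y₀
  refine ⟨T, hT, hT0, h.mono ?_⟩
  rintro P ⟨V₁, V₂, V₃, H, y, hV, rfl, hD, h1, h2, h3, hH, hy⟩ hpos
  exact toData_mem_profileStableSet hp hV hD hpos h1 h2 h3 hH hy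

lemma profileStableSet_subset {p y₀ y₁ : ℝ} (hp : 1 < p) :
    profileStableSet p y₀ y₁ ⊆ blowUpData p y₀ y₁ := by
  rw [blowUpData_eq hp]
  exact subset_union_left

/-- The blow-up point is determined by the Cauchy data. -/
lemma blowUpData_unique {p y₀ y₀' y₁ : ℝ} (hp : 1 < p) {z : Fin 4 → ℝ}
    (h : z ∈ blowUpData p y₀ y₁) (h' : z ∈ blowUpData p y₀' y₁) : y₀ = y₀' := by
  obtain ⟨b, f, hy, hf, rfl⟩ := h
  obtain ⟨b', f', hy', hf', hz⟩ := h'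
  refine hf.1.isSystemSol.blowUp_unique hp hf'.1.isSystemSol hy hy' hz ?_ ?_
  · simpa [cauchyData] using hf.2.1
  · simpa [cauchyData] using hf'.2.1

/-- Used to express the partial derivative in the position coordinate. -/
lemma hasDerivAt_line_snd (P : ℝ × ℝ × ℝ × ℝ × ℝ) (s : ℝ) :
    HasDerivAt (fun s : ℝ => ((P.1, P.2.1, P.2.2.1, P.2.2.2.1, s) : ℝ × ℝ × ℝ × ℝ × ℝ))
      (0, 0, 0, 0, 1) s :=
  (hasDerivAt_const s P.1).prodMk ((hasDerivAt_const s P.2.1).prodMk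
    ((hasDerivAt_const s P.2.2.1).prodMk ((hasDerivAt_const s P.2.2.2.1).prodMk (hasDerivAt_id s))))

/-- Nonemptiness of the stable set. -/
lemma exists_mem_profileStableSet {p : ℝ} (hp : 1 < p) (y₀ : ℝ) :
    ∃ δ > 0, ∀ y₁ ∈ Ioo y₀ (y₀ + δ), (profileStableSet p y₀ y₁).Nonempty := by
  obtain ⟨T, hT, hT0, h⟩ := exists_blowUpPoint hp y₀
  have hcont : ∀ᶠ P in 𝓝 ((1, 1, 1, 0, y₀) : ℝ × ℝ × ℝ × ℝ × ℝ), ContinuousAt T P :=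
    (hT.eventually (by simp)).mono fun P hP => hP.continuousAt
  obtain ⟨ε, hε, hs⟩ := Metric.eventually_nhds_iff.1 (hcont.and h)
  obtain ⟨ε', hε', hs'⟩ := Metric.eventually_nhds_iff.1 hT0
  set r := min (ε / 2) (ε' / 2) with hr
  have hrpos : 0 < r := lt_min (by linarith) (by linarith)
  have hrε : r < ε := (min_le_left _ _).trans_lt (by linarith)
  have hrε' : r < ε' := (min_le_right _ _).trans_lt (by linarith)
  have hdist : ∀ k s : ℝ, |k| ≤ r → |s - y₀| ≤ r →
      dist ((1, 1, 1, k, s) : ℝ × ℝ × ℝ × ℝ × ℝ) (1, 1, 1, 0, y₀) < ε := by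
    intro k s hk hs
    simp only [Prod.dist_eq, dist_self, Real.dist_eq, sub_zero]
    refine max_lt hε (max_lt hε (max_lt hε (max_lt ?_ ?_))) <;> linarith
  have hlim : ∀ s : ℝ, |s - y₀| ≤ r →
      Tendsto (fun k : ℝ => T (1, 1, 1, k, s)) (𝓝[>] 0) (𝓝 s) := by
    intro s hs1
    have h1 := (hs (hdist 0 s (by simpa using hrpos.le) hs1)).1
    have h2 : T (1, 1, 1, 0, s) = s := hs' (by rw [Real.dist_eq]; linarith)
    have h3 : Continuous fun k : ℝ => ((1, 1, 1, k, s) : ℝ × ℝ × ℝ × ℝ × ℝ) := by fun_prop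
    have h4 : Tendsto (fun k : ℝ => T (1, 1, 1, k, s)) (𝓝 0) (𝓝 (T (1, 1, 1, 0, s))) :=
      ContinuousAt.comp (g := T) (x := (0:ℝ)) h1 h3.continuousAt
    rw [h2] at h4
    exact h4.mono_left nhdsWithin_le_nhds
  -- For `H = k > 0` small, `s ↦ T(1, 1, 1, k, s)` is close to the identity at both ends of `[y₀ -
  -- r, y₀ + r]`, so by continuity it takes the value `y₀`.
  obtain ⟨k, ⟨hk1, hk2⟩, hk3⟩ := (((hlim (y₀ + r) (by simp [abs_of_pos hrpos])).eventually
    (lt_mem_nhds (show y₀ < y₀ + r by linarith))).and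
    ((hlim (y₀ - r) (by simp [abs_of_pos hrpos])).eventually
      (gt_mem_nhds (show y₀ - r < y₀ by linarith)))).and (Ioo_mem_nhdsGT hrpos) |>.exists
  have hkr : |k| ≤ r := by rw [abs_of_pos hk3.1]; exact hk3.2.le
  have hin : ∀ s ∈ Icc (y₀ - r) (y₀ + r), |s - y₀| ≤ r := fun s hs => by
    rw [abs_le]; constructor <;> linarith [hs.1, hs.2]
  have hc : ContinuousOn (fun s : ℝ => T (1, 1, 1, k, s)) (Icc (y₀ - r) (y₀ + r)) := by
    intro s hs1
    have h3 : Continuous fun s : ℝ => ((1, 1, 1, k, s) : ℝ × ℝ × ℝ × ℝ × ℝ) := by fun_prop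
    exact (ContinuousAt.comp (g := T) (x := s) (hs (hdist k s hkr (hin s hs1))).1
      h3.continuousAt).continuousWithinAt
  obtain ⟨s, hs1, hs2⟩ := intermediate_value_Icc (by linarith) hc ⟨hk2.le, hk1.le⟩
  have hmem := (hs (hdist k s hkr (hin s hs1))).2 hk3.1
  simp only at hs2 hmem
  rw [hs2] at hmem
  obtain ⟨b, f, hy, hf, he, -⟩ := hmem
  -- One solution serves every `y₁` in its interval of definition.
  refine ⟨b - y₀, sub_pos.2 (hy.1.trans hy.2), fun y₁ hy₁ => ⟨cauchyData f y₁, b, f, ?_, hf, he, rfl⟩⟩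
  exact ⟨hy₁.1, by linarith [hy₁.2]⟩

/-- Continuation of a solution asymptotic to the profile. -/
lemma mem_profileStableSet_of_isSystemSol {p τ y₁ y₂ c d : ℝ} (hp : 1 < p)
    {V : ℝ → Fin 4 → ℝ} (hV : IsSystemSol p (Ioo c d) V) (h₁ : y₁ ∈ Ioo c d) (h₂ : y₂ ∈ Ioo c d)
    (hlt : y₂ < y₁) (h : V y₂ ∈ profileStableSet p τ y₂) : V y₁ ∈ profileStableSet p τ y₁ := by
  obtain ⟨b, f, hy, hf, he, hz⟩ := h
  -- `V` need not reach back to `τ`, nor `f` forward to `y₁`; gluing at `y₂` does both.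
  have hg := hf.isSystemSol.glue hV hy h₂ hz.symm
  obtain ⟨hode, hdata⟩ := hg.solvesSimilarityODE hp
  have hy₁ : y₁ ∈ Ioo τ d := ⟨hy.1.trans hlt, h₁.2⟩
  refine ⟨d, _, hy₁, hode, fun i => ?_, ?_⟩
  · refine (he i).congr_left ?_
    filter_upwards [Ioo_mem_nhdsGT hy.1] with y hyy
    have := congrFun (hdata y ⟨hyy.1, hyy.2.trans h₂.2⟩) i
    rw [if_pos hyy.2.le] at this
    exact this.symm
  · rw [hdata y₁ hy₁, if_neg (not_le.2 hlt)]

/-- Near a point of the stable set, the blow-up point is a `C¹` function of the Cauchy data whose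
differential does not vanish. -/
lemma exists_contDiffAt_blowUpPoint {p y₀ y₁ : ℝ} (hp : 1 < p) {z : Fin 4 → ℝ}
    (hz : z ∈ profileStableSet p y₀ y₁) :
    ∃ τ : (Fin 4 → ℝ) → ℝ, ContDiffAt ℝ 1 τ z ∧ fderiv ℝ τ z ≠ 0 ∧
      ∀ᶠ w in 𝓝 z, w ∈ profileStableSet p (τ w) y₁ := by
  obtain ⟨b, f, hy₁, hode, he, rfl⟩ := hz
  obtain ⟨T, hT, hT0, hTm⟩ := exists_blowUpPoint hp y₀
  set P₀ : ℝ × ℝ × ℝ × ℝ × ℝ := (1, 1, 1, 0, y₀) with hP₀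
  have hsys := hode.isSystemSol
  have hfd0 : fderiv ℝ T P₀ (0, 0, 0, 0, 1) = 1 := by
    have h1 := (hT.differentiableAt one_ne_zero).hasFDerivAt.comp_hasDerivAt y₀
      (hasDerivAt_line_snd P₀ y₀)
    have h2 : HasDerivAt (T ∘ fun s : ℝ => (P₀.1, P₀.2.1, P₀.2.2.1, P₀.2.2.2.1, s)) 1 y₀ :=
      (hasDerivAt_id y₀).congr_of_eventuallyEq hT0
    exact h1.unique h2
  have hgood : ∀ᶠ P in 𝓝 P₀, ContDiffAt ℝ 1 T P ∧ fderiv ℝ T P (0, 0, 0, 0, 1) ≠ 0 ∧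
      (0 < P.2.2.2.1 → toData p P ∈ profileStableSet p (T P) P.2.2.2.2) := by
    refine (hT.eventually (by simp)).and (Eventually.and ?_ hTm)
    have hc : ContinuousAt (fun P => fderiv ℝ T P (0, 0, 0, 0, 1)) P₀ :=
      ((hT.fderiv_right (m := 0) (by norm_num)).continuousAt).clm_apply continuousAt_const
    exact hc.eventually_ne (by rw [hfd0]; exact one_ne_zero)
  have hpos : ∀ᶠ y in 𝓝[>] y₀, 0 < cauchyData f y 0 := by
    have hmem : ∀ᶠ y in 𝓝[>] y₀, y₀ < y := self_mem_nhdsWithin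
    exact (he 0).eventually_pos (hmem.mono fun y hy => by simpa using blowUpProfile_pos hp hy)
  obtain ⟨e, hey, hes⟩ := mem_nhdsGT_iff_exists_Ioo_subset.1
    (((tendsto_ofData hp he).eventually hgood.eventually_nhds).and
      (hpos.and (Ioo_mem_nhdsGT hy₁.1)))
  -- `y₂` is so close to `y₀` that the desingularized state lies where `T` is controlled.
  obtain ⟨y₂, hy₂⟩ := exists_between (show y₀ < e from hey)
  obtain ⟨hgood₂, hpos₂, hlt⟩ := hes hy₂
  have hy₂b : y₂ ∈ Ioo y₀ b := ⟨hy₂.1, hlt.2.trans hy₁.2⟩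
  set P₂ := ofData p (cauchyData f y₂) y₂ with hP₂
  -- the blow-up point as a function of the Cauchy data at `y₂`
  set G : (Fin 4 → ℝ) × ℝ → ℝ := fun q => T (ofData p q.1 q.2) with hG
  have hGd : ContDiffAt ℝ 1 G (cauchyData f y₂, y₂) :=
    ContDiffAt.comp (cauchyData f y₂, y₂) hgood₂.self_of_nhds.1 (contDiffAt_ofData hp hpos₂ y₂)
  have hGf := (hGd.differentiableAt one_ne_zero).hasFDerivAt
  set L := fderiv ℝ G (cauchyData f y₂, y₂) with hL
  have hGmem : ∀ᶠ w in 𝓝 (cauchyData f y₂), w ∈ profileStableSet p (G (w, y₂)) y₂ := by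
    have hc : ContinuousAt (fun w => ofData p w y₂) (cauchyData f y₂) :=
      ContinuousAt.comp (g := fun q : (Fin 4 → ℝ) × ℝ => ofData p q.1 q.2)
        (f := fun w => (w, y₂)) (contDiffAt_ofData hp hpos₂ y₂).continuousAt
        (continuousAt_id.prodMk continuousAt_const)
    have h0 : ∀ᶠ w in 𝓝 (cauchyData f y₂), 0 < w 0 :=
      (continuous_apply 0).continuousAt.eventually (lt_mem_nhds hpos₂)
    filter_upwards [hc.eventually hgood₂, h0] with w hw hw0
    have := hw.2.2 (ofData_pos hp hw0 y₂)
    rwa [toData_ofData hp hw0] at this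
  have hL1 : L (0, 1) ≠ 0 := by
    have h1 := hGf.comp_hasDerivAt y₂
      ((hasDerivAt_const y₂ (cauchyData f y₂)).prodMk (hasDerivAt_id y₂))
    have h2 := (hgood₂.self_of_nhds.1.differentiableAt one_ne_zero).hasFDerivAt.comp_hasDerivAt y₂
      (hasDerivAt_line_snd P₂ y₂)
    have h3 := h1.unique h2
    rw [h3]
    exact hgood₂.self_of_nhds.2.1
  -- Along the solution the predicted blow-up point is constantly `y₀`, by uniqueness. Subtracting
  -- `hL1`, a displacement of the data along the field alone changes it at a nonzero rate.
  have hL2 : L (similarityField p y₂ (cauchyData f y₂), 1) = 0 := by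
    have h1 := HasFDerivAt.comp_hasDerivAt (f := fun y => (cauchyData f y, id y)) y₂ hGf
      ((hsys y₂ hy₂b).prodMk (hasDerivAt_id y₂))
    have h2 : (G ∘ fun y => (cauchyData f y, id y)) =ᶠ[𝓝 y₂] fun _ => y₀ := by
      filter_upwards [Ioo_mem_nhds hy₂.1 hy₂.2] with y hy
      obtain ⟨g1, g2, g3⟩ := hes hy
      have h3 := g1.self_of_nhds.2.2 (ofData_pos hp g2 y)
      rw [toData_ofData hp g2] at h3
      have h4 : cauchyData f y ∈ profileStableSet p y₀ y :=
        ⟨b, f, ⟨g3.1, g3.2.trans hy₁.2⟩, hode, he, rfl⟩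
      exact blowUpData_unique hp (profileStableSet_subset hp h3) (profileStableSet_subset hp h4)
    exact h1.unique ((hasDerivAt_const y₂ y₀).congr_of_eventuallyEq h2)
  have hτ₂ : HasFDerivAt (fun w => G (w, y₂)) (L.comp (ContinuousLinearMap.inl ℝ (Fin 4 → ℝ) ℝ))
      (cauchyData f y₂) :=
    HasFDerivAt.comp (g := G) (cauchyData f y₂) hGf
      (hasFDerivAt_prodMk_left (cauchyData f y₂) y₂)
  have hτ₂ne : L.comp (ContinuousLinearMap.inl ℝ (Fin 4 → ℝ) ℝ) ≠ 0 := by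
    intro h0
    have h1 : L (similarityField p y₂ (cauchyData f y₂), 0) = 0 :=
      DFunLike.congr_fun h0 (similarityField p y₂ (cauchyData f y₂))
    have h2 : L (similarityField p y₂ (cauchyData f y₂), 1) =
        L (similarityField p y₂ (cauchyData f y₂), 0) + L (0, 1) := by
      rw [← map_add]; simp
    rw [hL2, h1, zero_add] at h2
    exact hL1 h2.symm
  -- transport along the flow
  obtain ⟨Φ, hΦ, hΦz, hΦs⟩ := exists_flow hp hsys hy₁ hy₂b
  obtain ⟨Ψ, hΨ, hΨz, hΨs⟩ := exists_flow hp hsys hy₂b hy₁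
  have hτ₁ : ContDiffAt ℝ 1 (fun w => G (Φ w, y₂)) (cauchyData f y₁) := by
    have h1 : ContDiffAt ℝ 1 G (Φ (cauchyData f y₁), y₂) := by rw [hΦz]; exact hGd
    exact ContDiffAt.comp (g := G) (f := fun w => (Φ w, y₂)) (cauchyData f y₁) h1
      (hΦ.prodMk contDiffAt_const)
  refine ⟨fun w => G (Φ w, y₂), hτ₁, ?_, ?_⟩
  · intro h0
    have hτ₁d : HasFDerivAt (fun w => G (Φ w, y₂)) (0 : (Fin 4 → ℝ) →L[ℝ] ℝ)
        (Ψ (cauchyData f y₂)) := by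
      rw [hΨz, ← h0]
      exact (hτ₁.differentiableAt one_ne_zero).hasFDerivAt
    have h1 := hτ₁d.comp (cauchyData f y₂) (hΨ.differentiableAt one_ne_zero).hasFDerivAt
    -- `Φ ∘ Ψ` is the identity near the data at `y₂`, so a zero differential at `y₁` would pull back
    -- to a zero differential at `y₂`.
    have hinv : ∀ᶠ w in 𝓝 (cauchyData f y₂), Φ (Ψ w) = w := by
      have hΨc : Tendsto Ψ (𝓝 (cauchyData f y₂)) (𝓝 (cauchyData f y₁)) := by
        rw [← hΨz]; exact hΨ.continuousAt
      filter_upwards [hΨs, hΨc.eventually hΦs] with w hw hw'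
      obtain ⟨c, d, V, hV, m1, m2, hV1, hV2⟩ := hw
      obtain ⟨c', d', V', hV', m1', m2', hV1', hV2'⟩ := hw'
      rw [← hV2', ← hV1]
      have i1 : y₁ ∈ Ioo (max c c') (min d d') :=
        ⟨max_lt m2.1 m1'.1, lt_min m2.2 m1'.2⟩
      have i2 : y₂ ∈ Ioo (max c c') (min d d') :=
        ⟨max_lt m1.1 m2'.1, lt_min m1.2 m2'.2⟩
      exact (hV'.mono (Ioo_subset_Ioo (le_max_right _ _) (min_le_right _ _))).eqOn hp
        (hV.mono (Ioo_subset_Ioo (le_max_left _ _) (min_le_left _ _))) i1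
        (hV1'.trans hV2.symm) i2
    have h2 := hτ₂.congr_of_eventuallyEq (f₁ := (fun w => G (Φ w, y₂)) ∘ Ψ)
      (hinv.mono fun w hw => by simp only [Function.comp, hw])
    refine hτ₂ne (h2.unique h1 |>.trans ?_)
    ext; simp
  · have hΦc : Tendsto Φ (𝓝 (cauchyData f y₁)) (𝓝 (cauchyData f y₂)) := by
      rw [← hΦz]; exact hΦ.continuousAt
    filter_upwards [hΦs, hΦc.eventually hGmem] with w hw hw'
    obtain ⟨c, d, V, hV, m1, m2, hV1, hV2⟩ := hw
    rw [← hV2] at hw'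
    have := mem_profileStableSet_of_isSystemSol hp hV m1 m2 hlt.2 hw'
    rw [hV1, hV2] at this
    exact this

/-! ### Charts -/

/-- A real `C¹` function with nonvanishing differential is a coordinate of a `C¹` chart. -/
lemma exists_chart_of_fderiv_ne_zero {n : ℕ} {τ : (Fin n → ℝ) → ℝ} {z : Fin n → ℝ}
    (hτ : ContDiffAt ℝ 1 τ z) (hne : fderiv ℝ τ z ≠ 0) (i₀ : Fin n) {s : Set (Fin n → ℝ)}
    (hs : s ∈ 𝓝 z) :
    ∃ e : OpenPartialHomeomorph (Fin n → ℝ) (Fin n → ℝ), z ∈ e.source ∧ IsC1Chart e ∧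
      e.source ⊆ s ∧ ∀ w, e w i₀ = τ w := by
  obtain ⟨j, hj⟩ : ∃ j, fderiv ℝ τ z (Pi.single j 1) ≠ 0 := by
    by_contra! h
    refine hne (ContinuousLinearMap.coe_injective (LinearMap.pi_ext' fun j => ?_))
    ext
    simpa using h j
  -- `τ` replaces the coordinate `j`, in which its derivative is nonzero; the swap places it at the
  -- prescribed index `i₀`.
  set σ := Equiv.swap i₀ j with hσ
  set F : (Fin n → ℝ) → Fin n → ℝ := fun w i => if i = i₀ then τ w else w (σ i) with hF
  set L : (Fin n → ℝ) →L[ℝ] (Fin n → ℝ) := ContinuousLinearMap.pi fun i =>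
    if i = i₀ then fderiv ℝ τ z else ContinuousLinearMap.proj (σ i) with hL
  have hFd : HasFDerivAt F L z := by
    rw [hasFDerivAt_pi]
    intro i
    by_cases hi : i = i₀
    · simpa [hF, hL, hi] using (hτ.differentiableAt one_ne_zero).hasFDerivAt
    · simp only [if_neg hi]
      exact hasFDerivAt_apply (σ i) z
  have hFc : ContDiffAt ℝ 1 F z := by
    rw [contDiffAt_pi]
    intro i
    by_cases hi : i = i₀
    · simpa only [hF, hi, if_true] using hτ
    · simp only [hF, if_neg hi]
      exact (contDiff_apply ℝ ℝ (σ i)).contDiffAt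
  have hLinj : Function.Injective (L : (Fin n → ℝ) →ₗ[ℝ] (Fin n → ℝ)) := by
    rw [← LinearMap.ker_eq_bot, LinearMap.ker_eq_bot']
    intro v hv
    have hv0 : fderiv ℝ τ z v = 0 := by
      have := congrFun hv i₀
      simpa [hL] using this
    have hvk : ∀ k, k ≠ j → v k = 0 := by
      intro k hk
      have h1 : σ.symm k ≠ i₀ := by
        intro h
        rw [Equiv.symm_apply_eq, hσ, Equiv.swap_apply_left] at h
        exact hk h
      have := congrFun hv (σ.symm k)
      simpa [hL, h1] using this
    have hvs : v = v j • Pi.single j 1 := by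
      ext k
      by_cases hk : k = j
      · subst hk; simp
      · simp [hvk k hk, hk]
    rw [hvs, map_smul, smul_eq_mul, mul_eq_zero] at hv0
    rw [hvs, hv0.resolve_right hj, zero_smul]
  set L' : (Fin n → ℝ) ≃L[ℝ] (Fin n → ℝ) :=
    (LinearEquiv.ofInjectiveEndo _ hLinj).toContinuousLinearEquiv with hL'
  have hFd' : HasFDerivAt F (L' : (Fin n → ℝ) →L[ℝ] (Fin n → ℝ)) z := by
    refine hFd.congr_fderiv ?_
    ext v : 1
    rfl
  set e := hFc.toOpenPartialHomeomorph F hFd' one_ne_zero with he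
  have hecoe : (e : (Fin n → ℝ) → Fin n → ℝ) = F := rfl
  have hze : z ∈ e.source := hFc.mem_toOpenPartialHomeomorph_source hFd' one_ne_zero
  have hsymm : ContDiffAt ℝ 1 e.symm (e z) := by
    refine e.contDiffAt_symm (f₀' := L') (e.map_source hze) ?_ ?_
    · rw [e.left_inv hze]; exact hFd'
    · rw [e.left_inv hze]; exact hFc
  -- The inverse function theorem gives regularity at one point only; shrinking the source makes
  -- both directions `C¹` throughout.
  have hev : ∀ᶠ w in 𝓝 z, w ∈ s ∧ ContDiffAt ℝ 1 e w ∧ ContDiffAt ℝ 1 e.symm (e w) :=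
    (eventually_mem_set.2 hs).and ((hFc.eventually (by simp)).and
      ((e.continuousAt hze).eventually (hsymm.eventually (by simp))))
  obtain ⟨O, hO, hOo, hzO⟩ := eventually_nhds_iff.1 hev
  refine ⟨e.restrOpen O hOo, ⟨hze, hzO⟩, ⟨?_, ?_⟩, fun w hw => (hO w hw.2).1, fun w => ?_⟩
  · exact fun w hw => (hO w hw.2).2.1.contDiffWithinAt
  · intro w hw
    have h1 := (hO (e.symm w) hw.2).2.2
    rw [e.right_inv hw.1] at h1
    exact h1.contDiffWithinAt
  · change F w i₀ = τ w
    simp [hF]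

/-- `τ - c` is made the coordinate of index `3`, the only one required to vanish in a slice of
dimension `3` in `ℝ⁴`. -/
lemma isC1Submanifold_three {S : Set (Fin 4 → ℝ)} (h : ∀ z ∈ S, ∃ (τ : (Fin 4 → ℝ) → ℝ) (c : ℝ),
    ContDiffAt ℝ 1 τ z ∧ fderiv ℝ τ z ≠ 0 ∧ ∀ᶠ w in 𝓝 z, w ∈ S ↔ τ w = c) :
    IsC1Submanifold 3 S := by
  refine ⟨by norm_num, fun z hz => ?_⟩
  obtain ⟨τ, c, hτ, hne, hev⟩ := h z hz
  obtain ⟨e, h1, h2, h3, h4⟩ := exists_chart_of_fderiv_ne_zero (τ := fun w => τ w - c)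
    (hτ.sub contDiffAt_const) (by rwa [fderiv_sub_const]) 3 hev
  refine ⟨e, h1, h2, fun w hw => ?_⟩
  rw [show (w ∈ S ↔ τ w = c) from h3 hw, ← sub_eq_zero, ← h4 w]
  constructor
  · intro h0 i hi
    rwa [show i = 3 by apply Fin.ext; have := i.2; simp; omega]
  · exact fun h0 => h0 3 (by norm_num)

/-! ### The set of all blow-up solutions -/

lemma neg_mem_blowUpData {p y₀ y₁ : ℝ} {z : Fin 4 → ℝ} (h : z ∈ blowUpData p y₀ y₁) :
    -z ∈ blowUpData p y₀ y₁ := by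
  obtain ⟨b, f, hy, hf, rfl⟩ := h
  exact ⟨b, -f, hy, hf.neg, (cauchyData_neg f y₁).symm⟩

/-- Every nearby `w` lies in the stable set for `τ w`, so uniqueness of the blow-up point excludes
every other `c`. The same argument shows that the two sets agree near `z`. -/
lemma exists_blowUpPoint_of_mem_profileStableSet {p y₀ y₁ : ℝ} (hp : 1 < p) {z : Fin 4 → ℝ}
    (hz : z ∈ profileStableSet p y₀ y₁) :
    ∃ τ : (Fin 4 → ℝ) → ℝ, ContDiffAt ℝ 1 τ z ∧ fderiv ℝ τ z ≠ 0 ∧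
      ∀ᶠ w in 𝓝 z, ∀ c, (w ∈ profileStableSet p c y₁ ↔ τ w = c) ∧
        (w ∈ blowUpData p c y₁ ↔ τ w = c) := by
  obtain ⟨τ, hτ, hne, hev⟩ := exists_contDiffAt_blowUpPoint hp hz
  refine ⟨τ, hτ, hne, hev.mono fun w hw c => ⟨⟨fun h => ?_, ?_⟩, fun h => ?_, ?_⟩⟩
  · exact blowUpData_unique hp (profileStableSet_subset hp hw) (profileStableSet_subset hp h)
  · rintro rfl; exact hw
  · exact blowUpData_unique hp (profileStableSet_subset hp hw) h
  · rintro rfl; exact profileStableSet_subset hp hw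

/-- The negative branch follows from the positive one through `w ↦ -w`, which preserves the blow-up
point. -/
lemma exists_blowUpPoint_of_mem_blowUpData {p y₀ y₁ : ℝ} (hp : 1 < p) {z : Fin 4 → ℝ}
    (hz : z ∈ blowUpData p y₀ y₁) :
    ∃ τ : (Fin 4 → ℝ) → ℝ, ContDiffAt ℝ 1 τ z ∧ fderiv ℝ τ z ≠ 0 ∧
      ∀ᶠ w in 𝓝 z, ∀ c, w ∈ blowUpData p c y₁ ↔ τ w = c := by
  rw [blowUpData_eq hp] at hz
  rcases hz with hz | hz
  · obtain ⟨τ, hτ, hne, hev⟩ := exists_blowUpPoint_of_mem_profileStableSet hp hz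
    exact ⟨τ, hτ, hne, hev.mono fun w hw c => (hw c).2⟩
  · obtain ⟨τ, hτ, hne, hev⟩ := exists_blowUpPoint_of_mem_profileStableSet hp hz
    have hneg : HasFDerivAt (fun w : Fin 4 → ℝ => -w)
      (-ContinuousLinearMap.id ℝ (Fin 4 → ℝ)) z := (hasFDerivAt_id z).neg
    have hd := (hτ.differentiableAt one_ne_zero).hasFDerivAt.comp z hneg
    refine ⟨τ ∘ fun w => -w, ContDiffAt.comp z hτ contDiff_neg.contDiffAt, ?_, ?_⟩
    · rw [hd.fderiv]
      intro h0
      refine hne ?_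
      ext v
      simpa using DFunLike.congr_fun h0 v
    · filter_upwards [(continuous_neg.tendsto z).eventually hev] with w hw c
      rw [Function.comp, ← (hw c).2]
      exact ⟨neg_mem_blowUpData, fun h => by simpa using neg_mem_blowUpData h⟩

lemma exists_blowUpPoint_chart {p y₁ : ℝ} (hp : 1 < p) {x : Fin 4 → ℝ}
    (hx : x ∈ ⋃ y₀ : ℝ, blowUpData p y₀ y₁) :
    ∃ e : OpenPartialHomeomorph (Fin 4 → ℝ) (Fin 4 → ℝ), x ∈ e.source ∧ IsC1Chart e ∧
      ∀ z ∈ e.source, ∀ y₀ : ℝ, z ∈ blowUpData p y₀ y₁ ↔ e z 0 = y₀ := by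
  obtain ⟨y₀, hx⟩ := mem_iUnion.1 hx
  obtain ⟨τ, hτ, hne, hev⟩ := exists_blowUpPoint_of_mem_blowUpData hp hx
  obtain ⟨e, h1, h2, h3, h4⟩ := exists_chart_of_fderiv_ne_zero hτ hne 0 hev
  exact ⟨e, h1, h2, fun z hz c => by rw [h4]; exact h3 hz c⟩

end

theorem proposition2p1 (p : ℝ) (hp : 1 < p) :
    -- the explicit profile
    (0 < blowUpAmp p ∧ blowUpAmp p ^ (p - 1) = eulerPhi (-(4 / (p - 1))) ∧
      ∀ y₀ : ℝ, ∀ y ∈ Ioi y₀, iteratedDeriv 4 (blowUpProfile p y₀) y =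
        |blowUpProfile p y₀ y| ^ (p - 1) * blowUpProfile p y₀ y) ∧
    -- the linearization of `f'''' - |f|^{p-1} f` about the profile is Euler's operator
    (∀ (y₀ : ℝ) (Y : ℝ → ℝ), ContDiffOn ℝ 4 Y (Ioi y₀) → ∀ y ∈ Ioi y₀,
      HasDerivAt
        (fun ε : ℝ => iteratedDeriv 4 (fun x => blowUpProfile p y₀ x + ε * Y x) y -
          |blowUpProfile p y₀ y + ε * Y y| ^ (p - 1) * (blowUpProfile p y₀ y + ε * Y y))
        (iteratedDeriv 4 Y y - p * eulerPhi (-(4 / (p - 1))) / (y - y₀) ^ 4 * Y y) 0) ∧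
    -- the characteristic equation for the powers `Y = (y - y₀)^m`
    (∀ (y₀ : ℝ) (m : ℂ),
      (∀ y ∈ Ioi y₀,
        ((y - y₀ : ℝ) : ℂ) ^ 4 * iteratedDeriv 4 (fun x : ℝ => ((x - y₀ : ℝ) : ℂ) ^ m) y =
          (p : ℂ) * eulerPhi (-(4 / ((p : ℂ) - 1))) * ((y - y₀ : ℝ) : ℂ) ^ m) ↔
      eulerPhi m = (p : ℂ) * eulerPhi (-(4 / ((p : ℂ) - 1)))) ∧
    -- its four roots, and the three-dimensional space of linearized solutions that are `o(f₀)`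
    (∃ mplus mminus ω : ℝ, 3 < mplus ∧ mminus < -(4 / (p - 1)) ∧ 0 < ω ∧
      (∀ m : ℂ, eulerPhi m = (p : ℂ) * eulerPhi (-(4 / ((p : ℂ) - 1))) ↔
        m = mplus ∨ m = mminus ∨
          m = 3 / 2 + (ω : ℂ) * Complex.I ∨ m = 3 / 2 - (ω : ℂ) * Complex.I) ∧
      ∀ (y₀ : ℝ) (Y : ℝ → ℝ),
        (SolvesEuler p y₀ Y ∧ Y =o[𝓝[>] y₀] blowUpProfile p y₀) ↔
        ∃ C₁ C₂ C₃ : ℝ, ∀ y ∈ Ioi y₀,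
          Y y = C₁ * (y - y₀) ^ mplus +
            (y - y₀) ^ (3 / 2 : ℝ) * (C₂ * Real.cos (ω * Real.log (y - y₀)) +
              C₃ * Real.sin (ω * Real.log (y - y₀)))) ∧
    -- for each fixed blow-up point the blow-up solutions are those on the stable manifolds of
    -- `f₀` and `-f₀`, which are nonempty and three-dimensional
    (∀ y₀ : ℝ, ∃ δ > 0, ∀ y₁ ∈ Ioo y₀ (y₀ + δ), (profileStableSet p y₀ y₁).Nonempty) ∧
    (∀ y₀ y₁ : ℝ, y₀ < y₁ →
      IsC1Submanifold 3 (profileStableSet p y₀ y₁) ∧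
      IsC1Submanifold 3 (blowUpData p y₀ y₁) ∧
      blowUpData p y₀ y₁ =
        profileStableSet p y₀ y₁ ∪ {z | -z ∈ profileStableSet p y₀ y₁}) ∧
    -- all blow-up solutions together form a four-dimensional set, and the blow-up point `y₀`
    -- can be taken as one of the four local coordinates
    (∀ y₁ : ℝ,
      IsC1Submanifold 4 (⋃ y₀ : ℝ, blowUpData p y₀ y₁) ∧
      ∀ x ∈ ⋃ y₀ : ℝ, blowUpData p y₀ y₁,
        ∃ e : OpenPartialHomeomorph (Fin 4 → ℝ) (Fin 4 → ℝ),
          x ∈ e.source ∧ IsC1Chart e ∧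
            ∀ z ∈ e.source, ∀ y₀ : ℝ, z ∈ blowUpData p y₀ y₁ ↔ e z 0 = y₀) := by

  refine ⟨⟨blowUpAmp_pos hp, blowUpAmp_rpow hp, fun y₀ y hy => blowUpProfile_ode hp hy⟩,
    fun y₀ Y hY y hy => hasDerivAt_linearization hp hY hy, fun y₀ m => euler_cpow_iff y₀ m _,
    euler_classification hp, exists_mem_profileStableSet hp, fun y₀ y₁ _ => ⟨?_, ?_, ?_⟩,
    fun y₁ => ⟨⟨le_rfl, fun x hx => ?_⟩, fun x hx => exists_blowUpPoint_chart hp hx⟩⟩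
  · refine isC1Submanifold_three fun z hz => ?_
    obtain ⟨τ, hτ, hne, hev⟩ := exists_blowUpPoint_of_mem_profileStableSet hp hz
    exact ⟨τ, y₀, hτ, hne, hev.mono fun w hw => (hw y₀).1⟩
  · refine isC1Submanifold_three fun z hz => ?_
    obtain ⟨τ, hτ, hne, hev⟩ := exists_blowUpPoint_of_mem_blowUpData hp hz
    exact ⟨τ, y₀, hτ, hne, hev.mono fun w hw => hw y₀⟩
  · exact blowUpData_eq hp
  · obtain ⟨e, h1, h2, h3⟩ := exists_blowUpPoint_chart hp hx
    -- In full dimension the slice condition is vacuous, so the whole chart domain must lie in the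
    -- union: `z` belongs to the set with blow-up point `e z 0`.
    refine ⟨e, h1, h2, fun z hz => iff_of_true ?_ fun i hi => absurd i.2 (not_lt.2 hi)⟩
    exact mem_iUnion.2 ⟨e z 0, (h3 z hz _).2 rfl⟩
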